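/- Let $K$ be a field, let $E=(E^0,E^1,s,r)$ be a directed graph of arbitrary size, and let $L_K(E)$ be its Leavitt path algebra, i.e. the (not necessarily unital) $K$-algebra generated by $E^0\cup E^1\cup\{e^*\mid e\in E^1\}$ with the relations $vw=\delta_{v,w}v$ for $v,w\in E^0$; $s(e)e=e=e\,r(e)$ and $r(e)e^*=e^*=e^*s(e)$ for $e\in E^1$; $e^*f=\delta_{e,f}\,r(e)$ for $e,f\in E^1$; and $v=\sum_{s(e)=v}ee^*$ for each regular vertex $v$ (one that emits at least one and only finitely many edges). It is $\mathbb Z$-graded: the $n$-th component is the $K$-span of the elements $pq^*$ for paths $p,q$ with $|p|-|q|=n$. *Graphs.* Paths are finite and may consist of a single vertex; write $u\ge v$ if there is a path from $u$ to $v$, and $R(v)=\{u\mid u\ge v\}$, $R(V)=\bigcup_{v\in V}R(v)$. A set $V\subseteq E^0$ is downwards directed if it is nonempty and any two elements of $V$ have a common lower bound in $V$ with respect to $\ge$; it has the Inner Countable Separation Property (ICSP) if $V\subseteq R(C)$ for a countable $C\subseteq V$. A cycle is a closed path of positive length whose edges have pairwise distinct sources; cycles differing only by the starting vertex are identified, and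 $c^0$ is the set of vertices of $c$. A cycle is exclusive if no vertex on it lies on another cycle. A cycle $c$ is extreme in $V$ if $c^0\subseteq V$, some edge not in $c$ has source in $c^0$ and range in $V$, and for every path $p$ with vertices in $V$ that starts in $c^0$ there is a path with vertices in $V$ from the range of $p$ to a vertex of $c^0$. An infinite path $\alpha=e_1e_2\ldots$ has vertex set $\alpha^0=\{s(e_n)\mid n\ge 1\}$; it is strictly decreasing if $\alpha=p_1p_2\cdots$ for finite paths $p_n$ with $s(p_n)\ge s(p_{n+1})$ and $s(p_{n+1})\not\ge s(p_n)$ for all $n$. *Graded ideals.* A set $H\subseteq E^0$ is hereditary if $u\in H$ and $u\ge v$ imply $v\in H$, and saturated if it contains every regular vertex $v$ with $r(s^{-1}(v))\subseteq H$. Let $B_H$ be the set of $v\in E^0-H$ that emit infinitely many edges, of which a finite nonzero number have range in $E^0-H$; for such $v$ put $v^H=v-\sum ee^*$, the sum over $e\in s^{-1}(v)$ with $r(e)\notin H$. An admissible pair is a pair $(H,S)$ with $H$ hereditary and saturated and $S\subseteq B_H$; $I(H,S)$ is the ideal generated by $H\cup\{v^H\mid v\in S\}$. *Graded primitivity.*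 A $\mathbb Z$-graded (left or right) module $M$ over a graded ring $R$ is graded simple if the action of $R$ on $M$ is nonzero and $M$ has no graded submodules other than $0$ and $M$. A graded ideal is graded primitive if it is the annihilator of a graded simple left module and the annihilator of a graded simple right module. **Theorem.** For an ideal $P$ of $L_K(E)$, the following conditions are equivalent. 1. $P$ is graded primitive. 2. $P=I(H,S)$ for an admissible pair $(H,S)$ such that $E^0-H$ is downwards directed and has ICSP, and either $S=B_H$ or $S=B_H-\{u\}$ for some $u\in B_H$ with $E^0-H=R(u)$. 3. Exactly one of the following holds (in each of them the pair in $I(\cdot,\cdot)$ is required to be admissible). - (a) $P=I(H,B_H)$ where $H=E^0-R(\alpha^0)$ for a strictly decreasing infinite path $\alpha$ such that $R(v)\subsetneq R(\alpha^0)$ for all $v\in E^0-H$. - (b) $P=I(H,B_H)$ where $H=E^0-R(v)$ for a vertex $v$ that emits no edges with range in $E^0-H$. - (c) $P=I(H,S)$ where $H=E^0-R(v)$ for a vertex $v$ on a cycle $c$ that is extreme in $E^0-H$, and $S=B_H$ or $S=B_H-\{u\}$ for some $u\in B_H$ on $c$. - (d) $P=I(H,S)$ where $H=E^0-R(v)$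 for a vertex $v$ on an exclusive cycle $c$, and $S=B_H$ or $S=B_H-\{u\}$ for some $u\in B_H$ on $c$. -/

import Mathlib

universe u v w

/-- A directed graph with vertex set `V`, edge set `E`, source map `s` and range map `r`
(any cardinality, parallel edges and loops allowed). -/
structure DirGraph (V : Type v) (E : Type w) where
  s : E → V
  r : E → V

namespace DirGraph

section Graphs

variable {V : Type v} {E : Type w} (G : DirGraph V E)

/-- `G.IsPath a p b`: the list of edges `p` is a (finite) path with source `a` and range `b`.
The empty list is the path consisting of a single vertex. -/
inductive IsPath : V → List E → V → Prop
  | nil (a : V) : IsPath a [] a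
  | cons (e : E) {p : List E} {b : V} : IsPath (G.r e) p b → IsPath (G.s e) (e :: p) b

/-- The set `p⁰` of the vertices on a path `p` with source `a`. -/
def pathVertices (a : V) (p : List E) : Set V :=
  {x | x = a ∨ ∃ e ∈ p, x = G.r e}

/-- `a ≥ b`: there is a path from `a` to `b`. -/
def Geq (a b : V) : Prop := ∃ p, G.IsPath a p b

/-- The root `R(A)` of a set `A` of vertices. -/
def rootSet (A : Set V) : Set V := {x | ∃ a ∈ A, G.Geq x a}

/-- The root `R(a)` of a vertex `a`. -/
def root (a : V) : Set V := {x | G.Geq x a}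

/-- The set `s⁻¹(a)` of the edges which `a` emits. -/
def emitted (a : V) : Set E := {e | G.s e = a}

/-- A vertex is regular if it emits at least one and only finitely many edges. -/
def IsRegular (a : V) : Prop := (G.emitted a).Nonempty ∧ (G.emitted a).Finite

def IsInfiniteEmitter (a : V) : Prop := (G.emitted a).Infinite

/-- A cycle: a closed path of positive length in which the edges have pairwise different sources. -/
def IsCycle (c : List E) : Prop :=
  c ≠ [] ∧ (∃ a, G.IsPath a c a) ∧ (c.map G.s).Nodup

/-- The set `c⁰` of the vertices on a cycle `c`. -/
def cycleVertices (c : List E) : Set V := {x | ∃ e ∈ c, G.s e = x}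

/-- A cycle is exclusive if no vertex on it is on a cycle distinct from it. Cycles which differ
only in the choice of the starting vertex are considered to be the same cycle. -/
def IsExclusive (c : List E) : Prop :=
  G.IsCycle c ∧
    ∀ d, G.IsCycle d → (∃ x ∈ G.cycleVertices c, x ∈ G.cycleVertices d) → d.IsRotated c

/-- The cycle `c` is extreme in the set `A` of vertices: `c⁰ ⊆ A`, `c` has an exit with range in
`A`, and every path in `A` which starts on `c` can be continued by a path in `A` back to `c`. -/
def IsExtremeIn (A : Set V) (c : List E) : Prop :=
  G.IsCycle c ∧ G.cycleVertices c ⊆ A ∧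
    (∃ e, G.s e ∈ G.cycleVertices c ∧ e ∉ c ∧ G.r e ∈ A) ∧
    ∀ a p b, a ∈ G.cycleVertices c → G.IsPath a p b → G.pathVertices a p ⊆ A →
      ∃ q, ∃ x ∈ G.cycleVertices c, G.IsPath b q x ∧ G.pathVertices b q ⊆ A

/-- The sequence of edges `α 0, α 1, …` is an infinite path. -/
def IsInfinitePath (α : ℕ → E) : Prop := ∀ n, G.r (α n) = G.s (α (n + 1))

/-- The set `α⁰` of the vertices of an infinite path `α`. -/
def infinitePathVertices (α : ℕ → E) : Set V := Set.range fun n => G.s (α n)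

/-- The infinite path `α` is strictly decreasing: it is a concatenation `p₁ p₂ …` of finite paths
such that the sources of the paths `pₙ` strictly decrease in the preorder `≥`. The number `k n` is
the position at which the `n`-th of these paths starts. -/
def IsStrictlyDecreasing (α : ℕ → E) : Prop :=
  G.IsInfinitePath α ∧ ∃ k : ℕ → ℕ, k 0 = 0 ∧ StrictMono k ∧
    ∀ n, G.Geq (G.s (α (k n))) (G.s (α (k (n + 1)))) ∧
      ¬ G.Geq (G.s (α (k (n + 1)))) (G.s (α (k n)))

def IsHereditary (H : Set V) : Prop := ∀ a b, a ∈ H → G.Geq a b → b ∈ H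

def IsSaturated (H : Set V) : Prop :=
  ∀ a, G.IsRegular a → (∀ e, G.s e = a → G.r e ∈ H) → a ∈ H

/-- A set of vertices is downwards directed if it is nonempty and any two of its elements have a
lower bound in it. -/
def IsDownwardsDirected (A : Set V) : Prop :=
  A.Nonempty ∧ ∀ a ∈ A, ∀ b ∈ A, ∃ x ∈ A, G.Geq a x ∧ G.Geq b x

/-- The Inner Countable Separation Property. -/
def HasICSP (A : Set V) : Prop := ∃ C : Set V, C.Countable ∧ C ⊆ A ∧ A ⊆ G.rootSet C

/-- The set `s⁻¹(a) ∩ r⁻¹(E⁰ - H)`. -/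
def emittedOutside (H : Set V) (a : V) : Set E := {e | G.s e = a ∧ G.r e ∉ H}

/-- The set `B_H` of the breaking vertices of `H`. -/
def breaking (H : Set V) : Set V :=
  {a | a ∉ H ∧ G.IsInfiniteEmitter a ∧
    (G.emittedOutside H a).Nonempty ∧ (G.emittedOutside H a).Finite}

/-- `(H, S)` is an admissible pair. -/
def IsAdmissible (H S : Set V) : Prop :=
  G.IsHereditary H ∧ G.IsSaturated H ∧ S ⊆ G.breaking H

end Graphs

end DirGraph

/-- The generators of a Leavitt path algebra: vertices `a`, edges `e` and ghost edges `e*`. -/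
inductive LeavittGen (V : Type v) (E : Type w)
  | vert (a : V)
  | edge (e : E)
  | ghost (e : E)

section LeavittPathAlgebra

variable (K : Type u) [Field K] {V : Type v} {E : Type w} (G : DirGraph V E)

/-- The free non-unital associative `K`-algebra on the generators. -/
abbrev FreeLeavitt (K : Type u) [Field K] (V : Type v) (E : Type w) : Type (max u v w) :=
  MonoidAlgebra K (FreeSemigroup (LeavittGen V E))

namespace FreeLeavitt

noncomputable def vert (a : V) : FreeLeavitt K V E :=
  MonoidAlgebra.single (FreeSemigroup.of (LeavittGen.vert a)) 1

noncomputable def edge (e : E) : FreeLeavitt K V E :=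
  MonoidAlgebra.single (FreeSemigroup.of (LeavittGen.edge e)) 1

noncomputable def ghost (e : E) : FreeLeavitt K V E :=
  MonoidAlgebra.single (FreeSemigroup.of (LeavittGen.ghost e)) 1

end FreeLeavitt

open FreeLeavitt in
/-- The defining relations of `L_K(E)`: (V), (E) for the edges of the extended graph, (CK1) and
(CK2). -/
inductive LeavittRel : FreeLeavitt K V E → FreeLeavitt K V E → Prop
  | vert_mul_self (a : V) : LeavittRel (vert K a * vert K a) (vert K a)
  | vert_mul_vert (a b : V) : a ≠ b → LeavittRel (vert K a * vert K b) 0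
  | source_mul_edge (e : E) : LeavittRel (vert K (G.s e) * edge K e) (edge K e)
  | edge_mul_range (e : E) : LeavittRel (edge K e * vert K (G.r e)) (edge K e)
  | range_mul_ghost (e : E) : LeavittRel (vert K (G.r e) * ghost K e) (ghost K e)
  | ghost_mul_source (e : E) : LeavittRel (ghost K e * vert K (G.s e)) (ghost K e)
  | ghost_mul_edge_self (e : E) : LeavittRel (ghost K e * edge K e) (vert K (G.r e))
  | ghost_mul_edge (e f : E) : e ≠ f → LeavittRel (ghost K e * edge K f) 0
  | sum_edge_mul_ghost (a : V) : G.IsRegular a →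
      LeavittRel (vert K a) (∑ᶠ e ∈ G.emitted a, edge K e * ghost K e)

/-- The congruence of the free non-unital `K`-algebra generated by the defining relations. All
scalar multiples of the relations are included so that it is a congruence of `K`-algebras. -/
noncomputable def leavittCon : RingCon (FreeLeavitt K V E) :=
  ringConGen fun x y => ∃ (k : K) (x' y' : FreeLeavitt K V E),
    LeavittRel K G x' y' ∧ x = k • x' ∧ y = k • y'

/-- The Leavitt path algebra `L_K(E)`, a not necessarily unital `K`-algebra. -/
def LeavittPathAlgebra : Type (max u v w) := (leavittCon K G).Quotient

namespace LeavittPathAlgebra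

noncomputable instance : NonUnitalRing (LeavittPathAlgebra K G) :=
  inferInstanceAs (NonUnitalRing (leavittCon K G).Quotient)

variable {K G} in
theorem leavittCon_smul (k : K) {x y : FreeLeavitt K V E} (h : leavittCon K G x y) :
    leavittCon K G (k • x) (k • y) := by
  change RingConGen.Rel _ x y at h
  change RingConGen.Rel _ (k • x) (k • y)
  induction h generalizing k with
  | of x y h =>
    obtain ⟨l, x', y', h, rfl, rfl⟩ := h
    exact .of _ _ ⟨k * l, x', y', h, (mul_smul k l x').symm, (mul_smul k l y').symm⟩
  | refl x => exact .refl _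
  | symm _ ih => exact .symm (ih k)
  | trans _ _ ih₁ ih₂ => exact .trans (ih₁ k) (ih₂ k)
  | add _ _ ih₁ ih₂ => rw [smul_add, smul_add]; exact .add (ih₁ k) (ih₂ k)
  | mul _ h₂ ih₁ _ => rw [← smul_mul_assoc, ← smul_mul_assoc]; exact .mul (ih₁ k) h₂

/-- The quotient map from the free algebra onto `L_K(E)`. -/
noncomputable def mk (x : FreeLeavitt K V E) : LeavittPathAlgebra K G := ((x : (leavittCon K G).Quotient) :)

theorem mk_surjective : Function.Surjective (mk K G) := Quotient.mk''_surjective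

theorem mk_add (x y : FreeLeavitt K V E) : mk K G (x + y) = mk K G x + mk K G y := rfl

theorem mk_mul (x y : FreeLeavitt K V E) : mk K G (x * y) = mk K G x * mk K G y := rfl

theorem mk_zero : mk K G 0 = 0 := rfl

noncomputable instance : SMul K (LeavittPathAlgebra K G) where
  smul k := Quotient.map' (k • ·) fun _ _ h => leavittCon_smul k h

theorem mk_smul (k : K) (x : FreeLeavitt K V E) : mk K G (k • x) = k • mk K G x := rfl

noncomputable instance : Module K (LeavittPathAlgebra K G) where
  one_smul := (mk_surjective K G).forall.2 fun x => by rw [← mk_smul, one_smul]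
  mul_smul k l := (mk_surjective K G).forall.2 fun x => by simp only [← mk_smul, mul_smul]
  smul_zero k := by rw [← mk_zero, ← mk_smul, smul_zero]
  smul_add k := (mk_surjective K G).forall₂.2 fun x y => by
    simp only [← mk_smul, ← mk_add, smul_add]
  add_smul k l := (mk_surjective K G).forall.2 fun x => by
    simp only [← mk_smul, ← mk_add, add_smul]
  zero_smul := (mk_surjective K G).forall.2 fun x => by rw [← mk_smul, zero_smul, mk_zero]

instance : IsScalarTower K (LeavittPathAlgebra K G) (LeavittPathAlgebra K G) where
  smul_assoc k := (mk_surjective K G).forall₂.2 fun x y => by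
    simp only [smul_eq_mul, ← mk_smul, ← mk_mul, smul_mul_assoc]

instance : SMulCommClass K (LeavittPathAlgebra K G) (LeavittPathAlgebra K G) where
  smul_comm k := (mk_surjective K G).forall₂.2 fun x y => by
    simp only [smul_eq_mul, ← mk_smul, ← mk_mul, mul_smul_comm]

/-- The vertex `a` as an element of `L_K(E)`. -/
noncomputable def vert (a : V) : LeavittPathAlgebra K G := mk K G (FreeLeavitt.vert K a)

/-- The edge `e` as an element of `L_K(E)`. -/
noncomputable def edge (e : E) : LeavittPathAlgebra K G := mk K G (FreeLeavitt.edge K e)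

/-- The ghost edge `e*` as an element of `L_K(E)`. -/
noncomputable def ghost (e : E) : LeavittPathAlgebra K G := mk K G (FreeLeavitt.ghost K e)

/-- The element `p = e₁ e₂ … eₙ` of `L_K(E)` for a path `p` with source `a`. -/
noncomputable def path : V → List E → LeavittPathAlgebra K G
  | a, [] => vert K G a
  | _, e :: p => edge K G e * path (G.r e) p

/-- The element `p* = eₙ* … e₂* e₁*` of `L_K(E)` for a path `p` with source `a`. -/
noncomputable def ghostPath : V → List E → LeavittPathAlgebra K G
  | a, [] => vert K G a
  | _, e :: p => ghostPath (G.r e) p * ghost K G e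

/-- The `n`-th component of the natural `ℤ`-grading of `L_K(E)`: the `K`-linear span of the
elements `p q*` for paths `p, q` with the same range and with `|p| - |q| = n`. -/
noncomputable def component (n : ℤ) : Submodule K (LeavittPathAlgebra K G) :=
  Submodule.span K {x | ∃ (a b c : V) (p q : List E), G.IsPath a p c ∧ G.IsPath b q c ∧
    (p.length : ℤ) - q.length = n ∧ x = path K G a p * ghostPath K G b q}

/-- The natural `ℤ`-grading of `L_K(E)`. -/
noncomputable def grading (n : ℤ) : AddSubgroup (LeavittPathAlgebra K G) :=
  (component K G n).toAddSubgroup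

/-- The element `a^H = a - ∑ e e*`, the sum being taken over the edges `e` from `a` to `E⁰ - H`
(a finite set if `a` is in `B_H`). -/
noncomputable def breakingElement (H : Set V) (a : V) : LeavittPathAlgebra K G :=
  vert K G a - ∑ᶠ e ∈ G.emittedOutside H a, edge K G e * ghost K G e

/-- The ideal `I(H, S)` generated by the vertices in `H` and the elements `a^H` for `a ∈ S`. -/
noncomputable def idealOf (H S : Set V) : TwoSidedIdeal (LeavittPathAlgebra K G) :=
  TwoSidedIdeal.span (vert K G '' H ∪ breakingElement K G H '' S)

end LeavittPathAlgebra

end LeavittPathAlgebra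

section GradedPrimitive

/-- A subgroup of a graded abelian group, given by the set `N` of its elements, is graded if it
contains the homogeneous components of all of its elements. -/
def IsGradedSubgroup {A : Type u} [AddCommGroup A] (𝒜 : ℤ → AddSubgroup A) (N : Set A) : Prop :=
  ∀ f : ℤ →₀ A, (∀ n, f n ∈ 𝒜 n) → (f.sum fun _ x => x) ∈ N → ∀ n, f n ∈ N

variable {R : Type u} [NonUnitalRing R] {M : Type v} [AddCommGroup M]

/-- The biadditive map `act` makes `M` into a left `R`-module. -/
def IsLeftAction (act : R →+ M →+ M) : Prop := ∀ x y m, act (x * y) m = act x (act y m)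

/-- The biadditive map `act` (with `act x m` standing for `m x`) makes `M` into a right
`R`-module. -/
def IsRightAction (act : R →+ M →+ M) : Prop := ∀ x y m, act (x * y) m = act y (act x m)

/-- With respect to the grading `𝒜` of `R`, the (left or right) module `M` is graded by `ℳ` and it
is graded simple: the action is not zero (in particular, `M` is not zero) and the only graded
submodules of `M` are the trivial ones. -/
structure IsGradedSimple (𝒜 : ℤ → AddSubgroup R) (act : R →+ M →+ M)
    (ℳ : ℤ → AddSubgroup M) : Prop where
  isInternal : DirectSum.IsInternal ℳ
  act_mem : ∀ i j x m, x ∈ 𝒜 i → m ∈ ℳ j → act x m ∈ ℳ (i + j)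
  act_ne_zero : ∃ x m, act x m ≠ 0
  eq_bot_or_eq_top : ∀ N : AddSubgroup M, (∀ x, ∀ m ∈ N, act x m ∈ N) →
    IsGradedSubgroup ℳ (N : Set M) → N = ⊥ ∨ N = ⊤

/-- A two-sided ideal is graded if it contains the homogeneous components of its elements. -/
def IsGradedIdeal (𝒜 : ℤ → AddSubgroup R) (P : TwoSidedIdeal R) : Prop :=
  IsGradedSubgroup 𝒜 {x | x ∈ P}

/-- `P` is graded and it is the annihilator of a graded simple left module. A graded simple module
is generated by any of its nonzero homogeneous elements, hence it is isomorphic to a quotient of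
`R`, so that it is sufficient to consider modules in the universe of `R`. -/
def IsGradedLeftPrimitive (𝒜 : ℤ → AddSubgroup R) (P : TwoSidedIdeal R) : Prop :=
  IsGradedIdeal 𝒜 P ∧
    ∃ (M : Type u) (_ : AddCommGroup M) (act : R →+ M →+ M) (ℳ : ℤ → AddSubgroup M),
      IsLeftAction act ∧ IsGradedSimple 𝒜 act ℳ ∧ ∀ x, x ∈ P ↔ ∀ m, act x m = 0

/-- `P` is graded and it is the annihilator of a graded simple right module. -/
def IsGradedRightPrimitive (𝒜 : ℤ → AddSubgroup R) (P : TwoSidedIdeal R) : Prop :=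
  IsGradedIdeal 𝒜 P ∧
    ∃ (M : Type u) (_ : AddCommGroup M) (act : R →+ M →+ M) (ℳ : ℤ → AddSubgroup M),
      IsRightAction act ∧ IsGradedSimple 𝒜 act ℳ ∧ ∀ x, x ∈ P ↔ ∀ m, act x m = 0

/-- A graded primitive ideal: both graded left primitive and graded right primitive. -/
def IsGradedPrimitive (𝒜 : ℤ → AddSubgroup R) (P : TwoSidedIdeal R) : Prop :=
  IsGradedLeftPrimitive 𝒜 P ∧ IsGradedRightPrimitive 𝒜 P

end GradedPrimitive

namespace LeavittPathAlgebra

section Conditions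

variable {K : Type u} [Field K] {V : Type v} {E : Type w} {G : DirGraph V E}

/-- `P = I(H, S)` for the admissible pair `(H, S)`. -/
def IsIdealOf (P : TwoSidedIdeal (LeavittPathAlgebra K G)) (H S : Set V) : Prop :=
  G.IsAdmissible H S ∧ P = idealOf K G H S

/-- `P = I(H, B_H)` where `E⁰ - H = R(α⁰)` for a strictly decreasing infinite path `α` such that
`R(a)` is properly contained in `R(α⁰)` for every vertex `a` in `E⁰ - H`. -/
def DecreasingPathCondition (P : TwoSidedIdeal (LeavittPathAlgebra K G)) : Prop :=
  ∃ (H : Set V) (α : ℕ → E), IsIdealOf P H (G.breaking H) ∧ G.IsStrictlyDecreasing α ∧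
    H = (G.rootSet (G.infinitePathVertices α))ᶜ ∧
    ∀ a, a ∉ H → G.root a ⊂ G.rootSet (G.infinitePathVertices α)

/-- `P = I(H, B_H)` where `E⁰ - H = R(a)` for a vertex `a` which emits no edges to `E⁰ - H`. -/
def NoEdgesCondition (P : TwoSidedIdeal (LeavittPathAlgebra K G)) : Prop :=
  ∃ (H : Set V) (a : V), IsIdealOf P H (G.breaking H) ∧ H = (G.root a)ᶜ ∧
    ∀ e, G.s e = a → G.r e ∈ H

/-- `P = I(H, S)` where `E⁰ - H = R(a)` for a vertex `a` on a cycle `c` extreme in `E⁰ - H`, and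
`S` is `B_H` or `B_H - {b}` for some `b ∈ B_H` on `c`. -/
def ExtremeCycleCondition (P : TwoSidedIdeal (LeavittPathAlgebra K G)) : Prop :=
  ∃ (H S : Set V) (a : V) (c : List E), IsIdealOf P H S ∧ H = (G.root a)ᶜ ∧
    G.IsExtremeIn Hᶜ c ∧ a ∈ G.cycleVertices c ∧
    (S = G.breaking H ∨ ∃ b ∈ G.breaking H, b ∈ G.cycleVertices c ∧ S = G.breaking H \ {b})

/-- `P = I(H, S)` where `E⁰ - H = R(a)` for a vertex `a` on an exclusive cycle `c`, and `S` is
`B_H` or `B_H - {b}` for some `b ∈ B_H` on `c`. -/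
def ExclusiveCycleCondition (P : TwoSidedIdeal (LeavittPathAlgebra K G)) : Prop :=
  ∃ (H S : Set V) (a : V) (c : List E), IsIdealOf P H S ∧ H = (G.root a)ᶜ ∧
    G.IsExclusive c ∧ a ∈ G.cycleVertices c ∧
    (S = G.breaking H ∨ ∃ b ∈ G.breaking H, b ∈ G.cycleVertices c ∧ S = G.breaking H \ {b})

end Conditions

end LeavittPathAlgebra

/-! Let `H` be the set of vertices in an ideal `P` and `S` the set of breaking vertices `a` of `H`
with `a^H ∈ P`.

A graded ideal is `I(H, S)` (`eq_gradedPart`). In degree zero one inducts on the length of the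
monomials `p q*`: multiplying by `e*` and `f` isolates shorter coefficients, and an element `a + ∑ e
y f*` of `P` forces `a^H ∈ P`. Positive degrees reduce to zero by `x = ∑ e (e* x)`, negative ones by
the involution. So the annihilator of a graded module is known as soon as the vertices and breaking
elements acting as zero are known.

Graded simple modules come from path spaces (`PathSystem`): edges prolong a basis path, ghost edges
remove its first edge. The basis consists of the finite paths ending at a non-regular vertex `a`, or
of the infinite paths tail equivalent to a given `α`, each paired with its lag, so that the module
is graded even if `α` is periodic. Initial segments separate basis elements of equal degree and any
two basis elements share a tail, whence graded simplicity. The annihilator is `I(H, B_H - {a})` with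
`E⁰ - H = R(a)` in the finite case, because `a^H` fixes the trivial path, and `I(H, B_H)` with `E⁰ -
H = R(α⁰)` in the infinite case. The involution turns left modules into right ones.

Conversely, let `P` annihilate a graded simple left module. If `x, y ∉ P` and `y` has degree zero,
then `x t y ∉ P` for a monomial `t = p q*`. Applied to vertices this gives directedness; applied to
breaking elements it shows that at most one is missing from `P`, and that its vertex is a root of
`E⁰ - H`. For ICSP fix a homogeneous `m ≠ 0`. Every `w ∉ H` yields `z` of degree zero with `z m =
m`, a combination of monomials `p q*` with `|q| ≤ N` and ranges outside `H` below `w`. For fixed `N`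
finitely many vertices separate all such `w`: otherwise one could multiply `N + 2` such elements in
which each new `w` is not above the previous ranges, lengthening `q` each time, so that the product
is zero and still fixes `m` (`exists_finset_of_zeroSpan_act`).

The equivalence of the last two conditions is graph theory. If `E⁰ - H` is not the root of one of
its vertices, directedness and ICSP give a strictly decreasing cofinal path. If it is `R(a)`, either
`a` emits no edge into it, or `a` lies on a cycle, which is extreme or exclusive according to
whether it has an exit inside `E⁰ - H`. The cases exclude each other because `P` determines `H`. -/

namespace DirGraph

/-! ### Finite paths and cycles -/

section Paths

variable {V : Type v} {E : Type w} {G : DirGraph V E}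

theorem IsPath.eq_of_nil {a b : V} (h : G.IsPath a [] b) : a = b := by
  cases h; rfl

theorem IsPath.source_eq {a b : V} {e : E} {p : List E} (h : G.IsPath a (e :: p) b) :
    G.s e = a := by
  cases h; rfl

theorem IsPath.tail {a b : V} {e : E} {p : List E} (h : G.IsPath a (e :: p) b) :
    G.IsPath (G.r e) p b := by
  cases h; assumption

theorem IsPath.append {a b c : V} {p q : List E} (hp : G.IsPath a p b) (hq : G.IsPath b q c) :
    G.IsPath a (p ++ q) c := by
  induction hp with
  | nil => exact hq
  | cons e _ ih => exact .cons e (ih hq)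

theorem isPath_append_iff {a c : V} {p q : List E} :
    G.IsPath a (p ++ q) c ↔ ∃ b, G.IsPath a p b ∧ G.IsPath b q c := by
  refine ⟨fun h => ?_, fun ⟨b, hp, hq⟩ => hp.append hq⟩
  induction p generalizing a with
  | nil => exact ⟨a, .nil a, h⟩
  | cons e p ih =>
    obtain ⟨b, hp, hq⟩ := ih h.tail
    obtain rfl := h.source_eq
    exact ⟨b, .cons e hp, hq⟩

theorem isPath_singleton (e : E) : G.IsPath (G.s e) [e] (G.r e) := .cons e (.nil _)

theorem IsPath.target_unique {a b c : V} {p : List E} (h : G.IsPath a p b)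
    (h' : G.IsPath a p c) : b = c := by
  induction h with
  | nil => exact h'.eq_of_nil
  | cons e _ ih => exact ih h'.tail

theorem Geq.refl (a : V) : G.Geq a a := ⟨[], .nil a⟩

theorem Geq.trans {a b c : V} (h : G.Geq a b) (h' : G.Geq b c) : G.Geq a c := by
  obtain ⟨p, hp⟩ := h
  obtain ⟨q, hq⟩ := h'
  exact ⟨p ++ q, hp.append hq⟩

theorem geq_edge (e : E) : G.Geq (G.s e) (G.r e) := ⟨[e], isPath_singleton e⟩

theorem IsPath.geq_of_mem {a b : V} {p : List E} (h : G.IsPath a p b) {e : E} (he : e ∈ p) :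
    G.Geq a (G.s e) ∧ G.Geq (G.r e) b := by
  induction h with
  | nil => simp at he
  | cons f hp ih =>
    rcases List.mem_cons.1 he with rfl | he
    · exact ⟨Geq.refl _, ⟨_, hp⟩⟩
    · exact ⟨(geq_edge f).trans (ih he).1, (ih he).2⟩

theorem root_subset_iff {a b : V} : G.root a ⊆ G.root b ↔ G.Geq a b :=
  ⟨fun h => h (Geq.refl a), fun h _ hx => Geq.trans hx h⟩

theorem root_eq_iff {a b : V} : G.root a = G.root b ↔ G.Geq a b ∧ G.Geq b a := by
  rw [Set.Subset.antisymm_iff, root_subset_iff, root_subset_iff]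

theorem mem_root_self (a : V) : a ∈ G.root a := Geq.refl a

theorem root_subset_of_hereditary {H : Set V} (hH : G.IsHereditary H) {a : V} (ha : a ∉ H) :
    G.root a ⊆ Hᶜ := fun x hx hxH => ha (hH x a hxH hx)

/-- A path has a suffix which starts at any given source of its edges. -/
theorem IsPath.exists_suffix {a b : V} {p : List E} (h : G.IsPath a p b) {x : V}
    (hx : x ∈ p.map G.s) : ∃ q, q <:+ p ∧ G.IsPath x q b := by
  induction h with
  | nil => simp at hx
  | cons e hp ih =>
    rcases List.mem_cons.1 hx with rfl | hx
    · exact ⟨_, List.suffix_rfl, .cons e hp⟩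
    · obtain ⟨q, hq, hq'⟩ := ih hx
      exact ⟨q, hq.trans (List.suffix_cons _ _), hq'⟩

/-- Every path can be replaced by one in which no vertex repeats. -/
theorem Geq.exists_simple {a b : V} (h : G.Geq a b) :
    ∃ p, G.IsPath a p b ∧ (p.map G.s).Nodup ∧ b ∉ p.map G.s := by
  obtain ⟨p, hp⟩ := h
  induction hp with
  | nil a => exact ⟨[], .nil a, by simp, by simp⟩
  | @cons e p b _ ih =>
    obtain ⟨q, hq, hnd, hb⟩ := ih
    by_cases h1 : G.s e ∈ q.map G.s
    · obtain ⟨t, ht, ht'⟩ := hq.exists_suffix h1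
      have hs : (t.map G.s).Sublist (q.map G.s) := ht.sublist.map _
      exact ⟨t, ht', hnd.sublist hs, fun hmem => hb (hs.subset hmem)⟩
    · by_cases h2 : b = G.s e
      · subst h2
        exact ⟨[], .nil _, by simp, by simp⟩
      · refine ⟨e :: q, .cons e hq, ?_, ?_⟩
        · rw [List.map_cons, List.nodup_cons]; exact ⟨h1, hnd⟩
        · rw [List.map_cons, List.mem_cons, not_or]; exact ⟨h2, hb⟩

/-- A simple return path has no edge with source `s e`, its endpoint, so prefixing `e` keeps the
sources distinct. -/
theorem exists_cycle_of_edge {e : E} (h : G.Geq (G.r e) (G.s e)) :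
    ∃ c, G.IsCycle c ∧ e ∈ c := by
  obtain ⟨p, hp, hnd, hb⟩ := h.exists_simple
  refine ⟨e :: p, ⟨by simp, ⟨G.s e, .cons e hp⟩, ?_⟩, by simp⟩
  rw [List.map_cons, List.nodup_cons]; exact ⟨hb, hnd⟩

theorem mem_cycleVertices_of_mem {c : List E} {e : E} (h : e ∈ c) :
    G.s e ∈ G.cycleVertices c := ⟨e, h, rfl⟩

theorem cycleVertices_eq_of_isRotated {c d : List E} (h : c.IsRotated d) :
    G.cycleVertices c = G.cycleVertices d := by
  ext x
  simp only [cycleVertices, Set.mem_ofPred_eq, h.mem_iff]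

/-- A cycle can be rotated to start at any of its vertices. -/
theorem IsCycle.exists_rotated {c : List E} (hc : G.IsCycle c) {x : V}
    (hx : x ∈ G.cycleVertices c) :
    ∃ d, d.IsRotated c ∧ G.IsCycle d ∧ G.IsPath x d x := by
  obtain ⟨hne, ⟨a, ha⟩, hnd⟩ := hc
  obtain ⟨e, he, rfl⟩ := hx
  obtain ⟨p, q, rfl⟩ := List.append_of_mem he
  obtain ⟨b, hp, hq⟩ := isPath_append_iff.1 ha
  obtain rfl := hq.source_eq
  have hr : (e :: q ++ p).IsRotated (p ++ e :: q) := by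
    refine List.IsRotated.symm ⟨p.length, ?_⟩
    simp
  have hpath := hq.append hp
  refine ⟨e :: q ++ p, hr, ⟨by simp, ⟨_, hpath⟩, ?_⟩, hpath⟩
  exact (hr.map G.s).nodup_iff.2 hnd

theorem IsCycle.geq {c : List E} (hc : G.IsCycle c) {x y : V}
    (hx : x ∈ G.cycleVertices c) (hy : y ∈ G.cycleVertices c) : G.Geq x y := by
  obtain ⟨d, hd, -, hpath⟩ := hc.exists_rotated hx
  rw [← cycleVertices_eq_of_isRotated hd] at hy
  obtain ⟨e, he, rfl⟩ := hy
  exact (hpath.geq_of_mem he).1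

theorem IsCycle.range_geq {c : List E} (hc : G.IsCycle c) {e : E} (he : e ∈ c) {x : V}
    (hx : x ∈ G.cycleVertices c) : G.Geq (G.r e) x := by
  obtain ⟨d, hd, -, hpath⟩ := hc.exists_rotated hx
  exact (hpath.geq_of_mem (hd.mem_iff.2 he)).2

theorem IsCycle.range_mem {c : List E} (hc : G.IsCycle c) {e : E} (he : e ∈ c) :
    G.r e ∈ G.cycleVertices c := by
  obtain ⟨a, ha⟩ := hc.2.1
  have key : ∀ {x y : V} {p : List E}, G.IsPath x p y → e ∈ p →
      G.r e = y ∨ ∃ f ∈ p, G.s f = G.r e := by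
    intro x y p hp hep
    induction hp with
    | nil => simp at hep
    | @cons f p b hp ih =>
      rcases List.mem_cons.1 hep with rfl | hep
      · cases p with
        | nil => exact Or.inl hp.eq_of_nil
        | cons g p => exact Or.inr ⟨g, by simp, hp.source_eq⟩
      · rcases ih hep with h | ⟨g, hg, hg'⟩
        · exact Or.inl h
        · exact Or.inr ⟨g, List.mem_cons_of_mem _ hg, hg'⟩
  rcases key ha he with h | h
  · obtain ⟨hne, -, -⟩ := hc
    cases c with
    | nil => exact absurd rfl hne
    | cons f c => exact ⟨f, by simp, ha.source_eq.trans h.symm⟩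
  · exact h

theorem IsCycle.edge_unique {c : List E} (hc : G.IsCycle c) {e f : E} (he : e ∈ c) (hf : f ∈ c)
    (h : G.s e = G.s f) : e = f :=
  List.inj_on_of_nodup_map hc.2.2 he hf h

/-- An edge with a return path closes up to a cycle meeting `c`, which exclusiveness identifies with
`c`. -/
theorem IsExclusive.edge_mem {c : List E} (hc : G.IsExclusive c) {e : E}
    (he : G.s e ∈ G.cycleVertices c) (h : G.Geq (G.r e) (G.s e)) : e ∈ c := by
  obtain ⟨d, hd, hed⟩ := exists_cycle_of_edge h
  exact (hc.2 d hd ⟨_, he, mem_cycleVertices_of_mem hed⟩).mem_iff.1 hed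

/-- The vertices of an exclusive cycle form a whole strongly connected component: a path that can
return never leaves the cycle. -/
theorem IsExclusive.mem_of_geq {c : List E} (hc : G.IsExclusive c) {a x : V}
    (ha : a ∈ G.cycleVertices c) (hax : G.Geq a x) (hxa : G.Geq x a) :
    x ∈ G.cycleVertices c := by
  obtain ⟨p, hp⟩ := hax
  induction hp with
  | nil => exact ha
  | cons e hp ih =>
    have he : e ∈ c := hc.edge_mem ha (Geq.trans ⟨_, hp⟩ hxa)
    have hr := hc.1.range_mem he
    exact ih hr (hxa.trans (geq_edge e))

/-- Two paths with the same source, in a set of edges with pairwise different sources. -/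
theorem IsPath.initialSegment_total {T : Set E} (hT : ∀ e ∈ T, ∀ f ∈ T, G.s e = G.s f → e = f)
    {x y z : V} {p q : List E} (hp : G.IsPath x p y) (hq : G.IsPath x q z)
    (hpT : ∀ e ∈ p, e ∈ T) (hqT : ∀ e ∈ q, e ∈ T) : p <+: q ∨ q <+: p := by
  induction hp generalizing q with
  | nil => exact Or.inl List.nil_prefix
  | cons e hp ih =>
    cases q with
    | nil => exact Or.inr List.nil_prefix
    | cons f q =>
      obtain rfl : e = f := hT e (hpT e (by simp)) f (hqT f (by simp)) hq.source_eq.symm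
      rcases ih hq.tail (fun g hg => hpT g (by simp [hg])) (fun g hg => hqT g (by simp [hg]))
        with h | h
      · exact Or.inl (List.cons_prefix_cons.2 ⟨rfl, h⟩)
      · exact Or.inr (List.cons_prefix_cons.2 ⟨rfl, h⟩)

/-- A proper prolongation of `c` would leave `x` a second time and thus repeat a source. -/
theorem IsCycle.eq_of_initialSegment {c d : List E} (hc : G.IsCycle c) (hd : G.IsCycle d) {x : V}
    (hcx : G.IsPath x c x) (hdx : G.IsPath x d x) (h : c <+: d) : c = d := by
  obtain ⟨t, rfl⟩ := h
  cases t with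
  | nil => simp
  | cons f t =>
    exfalso
    obtain ⟨y, h1, h2⟩ := isPath_append_iff.1 hdx
    obtain rfl := hcx.target_unique h1
    cases c with
    | nil => exact hc.1 rfl
    | cons e c =>
      have := hd.2.2
      rw [List.cons_append, List.map_cons, List.nodup_cons] at this
      apply this.1
      rw [hcx.source_eq, ← h2.source_eq]
      simp

/-- A cycle all of whose edges are forced within its strongly connected component is
exclusive. -/
theorem IsCycle.isExclusive {c : List E} (hc : G.IsCycle c)
    (h : ∀ e, G.s e ∈ G.cycleVertices c → G.Geq (G.r e) (G.s e) → e ∈ c) : G.IsExclusive c := by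
  refine ⟨hc, ?_⟩
  rintro d hd ⟨x, hxc, hxd⟩
  obtain ⟨c', hcr, hc', hcx⟩ := hc.exists_rotated hxc
  obtain ⟨d', hdr, hd', hdx⟩ := hd.exists_rotated hxd
  have hmem : ∀ {x y : V} {p : List E}, G.IsPath x p y → x ∈ G.cycleVertices c →
      G.Geq y x → ∀ e ∈ p, e ∈ c := by
    intro x y p hp
    induction hp with
    | nil => intro _ _ e he; simp at he
    | cons e hp ih =>
      intro hx hy f hf
      have he : e ∈ c := h e hx (Geq.trans ⟨_, hp⟩ hy)
      rcases List.mem_cons.1 hf with rfl | hf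
      · exact he
      · exact ih (hc.range_mem he) (hy.trans (geq_edge e)) f hf
  have hdc : ∀ e ∈ d', e ∈ c := hmem hdx hxc (Geq.refl x)
  have hcc : ∀ e ∈ c', e ∈ c := fun e he => hcr.mem_iff.1 he
  -- Both closed paths at `x` use edges of `c`, whose sources are distinct, so there is never a
  -- choice of next edge and one is an initial segment of the other.
  have : c' = d' := by
    rcases hcx.initialSegment_total (T := {e | e ∈ c}) (fun e he f hf hef => hc.edge_unique he hf hef)
      hdx hcc hdc with h | h
    · exact hc'.eq_of_initialSegment hd' hcx hdx h
    · exact (hd'.eq_of_initialSegment hc' hdx hcx h).symm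
  exact (hdr.symm.trans (this ▸ List.IsRotated.refl _)).trans hcr

end Paths

/-! ### Infinite paths -/

section InfinitePaths

variable {V : Type v} {E : Type w} {G : DirGraph V E}

theorem IsPath.getElem?_succ {a b : V} {p : List E} (h : G.IsPath a p b) {i : ℕ} {e f : E}
    (he : p[i]? = some e) (hf : p[i + 1]? = some f) : G.r e = G.s f := by
  induction h generalizing i with
  | nil => simp at he
  | @cons g p b hp ih =>
    cases i with
    | zero =>
      cases p with
      | nil => simp at hf
      | cons g' p =>
        simp only [List.getElem?_cons_zero, Option.some.injEq, zero_add,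
          List.getElem?_cons_succ] at he hf
        subst he hf
        exact hp.source_eq.symm
    | succ i => exact ih (by simpa using he) (by simpa using hf)

theorem IsInfinitePath.geq {α : ℕ → E} (h : G.IsInfinitePath α) {i j : ℕ} (hij : i ≤ j) :
    G.Geq (G.s (α i)) (G.s (α j)) := by
  induction j, hij using Nat.le_induction with
  | base => exact Geq.refl _
  | succ j _ ih => exact ih.trans (by rw [← h j]; exact geq_edge _)

/-- The concatenation of infinitely many paths of positive length. -/
theorem exists_infinitePath (x : ℕ → V) (p : ℕ → List E)
    (hp : ∀ n, G.IsPath (x n) (p n) (x (n + 1))) (hne : ∀ n, p n ≠ []) :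
    ∃ (α : ℕ → E) (k : ℕ → ℕ), G.IsInfinitePath α ∧ k 0 = 0 ∧ StrictMono k ∧
      ∀ n, G.s (α (k n)) = x n := by
  -- `L n` is the concatenation of the first `n` paths. As these are nonempty, `L (i + 1)` has an
  -- `i`-th entry, which is taken as `α i`; the position `k n` is the length of `L n`.
  let L : ℕ → List E := fun n => Nat.rec [] (fun n l => l ++ p n) n
  have hL : ∀ n, L (n + 1) = L n ++ p n := fun n => rfl
  have hmono : StrictMono fun n => (L n).length := by
    refine strictMono_nat_of_lt_succ fun n => ?_
    have := List.length_pos_of_ne_nil (hne n)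
    simp only [hL, List.length_append]; omega
  have hpath : ∀ n, G.IsPath (x 0) (L n) (x n) := by
    intro n
    induction n with
    | zero => exact .nil _
    | succ n ih => exact ih.append (hp n)
  have hpre : ∀ {m n : ℕ}, m ≤ n → L m <+: L n := by
    intro m n hmn
    induction n, hmn using Nat.le_induction with
    | base => exact List.prefix_rfl
    | succ n _ ih => exact ih.trans (List.prefix_append _ _)
  have hex : ∀ i, ∃ e, (L (i + 1))[i]? = some e := fun i =>
    ⟨_, List.getElem?_eq_getElem (lt_of_lt_of_le (Nat.lt_succ_self i) (hmono.id_le (i + 1)))⟩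
  choose α hα using hex
  have hα' : ∀ {i n : ℕ}, i < (L n).length → (L n)[i]? = some (α i) := by
    intro i n hi
    rcases le_total n (i + 1) with h | h
    · obtain ⟨t, ht⟩ := hpre h
      rw [← hα i, ← ht, List.getElem?_append_left hi]
    · obtain ⟨t, ht⟩ := hpre h
      rw [← ht, List.getElem?_append_left
        (lt_of_lt_of_le (Nat.lt_succ_self i) (hmono.id_le (i + 1))), hα i]
  refine ⟨α, fun n => (L n).length, fun n => ?_, rfl, hmono, fun n => ?_⟩
  · have h2 : n + 2 ≤ (L (n + 2)).length := hmono.id_le (n + 2)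
    exact (hpath (n + 2)).getElem?_succ (hα' (n := n + 2) (by omega))
      (hα' (n := n + 2) (by omega))
  · have h1 := hα' (hmono (Nat.lt_succ_self n))
    simp only [Nat.succ_eq_add_one] at h1
    rw [hL, List.getElem?_append_right le_rfl, Nat.sub_self] at h1
    cases hpn : p n with
    | nil => exact absurd hpn (hne n)
    | cons e q =>
      rw [hpn] at h1
      have h3 := hp n
      rw [hpn] at h3
      simp only [List.getElem?_cons_zero, Option.some.injEq] at h1
      rw [← h1, h3.source_eq]

theorem rootSet_infinitePathVertices {α : ℕ → E} (hα : G.IsInfinitePath α) {k : ℕ → ℕ}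
    (hk : StrictMono k) :
    G.rootSet (G.infinitePathVertices α) = {y | ∃ n, G.Geq y (G.s (α (k n)))} := by
  ext y
  constructor
  · rintro ⟨_, ⟨i, rfl⟩, hy⟩
    exact ⟨i, hy.trans (hα.geq (hk.id_le i))⟩
  · rintro ⟨n, hn⟩
    exact ⟨_, ⟨k n, rfl⟩, hn⟩

/-- Running around a cycle forever. -/
theorem IsCycle.exists_infinitePath {c : List E} (hc : G.IsCycle c) {a : V}
    (ha : a ∈ G.cycleVertices c) :
    ∃ α, G.IsInfinitePath α ∧ G.rootSet (G.infinitePathVertices α) = G.root a := by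
  obtain ⟨d, -, hd, hpath⟩ := hc.exists_rotated ha
  obtain ⟨α, k, hα, -, hk, hs⟩ := DirGraph.exists_infinitePath (fun _ => a) (fun _ => d)
    (fun _ => hpath) (fun _ => hd.1)
  refine ⟨α, hα, ?_⟩
  rw [rootSet_infinitePathVertices hα hk]
  ext y
  simp [hs, root]

end InfinitePaths

/-! ### Combinatorics of admissible pairs: equivalence of the second and third conditions -/

section Pairs

variable {V : Type v} {E : Type w} {G : DirGraph V E}

/-- The condition on an admissible pair which characterizes the graded primitive ideals. -/
def IsPrimitivePair (G : DirGraph V E) (H S : Set V) : Prop :=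
  G.IsAdmissible H S ∧ G.IsDownwardsDirected Hᶜ ∧ G.HasICSP Hᶜ ∧
    (S = G.breaking H ∨ ∃ a ∈ G.breaking H, Hᶜ = G.root a ∧ S = G.breaking H \ {a})

/-- This and the next three definitions isolate the graph-theoretic content of the four cases, with
`H` and `S` as parameters and without the ideal. -/
def PathCase (G : DirGraph V E) (H S : Set V) : Prop :=
  ∃ α : ℕ → E, S = G.breaking H ∧ G.IsStrictlyDecreasing α ∧
    H = (G.rootSet (G.infinitePathVertices α))ᶜ ∧
    ∀ a, a ∉ H → G.root a ⊂ G.rootSet (G.infinitePathVertices α)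

def NoEdgesCase (G : DirGraph V E) (H S : Set V) : Prop :=
  ∃ a : V, S = G.breaking H ∧ H = (G.root a)ᶜ ∧ ∀ e, G.s e = a → G.r e ∈ H

def ExtremeCase (G : DirGraph V E) (H S : Set V) : Prop :=
  ∃ (a : V) (c : List E), H = (G.root a)ᶜ ∧ G.IsExtremeIn Hᶜ c ∧ a ∈ G.cycleVertices c ∧
    (S = G.breaking H ∨ ∃ b ∈ G.breaking H, b ∈ G.cycleVertices c ∧ S = G.breaking H \ {b})

def ExclusiveCase (G : DirGraph V E) (H S : Set V) : Prop :=
  ∃ (a : V) (c : List E), H = (G.root a)ᶜ ∧ G.IsExclusive c ∧ a ∈ G.cycleVertices c ∧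
    (S = G.breaking H ∨ ∃ b ∈ G.breaking H, b ∈ G.cycleVertices c ∧ S = G.breaking H \ {b})

theorem isDownwardsDirected_root (a : V) : G.IsDownwardsDirected (G.root a) :=
  ⟨⟨a, Geq.refl a⟩, fun _ hx _ hy => ⟨a, Geq.refl a, hx, hy⟩⟩

theorem hasICSP_root (a : V) : G.HasICSP (G.root a) :=
  ⟨{a}, Set.countable_singleton a, by simpa using mem_root_self a,
    fun _ hx => ⟨a, rfl, hx⟩⟩

theorem PathCase.isPrimitivePair {H S : Set V} (hadm : G.IsAdmissible H S)
    (h : G.PathCase H S) : G.IsPrimitivePair H S := by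
  obtain ⟨α, hS, ⟨hα, -⟩, hH, -⟩ := h
  have hc : Hᶜ = G.rootSet (G.infinitePathVertices α) := by rw [hH, compl_compl]
  refine ⟨hadm, ?_, ?_, Or.inl hS⟩
  · rw [hc]
    refine ⟨⟨G.s (α 0), _, ⟨0, rfl⟩, Geq.refl _⟩, ?_⟩
    rintro x ⟨_, ⟨i, rfl⟩, hx⟩ y ⟨_, ⟨j, rfl⟩, hy⟩
    exact ⟨G.s (α (max i j)), ⟨_, ⟨max i j, rfl⟩, Geq.refl _⟩,
      hx.trans (hα.geq (le_max_left i j)), hy.trans (hα.geq (le_max_right i j))⟩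
  · rw [hc]
    exact ⟨G.infinitePathVertices α, Set.countable_range _, fun x hx => ⟨x, hx, Geq.refl x⟩,
      subset_rfl⟩

theorem isPrimitivePair_of_root {H S : Set V} (hadm : G.IsAdmissible H S) {a : V}
    (hH : H = (G.root a)ᶜ)
    (hS : S = G.breaking H ∨ ∃ b ∈ G.breaking H, G.Geq a b ∧ S = G.breaking H \ {b}) :
    G.IsPrimitivePair H S := by
  have hc : Hᶜ = G.root a := by rw [hH, compl_compl]
  refine ⟨hadm, by rw [hc]; exact isDownwardsDirected_root a, by rw [hc]; exact hasICSP_root a, ?_⟩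
  rcases hS with hS | ⟨b, hb, hab, hS⟩
  · exact Or.inl hS
  · refine Or.inr ⟨b, hb, ?_, hS⟩
    have : b ∈ Hᶜ := hb.1
    rw [hc] at this ⊢
    exact root_eq_iff.2 ⟨hab, this⟩

theorem NoEdgesCase.isPrimitivePair {H S : Set V} (hadm : G.IsAdmissible H S)
    (h : G.NoEdgesCase H S) : G.IsPrimitivePair H S := by
  obtain ⟨a, hS, hH, -⟩ := h
  exact isPrimitivePair_of_root hadm hH (Or.inl hS)

theorem ExtremeCase.isPrimitivePair {H S : Set V} (hadm : G.IsAdmissible H S)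
    (h : G.ExtremeCase H S) : G.IsPrimitivePair H S := by
  obtain ⟨a, c, hH, hc, ha, hS⟩ := h
  exact isPrimitivePair_of_root hadm hH
    (hS.imp_right fun ⟨b, hb, hbc, hS⟩ => ⟨b, hb, hc.1.geq ha hbc, hS⟩)

theorem ExclusiveCase.isPrimitivePair {H S : Set V} (hadm : G.IsAdmissible H S)
    (h : G.ExclusiveCase H S) : G.IsPrimitivePair H S := by
  obtain ⟨a, c, hH, hc, ha, hS⟩ := h
  exact isPrimitivePair_of_root hadm hH
    (hS.imp_right fun ⟨b, hb, hbc, hS⟩ => ⟨b, hb, hc.1.geq ha hbc, hS⟩)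

/-- Each step goes below the next member of a countable separating set, which makes the path cofinal
in `A`, and also below some vertex outside the root of the current one, which makes the step strict.
Directedness provides the common lower bounds. -/
theorem exists_strictlyDecreasing {A : Set V} (hA : ∀ a ∈ A, G.root a ⊆ A)
    (hdir : G.IsDownwardsDirected A) (hsep : G.HasICSP A) (hroot : ∀ a ∈ A, A ≠ G.root a) :
    ∃ α, G.IsStrictlyDecreasing α ∧ G.rootSet (G.infinitePathVertices α) = A := by
  obtain ⟨C, hC, hCA, hAC⟩ := hsep
  have hCne : C.Nonempty := by
    obtain ⟨a, ha⟩ := hdir.1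
    obtain ⟨b, hb, -⟩ := hAC ha
    exact ⟨b, hb⟩
  obtain ⟨f, rfl⟩ := hC.exists_eq_range hCne
  have step : ∀ (a : A) (n : ℕ), ∃ b : A, G.Geq a b ∧ G.Geq (f n) b ∧ ¬ G.Geq b.1 a := by
    rintro ⟨a, ha⟩ n
    obtain ⟨y, hy, hya⟩ : ∃ y ∈ A, y ∉ G.root a := by
      by_contra! hcon
      exact hroot a ha (Set.Subset.antisymm hcon (hA a ha))
    obtain ⟨z, hz, haz, hfz⟩ := hdir.2 a ha (f n) (hCA ⟨n, rfl⟩)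
    obtain ⟨b, hb, hzb, hyb⟩ := hdir.2 z hz y hy
    exact ⟨⟨b, hb⟩, haz.trans hzb, hfz.trans hzb, fun h => hya (hyb.trans h)⟩
  choose g hg1 hg2 hg3 using step
  let x : ℕ → A := fun n => Nat.rec ⟨f 0, hCA ⟨0, rfl⟩⟩ (fun n a => g a n) n
  have hx : ∀ n, x (n + 1) = g (x n) n := fun n => rfl
  have hgeq : ∀ n, G.Geq (x n).1 (x (n + 1)).1 := fun n => hg1 (x n) n
  choose p hp using hgeq
  have hne : ∀ n, p n ≠ [] := by
    intro n hn
    have h := hp n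
    rw [hn] at h
    have h3 := hg3 (x n) n
    rw [← hx, ← h.eq_of_nil] at h3
    exact h3 (Geq.refl _)
  obtain ⟨α, k, hα, hk0, hk, hs⟩ := exists_infinitePath (fun n => (x n).1) p hp hne
  refine ⟨α, ⟨hα, k, hk0, hk, fun n => ?_⟩, ?_⟩
  · rw [hs, hs]
    exact ⟨hg1 (x n) n, hg3 (x n) n⟩
  · rw [rootSet_infinitePathVertices hα hk]
    ext y
    constructor
    · rintro ⟨n, hn⟩
      rw [hs] at hn
      exact hA _ (x n).2 hn
    · intro hy
      obtain ⟨_, ⟨n, rfl⟩, hn⟩ := hAC hy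
      exact ⟨n + 1, by rw [hs]; exact hn.trans (hg2 (x n) n)⟩

theorem IsPrimitivePair.cases {H S : Set V} (h : G.IsPrimitivePair H S) :
    G.PathCase H S ∨ G.NoEdgesCase H S ∨ G.ExtremeCase H S ∨ G.ExclusiveCase H S := by
  obtain ⟨⟨hher, -, -⟩, hdir, hsep, hS⟩ := h
  by_cases hroot : ∃ a ∈ Hᶜ, Hᶜ = G.root a
  swap
  · push Not at hroot
    obtain ⟨α, hα, hαH⟩ := exists_strictlyDecreasing
      (fun a ha => root_subset_of_hereditary hher ha) hdir hsep hroot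
    refine Or.inl ⟨α, ?_, hα, by rw [hαH, compl_compl], fun a ha => ?_⟩
    · rcases hS with hS | ⟨a, ha, haH, -⟩
      · exact hS
      · exact absurd haH (hroot a ha.1)
    · rw [hαH]
      exact (root_subset_of_hereditary hher ha).ssubset_of_ne (hroot a ha).symm
  right
  -- The generating vertex is chosen to be the excluded breaking vertex whenever there is one, so
  -- that this vertex lies on the cycle found below.
  obtain ⟨a, ha, haH, hS'⟩ : ∃ a ∈ Hᶜ, Hᶜ = G.root a ∧
      (S = G.breaking H ∨ a ∈ G.breaking H ∧ S = G.breaking H \ {a}) := by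
    rcases hS with hS | ⟨a, ha, haH, hS⟩
    · obtain ⟨a, ha, haH⟩ := hroot
      exact ⟨a, ha, haH, Or.inl hS⟩
    · exact ⟨a, ha.1, haH, Or.inr ⟨ha, hS⟩⟩
  have hH : H = (G.root a)ᶜ := by rw [← haH, compl_compl]
  by_cases hno : ∀ e, G.s e = a → G.r e ∈ H
  · left
    refine ⟨a, ?_, hH, hno⟩
    rcases hS' with hS' | ⟨hab, -⟩
    · exact hS'
    · obtain ⟨e, he, he'⟩ := hab.2.2.1
      exact absurd (hno e he) he'
  · right
    push Not at hno
    obtain ⟨e, rfl, he'⟩ := hno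
    have hre : G.r e ∈ Hᶜ := he'
    -- An edge from `a` into `Hᶜ = R(a)` has a return path.
    rw [haH] at hre
    obtain ⟨c, hc, hec⟩ := exists_cycle_of_edge hre
    have hac : G.s e ∈ G.cycleVertices c := ⟨e, hec, rfl⟩
    have hS'' : S = G.breaking H ∨
        ∃ b ∈ G.breaking H, b ∈ G.cycleVertices c ∧ S = G.breaking H \ {b} :=
      hS'.imp_right fun ⟨hb, hS⟩ => ⟨_, hb, hac, hS⟩
    -- With an exit inside `Hᶜ` the cycle is extreme, since every vertex of `Hᶜ` leads back to `a`.
    -- Without one, an edge leaving `c` with a return path would be such an exit, so `c` is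
    -- exclusive.
    by_cases hexit : ∃ f, G.s f ∈ G.cycleVertices c ∧ f ∉ c ∧ G.r f ∈ Hᶜ
    · left
      refine ⟨_, c, hH, ⟨hc, ?_, hexit, ?_⟩, hac, hS''⟩
      · intro x hx
        rw [haH]
        exact hc.geq hx hac
      · intro x p y hx hp hpA
        have hy : y ∈ Hᶜ := by
          apply hpA
          clear hpA hx
          induction hp with
          | nil => exact Or.inl rfl
          | @cons f p b hp ih =>
            refine Or.inr ?_
            rcases ih with h | ⟨g, hg, hg'⟩
            · exact ⟨f, by simp, h⟩
            · exact ⟨g, by simp [hg], hg'⟩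
        rw [haH] at hy
        obtain ⟨q, hq⟩ := hy
        refine ⟨q, _, hac, hq, ?_⟩
        rw [haH]
        rintro z (rfl | ⟨g, hg, rfl⟩)
        · exact ⟨q, hq⟩
        · exact (hq.geq_of_mem hg).2
    · right
      refine ⟨_, c, hH, hc.isExclusive fun f hf hfr => ?_, hac, hS''⟩
      by_contra hfc
      refine hexit ⟨f, hf, hfc, ?_⟩
      rw [haH]
      exact hfr.trans (hc.geq hf hac)

/-- The proper inclusion, applied to `a` itself, would read `R(a) ⊊ R(a)`. -/
theorem PathCase.not_root {H S : Set V} (h : G.PathCase H S) {a : V} : H ≠ (G.root a)ᶜ := by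
  rintro rfl
  obtain ⟨α, -, -, hH, hlt⟩ := h
  have := hlt a (fun h => h (Geq.refl a))
  rw [compl_inj_iff.1 hH] at this
  exact lt_irrefl _ this

/-- If `R(b) = R(a)` with `a` on a cycle, then the first edge of a path from `b` to `a`, or the
cycle edge at `b = a`, stays in `R(a)`. -/
theorem NoEdgesCase.not_cycle {H S : Set V} (h : G.NoEdgesCase H S) {a : V} {c : List E}
    (hc : G.IsCycle c) (ha : a ∈ G.cycleVertices c) : H ≠ (G.root a)ᶜ := by
  rintro rfl
  obtain ⟨b, -, hH, hb⟩ := h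
  obtain ⟨hab, hba⟩ := root_eq_iff.1 (compl_inj_iff.1 hH)
  obtain ⟨p, hp⟩ := hba
  cases p with
  | nil =>
    obtain rfl := hp.eq_of_nil
    obtain ⟨e, he, rfl⟩ := ha
    exact hb e rfl (hc.range_geq he ⟨e, he, rfl⟩)
  | cons e p => exact hb e hp.source_eq ⟨p, hp.tail⟩

/-- Both cycles lie in one strongly connected component, so they coincide; the exit of the extreme
cycle has a return path and would be an edge of the exclusive one. -/
theorem ExtremeCase.not_exclusive {H S S' : Set V} (h : G.ExtremeCase H S)
    (h' : G.ExclusiveCase H S') : False := by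
  obtain ⟨a, c, hH, ⟨hc, -, ⟨e, hes, hec, heH⟩, -⟩, ha, -⟩ := h
  obtain ⟨b, d, hH', hd, hb, -⟩ := h'
  obtain ⟨hab, hba⟩ := root_eq_iff.1 (compl_inj_iff.1 (hH.symm.trans hH'))
  have had := hd.mem_of_geq hb hba hab
  have hrot := hd.2 c hc ⟨a, had, ha⟩
  rw [hH, compl_compl] at heH
  apply hec
  rw [hrot.mem_iff]
  refine hd.edge_mem ?_ (Geq.trans heH (hc.geq ha hes))
  rwa [← cycleVertices_eq_of_isRotated hrot]

end Pairs

end DirGraph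

namespace LeavittPathAlgebra

/-! ### The defining relations of the Leavitt path algebra -/

section Relations

variable {K : Type u} [Field K] {V : Type v} {E : Type w} {G : DirGraph V E}

theorem mk_eq_of_rel {x y : FreeLeavitt K V E} (h : LeavittRel K G x y) :
    mk K G x = mk K G y :=
  Quotient.sound' (RingConGen.Rel.of _ _ ⟨1, x, y, h, (one_smul _ _).symm, (one_smul _ _).symm⟩)

theorem vert_mul_self (a : V) : vert K G a * vert K G a = vert K G a :=
  mk_eq_of_rel (.vert_mul_self a)

theorem vert_mul_vert {a b : V} (h : a ≠ b) : vert K G a * vert K G b = 0 :=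
  mk_eq_of_rel (.vert_mul_vert a b h)

theorem source_mul_edge (e : E) : vert K G (G.s e) * edge K G e = edge K G e :=
  mk_eq_of_rel (.source_mul_edge e)

theorem edge_mul_range (e : E) : edge K G e * vert K G (G.r e) = edge K G e :=
  mk_eq_of_rel (.edge_mul_range e)

theorem range_mul_ghost (e : E) : vert K G (G.r e) * ghost K G e = ghost K G e :=
  mk_eq_of_rel (.range_mul_ghost e)

theorem ghost_mul_source (e : E) : ghost K G e * vert K G (G.s e) = ghost K G e :=
  mk_eq_of_rel (.ghost_mul_source e)

theorem ghost_mul_edge_self (e : E) : ghost K G e * edge K G e = vert K G (G.r e) :=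
  mk_eq_of_rel (.ghost_mul_edge_self e)

theorem ghost_mul_edge {e f : E} (h : e ≠ f) : ghost K G e * edge K G f = 0 :=
  mk_eq_of_rel (.ghost_mul_edge e f h)

variable (K G) in
/-- The quotient map as a homomorphism of non-unital algebras. -/
noncomputable def mkHom : FreeLeavitt K V E →ₙₐ[K] LeavittPathAlgebra K G where
  toFun := mk K G
  map_smul' := mk_smul K G
  map_zero' := mk_zero K G
  map_add' := mk_add K G
  map_mul' := mk_mul K G

theorem vert_eq_sum {a : V} (h : G.IsRegular a) :
    vert K G a = ∑ e ∈ h.2.toFinset, edge K G e * ghost K G e := by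
  have h1 : vert K G a = mkHom K G (∑ᶠ e ∈ G.emitted a,
      FreeLeavitt.edge K e * FreeLeavitt.ghost K e) :=
    mk_eq_of_rel (.sum_edge_mul_ghost a h)
  rw [h1, finsum_mem_eq_finite_toFinset_sum _ h.2, map_sum]
  rfl

theorem breakingElement_eq {H : Set V} {a : V} (h : (G.emittedOutside H a).Finite) :
    breakingElement K G H a = vert K G a - ∑ e ∈ h.toFinset, edge K G e * ghost K G e := by
  rw [breakingElement, finsum_mem_eq_finite_toFinset_sum _ h]

theorem vert_mul_edge {a : V} {e : E} (h : G.s e ≠ a) : vert K G a * edge K G e = 0 := by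
  rw [← source_mul_edge e, ← mul_assoc, vert_mul_vert h.symm, zero_mul]

theorem ghost_mul_vert {a : V} {e : E} (h : G.s e ≠ a) : ghost K G e * vert K G a = 0 := by
  rw [← ghost_mul_source e, mul_assoc, vert_mul_vert h, mul_zero]

theorem edge_mul_vert {a : V} {e : E} (h : G.r e ≠ a) : edge K G e * vert K G a = 0 := by
  rw [← edge_mul_range e, mul_assoc, vert_mul_vert h, mul_zero]

end Relations

/-! ### The universal property -/

section Lift

variable {K : Type u} [Field K] {V : Type v} {E : Type w}

/-- A family of elements of an algebra which satisfies the defining relations of `L_K(E)`. -/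
structure Family (K : Type u) [Field K] {V : Type v} {E : Type w} (G : DirGraph V E)
    (A : Type*) [NonUnitalRing A] [Module K A] where
  vert : V → A
  edge : E → A
  ghost : E → A
  vert_mul_self : ∀ a, vert a * vert a = vert a
  vert_mul_vert : ∀ a b, a ≠ b → vert a * vert b = 0
  source_mul_edge : ∀ e, vert (G.s e) * edge e = edge e
  edge_mul_range : ∀ e, edge e * vert (G.r e) = edge e
  range_mul_ghost : ∀ e, vert (G.r e) * ghost e = ghost e
  ghost_mul_source : ∀ e, ghost e * vert (G.s e) = ghost e
  ghost_mul_edge_self : ∀ e, ghost e * edge e = vert (G.r e)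
  ghost_mul_edge : ∀ e f, e ≠ f → ghost e * edge f = 0
  vert_eq_sum : ∀ a (h : G.IsRegular a), vert a = ∑ e ∈ h.2.toFinset, edge e * ghost e

variable {G : DirGraph V E} {A : Type*} [NonUnitalRing A] [Module K A] [IsScalarTower K A A]
  [SMulCommClass K A A]

namespace Family

variable (F : Family K G A)

/-- The homomorphism from the free algebra which a family of elements defines. -/
noncomputable def freeLift : FreeLeavitt K V E →ₙₐ[K] A :=
  MonoidAlgebra.liftMagma K (FreeSemigroup.lift fun
    | .vert a => F.vert a
    | .edge e => F.edge e
    | .ghost e => F.ghost e)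

theorem freeLift_vert (a : V) : F.freeLift (FreeLeavitt.vert K a) = F.vert a := by
  simp [freeLift, FreeLeavitt.vert]

theorem freeLift_edge (e : E) : F.freeLift (FreeLeavitt.edge K e) = F.edge e := by
  simp [freeLift, FreeLeavitt.edge]

theorem freeLift_ghost (e : E) : F.freeLift (FreeLeavitt.ghost K e) = F.ghost e := by
  simp [freeLift, FreeLeavitt.ghost]

theorem freeLift_eq_of_rel {x y : FreeLeavitt K V E} (h : LeavittRel K G x y) :
    F.freeLift x = F.freeLift y := by
  cases h with
  | vert_mul_self a => simp only [map_mul, freeLift_vert, F.vert_mul_self]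
  | vert_mul_vert a b h => simp only [map_mul, freeLift_vert, F.vert_mul_vert a b h, map_zero]
  | source_mul_edge e => simp only [map_mul, freeLift_vert, freeLift_edge, F.source_mul_edge]
  | edge_mul_range e => simp only [map_mul, freeLift_vert, freeLift_edge, F.edge_mul_range]
  | range_mul_ghost e => simp only [map_mul, freeLift_vert, freeLift_ghost, F.range_mul_ghost]
  | ghost_mul_source e => simp only [map_mul, freeLift_vert, freeLift_ghost, F.ghost_mul_source]
  | ghost_mul_edge_self e =>
    simp only [map_mul, freeLift_vert, freeLift_edge, freeLift_ghost, F.ghost_mul_edge_self]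
  | ghost_mul_edge e f h =>
    simp only [map_mul, freeLift_edge, freeLift_ghost, F.ghost_mul_edge e f h, map_zero]
  | sum_edge_mul_ghost a h =>
    rw [finsum_mem_eq_finite_toFinset_sum _ h.2, map_sum, freeLift_vert, F.vert_eq_sum a h]
    simp only [map_mul, freeLift_edge, freeLift_ghost]

theorem freeLift_eq {x y : FreeLeavitt K V E} (h : leavittCon K G x y) :
    F.freeLift x = F.freeLift y := by
  change RingConGen.Rel _ x y at h
  induction h with
  | of x y h =>
    obtain ⟨l, x', y', h, rfl, rfl⟩ := h
    rw [map_smul, map_smul, F.freeLift_eq_of_rel h]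
  | refl x => rfl
  | symm _ ih => exact ih.symm
  | trans _ _ ih₁ ih₂ => exact ih₁.trans ih₂
  | add _ _ ih₁ ih₂ => rw [map_add, map_add, ih₁, ih₂]
  | mul _ h₂ ih₁ ih₂ => rw [map_mul, map_mul, ih₁, ih₂]

/-- The universal property of `L_K(E)`. -/
noncomputable def lift : LeavittPathAlgebra K G →ₙₐ[K] A where
  toFun := Quotient.lift F.freeLift fun _ _ h => F.freeLift_eq h
  map_smul' k := (mk_surjective K G).forall.2 fun x => map_smul F.freeLift k x
  map_zero' := map_zero F.freeLift
  map_add' := (mk_surjective K G).forall₂.2 fun x y => map_add F.freeLift x y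
  map_mul' := (mk_surjective K G).forall₂.2 fun x y => map_mul F.freeLift x y

theorem lift_vert (a : V) : F.lift (LeavittPathAlgebra.vert K G a) = F.vert a :=
  F.freeLift_vert a

theorem lift_edge (e : E) : F.lift (LeavittPathAlgebra.edge K G e) = F.edge e :=
  F.freeLift_edge e

theorem lift_ghost (e : E) : F.lift (LeavittPathAlgebra.ghost K G e) = F.ghost e :=
  F.freeLift_ghost e

end Family

end Lift

/-! ### Spanning monomials and local units -/

section Monomials

variable {K : Type u} [Field K] {V : Type v} {E : Type w} {G : DirGraph V E}

theorem vert_mul_path {a c : V} {p : List E} (h : G.IsPath a p c) :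
    vert K G a * path K G a p = path K G a p := by
  cases h with
  | nil => exact vert_mul_self a
  | cons e _ => rw [path, ← mul_assoc, source_mul_edge]

theorem path_mul_vert {a c : V} {p : List E} (h : G.IsPath a p c) :
    path K G a p * vert K G c = path K G a p := by
  induction h with
  | nil => exact vert_mul_self _
  | cons e _ ih => rw [path, mul_assoc, ih]

theorem ghostPath_mul_vert {a c : V} {p : List E} (h : G.IsPath a p c) :
    ghostPath K G a p * vert K G a = ghostPath K G a p := by
  cases h with
  | nil => exact vert_mul_self a
  | cons e _ => rw [ghostPath, mul_assoc, ghost_mul_source]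

theorem vert_mul_ghostPath {a c : V} {p : List E} (h : G.IsPath a p c) :
    vert K G c * ghostPath K G a p = ghostPath K G a p := by
  induction h with
  | nil => exact vert_mul_self _
  | cons e _ ih => rw [ghostPath, ← mul_assoc, ih]

theorem vert_mul_path_of_ne {a b c : V} {p : List E} (h : G.IsPath a p c) (hab : b ≠ a) :
    vert K G b * path K G a p = 0 := by
  rw [← vert_mul_path h, ← mul_assoc, vert_mul_vert hab, zero_mul]

theorem ghostPath_mul_vert_of_ne {a b c : V} {p : List E} (h : G.IsPath a p c) (hab : a ≠ b) :
    ghostPath K G a p * vert K G b = 0 := by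
  rw [← ghostPath_mul_vert h, mul_assoc, vert_mul_vert hab, mul_zero]

theorem path_singleton (e : E) : path K G (G.s e) [e] = edge K G e := edge_mul_range e

theorem ghostPath_singleton (e : E) : ghostPath K G (G.s e) [e] = ghost K G e := range_mul_ghost e

theorem path_append {a b c : V} {p q : List E} (hp : G.IsPath a p b) (hq : G.IsPath b q c) :
    path K G a (p ++ q) = path K G a p * path K G b q := by
  induction hp with
  | nil => exact (vert_mul_path hq).symm
  | cons e _ ih => rw [List.cons_append, path, path, ih hq, mul_assoc]

theorem ghostPath_append {a b c : V} {p q : List E} (hp : G.IsPath a p b)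
    (hq : G.IsPath b q c) :
    ghostPath K G a (p ++ q) = ghostPath K G b q * ghostPath K G a p := by
  induction hp with
  | nil => exact (ghostPath_mul_vert hq).symm
  | cons e _ ih => rw [List.cons_append, ghostPath, ghostPath, ih hq, mul_assoc]

theorem ghostPath_mul_path_self {a c : V} {p : List E} (h : G.IsPath a p c) :
    ghostPath K G a p * path K G a p = vert K G c := by
  induction h with
  | nil => exact vert_mul_self _
  | cons e hp ih =>
    rw [ghostPath, path, mul_assoc, ← mul_assoc (ghost K G e), ghost_mul_edge_self,
      vert_mul_path hp, ih]

/-- The product `q* p` of a ghost path and a path: zero unless one of the paths `p`, `q` is an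
initial segment of the other. -/
theorem ghostPath_mul_path_cases {a b c d : V} {q p : List E} (hq : G.IsPath a q c)
    (hp : G.IsPath b p d) :
    (∃ t, p = q ++ t ∧ a = b ∧ G.IsPath c t d ∧
      ghostPath K G a q * path K G b p = path K G c t) ∨
    (∃ t, q = p ++ t ∧ a = b ∧ G.IsPath d t c ∧
      ghostPath K G a q * path K G b p = ghostPath K G d t) ∨
    ghostPath K G a q * path K G b p = 0 := by
  by_cases hab : a = b
  swap
  · right; right
    rw [← vert_mul_path hp, ← mul_assoc, ghostPath_mul_vert_of_ne hq hab, zero_mul]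
  subst hab
  induction hq generalizing p with
  | nil => exact Or.inl ⟨p, rfl, rfl, hp, vert_mul_path hp⟩
  | @cons e q c hq ih =>
    cases p with
    | nil =>
      obtain rfl := hp.eq_of_nil
      exact Or.inr (Or.inl ⟨e :: q, rfl, rfl, .cons e hq, ghostPath_mul_vert (.cons e hq)⟩)
    | cons f p =>
      have hmul : ghostPath K G (G.s e) (e :: q) * path K G (G.s e) (f :: p) =
          ghostPath K G (G.r e) q * ((ghost K G e * edge K G f) * path K G (G.r f) p) := by
        simp only [ghostPath, path, mul_assoc]
      by_cases hef : e = f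
      · subst hef
        rw [ghost_mul_edge_self, vert_mul_path hp.tail] at hmul
        rcases ih hp.tail with ⟨t, ht, -, h1, h2⟩ | ⟨t, ht, -, h1, h2⟩ | h
        · exact Or.inl ⟨t, by rw [ht, List.cons_append], rfl, h1, hmul.trans h2⟩
        · exact Or.inr (Or.inl ⟨t, by rw [ht, List.cons_append], rfl, h1, hmul.trans h2⟩)
        · exact Or.inr (Or.inr (hmul.trans h))
      · right; right
        rw [hmul, ghost_mul_edge hef, zero_mul, mul_zero]

variable (K G) in
/-- The elements `p q*` of `L_K(E)`. -/
def monomials : Set (LeavittPathAlgebra K G) :=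
  {x | ∃ (a b c : V) (p q : List E), G.IsPath a p c ∧ G.IsPath b q c ∧
    x = path K G a p * ghostPath K G b q}

theorem mk_of_mul_monomial_mem (g : LeavittGen V E) {x : LeavittPathAlgebra K G}
    (hx : x ∈ monomials K G) :
    mk K G (MonoidAlgebra.single (FreeSemigroup.of g) 1) * x ∈
      Submodule.span K (monomials K G) := by
  obtain ⟨a, b, c, p, q, hp, hq, rfl⟩ := hx
  rw [← mul_assoc]
  cases g with
  | vert d =>
    change vert K G d * _ * _ ∈ _
    by_cases hd : d = a
    · subst hd
      rw [vert_mul_path hp]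
      exact Submodule.subset_span ⟨_, _, _, _, _, hp, hq, rfl⟩
    · rw [vert_mul_path_of_ne hp hd, zero_mul]; exact zero_mem _
  | edge e =>
    change edge K G e * _ * _ ∈ _
    by_cases hd : G.r e = a
    · subst hd
      exact Submodule.subset_span ⟨_, _, _, e :: p, _, .cons e hp, hq, rfl⟩
    · rw [← vert_mul_path hp, ← mul_assoc, edge_mul_vert hd, zero_mul, zero_mul]
      exact zero_mem _
  | ghost e =>
    change ghost K G e * _ * _ ∈ _
    rw [← ghostPath_singleton e]
    rcases ghostPath_mul_path_cases (K := K) (DirGraph.isPath_singleton (G := G) e) hp with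
      ⟨t, -, -, h1, h2⟩ | ⟨t, -, -, h1, h2⟩ | h
    · rw [h2]; exact Submodule.subset_span ⟨_, _, _, _, _, h1, hq, rfl⟩
    · rw [h2, ← ghostPath_append hq h1, ← vert_mul_ghostPath (hq.append h1)]
      exact Submodule.subset_span ⟨_, _, _, [], _, .nil _, hq.append h1, rfl⟩
    · rw [h, zero_mul]; exact zero_mem _

theorem mk_of_mem (g : LeavittGen V E) :
    mk K G (MonoidAlgebra.single (FreeSemigroup.of g) 1) ∈
      Submodule.span K (monomials K G) := by
  cases g with
  | vert a =>
    refine Submodule.subset_span ⟨a, a, a, [], [], .nil a, .nil a, ?_⟩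
    exact (vert_mul_self a).symm
  | edge e =>
    refine Submodule.subset_span ⟨_, _, _, [e], [], DirGraph.isPath_singleton e, .nil _, ?_⟩
    rw [path_singleton]
    exact (edge_mul_range e).symm
  | ghost e =>
    refine Submodule.subset_span ⟨_, _, _, [], [e], .nil _, DirGraph.isPath_singleton e, ?_⟩
    rw [ghostPath_singleton]
    exact (range_mul_ghost e).symm

/-- Words are built by left multiplication with generators, and the span of the monomials is stable
under it. -/
theorem mem_span_monomials (x : LeavittPathAlgebra K G) :
    x ∈ Submodule.span K (monomials K G) := by
  obtain ⟨x, rfl⟩ := mk_surjective K G x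
  induction x using MonoidAlgebra.induction_linear with
  | zero => exact zero_mem _
  | add x y hx hy => rw [mk_add]; exact add_mem hx hy
  | single g k =>
    have : MonoidAlgebra.single g k = k • (MonoidAlgebra.single g 1 : FreeLeavitt K V E) := by
      simp
    rw [this, mk_smul]
    refine Submodule.smul_mem _ _ ?_
    induction g using FreeSemigroup.recOnMul with
    | ih1 g => exact mk_of_mem g
    | ih2 g y _ ih =>
      have : (MonoidAlgebra.single (FreeSemigroup.of g * y) 1 : FreeLeavitt K V E) =
          MonoidAlgebra.single (FreeSemigroup.of g) 1 * MonoidAlgebra.single y 1 := by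
        simp
      rw [this, mk_mul]
      replace ih := ih (by simp)
      generalize mk K G (MonoidAlgebra.single y 1) = z at ih ⊢
      induction ih using Submodule.span_induction with
      | mem x hx => exact mk_of_mul_monomial_mem g hx
      | zero => rw [mul_zero]; exact zero_mem _
      | add x y _ _ hx hy => rw [mul_add]; exact add_mem hx hy
      | smul k x _ hx => rw [mul_smul_comm]; exact Submodule.smul_mem _ _ hx

/-- Every element is a sum of homogeneous elements. -/
theorem exists_homogeneous_sum (x : LeavittPathAlgebra K G) :
    ∃ f : ℤ →₀ LeavittPathAlgebra K G, (∀ n, f n ∈ grading K G n) ∧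
      (f.sum fun _ y => y) = x := by
  induction mem_span_monomials x using Submodule.span_induction with
  | mem x hx =>
    obtain ⟨a, b, c, p, q, hp, hq, rfl⟩ := hx
    refine ⟨Finsupp.single ((p.length : ℤ) - q.length) (path K G a p * ghostPath K G b q),
      fun n => ?_, Finsupp.sum_single_index rfl⟩
    rw [Finsupp.single_apply]
    split_ifs with h
    · exact Submodule.subset_span ⟨a, b, c, p, q, hp, hq, h, rfl⟩
    · exact zero_mem _
  | zero => exact ⟨0, fun n => zero_mem _, by simp⟩
  | add x y _ _ hx hy =>
    obtain ⟨f, hf, rfl⟩ := hx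
    obtain ⟨g, hg, rfl⟩ := hy
    exact ⟨f + g, fun n => add_mem (hf n) (hg n),
      Finsupp.sum_add_index' (fun _ => rfl) (fun _ _ _ => rfl)⟩
  | smul k x _ hx =>
    obtain ⟨f, hf, rfl⟩ := hx
    refine ⟨k • f, fun n => Submodule.smul_mem (component K G n) k (hf n), ?_⟩
    rw [Finsupp.sum_smul_index' (fun _ => rfl), Finsupp.smul_sum]

/-- Every element has a two-sided local unit which is a sum of vertices. -/
theorem exists_local_unit (x : LeavittPathAlgebra K G) :
    ∃ F : Finset V, ∀ F', F ⊆ F' →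
      (∑ a ∈ F', vert K G a) * x = x ∧ x * (∑ a ∈ F', vert K G a) = x := by
  classical
  induction mem_span_monomials x using Submodule.span_induction with
  | mem x hx =>
    obtain ⟨a, b, c, p, q, hp, hq, rfl⟩ := hx
    refine ⟨{a, b}, fun F' hF => ⟨?_, ?_⟩⟩
    · rw [Finset.sum_mul, Finset.sum_eq_single a]
      · rw [← mul_assoc, vert_mul_path hp]
      · intro d _ hd
        rw [← mul_assoc, vert_mul_path_of_ne hp hd, zero_mul]
      · intro ha; exact absurd (hF (by simp)) ha
    · rw [Finset.mul_sum, Finset.sum_eq_single b]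
      · rw [mul_assoc, ghostPath_mul_vert hq]
      · intro d _ hd
        rw [mul_assoc, ghostPath_mul_vert_of_ne hq hd.symm, mul_zero]
      · intro ha; exact absurd (hF (by simp)) ha
  | zero => exact ⟨∅, fun _ _ => ⟨mul_zero _, zero_mul _⟩⟩
  | add x y _ _ hx hy =>
    obtain ⟨F, hF⟩ := hx
    obtain ⟨F', hF'⟩ := hy
    refine ⟨F ∪ F', fun T hT => ?_⟩
    rw [mul_add, add_mul, (hF T (Finset.union_subset_left hT)).1,
      (hF T (Finset.union_subset_left hT)).2, (hF' T (Finset.union_subset_right hT)).1,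
      (hF' T (Finset.union_subset_right hT)).2]
    exact ⟨rfl, rfl⟩
  | smul k x _ hx =>
    obtain ⟨F, hF⟩ := hx
    refine ⟨F, fun T hT => ?_⟩
    rw [mul_smul_comm, smul_mul_assoc, (hF T hT).1, (hF T hT).2]
    exact ⟨rfl, rfl⟩

/-- Ring ideals are automatically subspaces: for a local unit `u` of `x` one has `k x = (k u) x`. -/
theorem smul_mem_ideal (P : TwoSidedIdeal (LeavittPathAlgebra K G)) (k : K)
    {x : LeavittPathAlgebra K G} (hx : x ∈ P) : k • x ∈ P := by
  obtain ⟨F, hF⟩ := exists_local_unit x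
  rw [← (hF F subset_rfl).1, ← smul_mul_assoc]
  exact P.mul_mem_left _ _ hx

theorem sum_mem_ideal (P : TwoSidedIdeal (LeavittPathAlgebra K G)) {ι : Type*} {T : Finset ι}
    {f : ι → LeavittPathAlgebra K G} (h : ∀ i ∈ T, f i ∈ P) : ∑ i ∈ T, f i ∈ P :=
  sum_mem h

/-- An element outside an ideal is detected on the monomials. -/
theorem exists_monomial_notMem (P : TwoSidedIdeal (LeavittPathAlgebra K G))
    {x y z : LeavittPathAlgebra K G} (h : x * y * z ∉ P) :
    ∃ t ∈ monomials K G, x * t * z ∉ P := by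
  by_contra! hcon
  apply h
  clear h
  induction mem_span_monomials y using Submodule.span_induction with
  | mem y hy => exact hcon y hy
  | zero => rw [mul_zero, zero_mul]; exact P.zero_mem
  | add y t _ _ hy ht => rw [mul_add, add_mul]; exact P.add_mem hy ht
  | smul k y _ hy => rw [mul_smul_comm, smul_mul_assoc]; exact smul_mem_ideal P k hy

end Monomials

/-! ### The involution -/

section Involution

variable (K : Type u) [Field K] {V : Type v} {E : Type w} (G : DirGraph V E)

open MulOpposite in
/-- The family in the opposite algebra which interchanges the edges and the ghost edges. -/
noncomputable def opFamily : Family K G (LeavittPathAlgebra K G)ᵐᵒᵖ where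
  vert a := op (vert K G a)
  edge e := op (ghost K G e)
  ghost e := op (edge K G e)
  vert_mul_self a := by rw [← op_mul, LeavittPathAlgebra.vert_mul_self]
  vert_mul_vert a b h := by rw [← op_mul, LeavittPathAlgebra.vert_mul_vert h.symm, op_zero]
  source_mul_edge e := by rw [← op_mul, LeavittPathAlgebra.ghost_mul_source]
  edge_mul_range e := by rw [← op_mul, LeavittPathAlgebra.range_mul_ghost]
  range_mul_ghost e := by rw [← op_mul, LeavittPathAlgebra.edge_mul_range]
  ghost_mul_source e := by rw [← op_mul, LeavittPathAlgebra.source_mul_edge]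
  ghost_mul_edge_self e := by rw [← op_mul, LeavittPathAlgebra.ghost_mul_edge_self]
  ghost_mul_edge e f h := by rw [← op_mul, LeavittPathAlgebra.ghost_mul_edge h.symm, op_zero]
  vert_eq_sum a h := by
    rw [LeavittPathAlgebra.vert_eq_sum h, Finset.op_sum]
    simp only [op_mul]

/-- The involution of `L_K(E)`. -/
noncomputable def invol : LeavittPathAlgebra K G →ₗ[K] LeavittPathAlgebra K G :=
  (MulOpposite.opLinearEquiv K).symm.toLinearMap ∘ₗ
    ((opFamily K G).lift : LeavittPathAlgebra K G →ₗ[K] (LeavittPathAlgebra K G)ᵐᵒᵖ)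

variable {K G}

theorem invol_apply (x : LeavittPathAlgebra K G) :
    invol K G x = ((opFamily K G).lift x).unop := rfl

theorem invol_mul (x y : LeavittPathAlgebra K G) :
    invol K G (x * y) = invol K G y * invol K G x := by
  simp only [invol_apply, map_mul, MulOpposite.unop_mul]

theorem invol_vert (a : V) : invol K G (vert K G a) = vert K G a := by
  rw [invol_apply, Family.lift_vert]; rfl

theorem invol_edge (e : E) : invol K G (edge K G e) = ghost K G e := by
  rw [invol_apply, Family.lift_edge]; rfl

theorem invol_ghost (e : E) : invol K G (ghost K G e) = edge K G e := by
  rw [invol_apply, Family.lift_ghost]; rfl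

theorem invol_path (a : V) (p : List E) : invol K G (path K G a p) = ghostPath K G a p := by
  induction p generalizing a with
  | nil => exact invol_vert a
  | cons e p ih => rw [path, ghostPath, invol_mul, invol_edge, ih]

theorem invol_ghostPath (a : V) (p : List E) :
    invol K G (ghostPath K G a p) = path K G a p := by
  induction p generalizing a with
  | nil => exact invol_vert a
  | cons e p ih => rw [path, ghostPath, invol_mul, invol_ghost, ih]

theorem invol_invol (x : LeavittPathAlgebra K G) : invol K G (invol K G x) = x := by
  induction mem_span_monomials x using Submodule.span_induction with
  | mem x hx =>
    obtain ⟨a, b, c, p, q, hp, hq, rfl⟩ := hx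
    simp only [invol_mul, invol_path, invol_ghostPath]
  | zero => simp only [map_zero]
  | add x y _ _ hx hy => simp only [map_add, hx, hy]
  | smul k x _ hx => simp only [map_smul, hx]

theorem invol_mem_grading {n : ℤ} {x : LeavittPathAlgebra K G} (hx : x ∈ grading K G n) :
    invol K G x ∈ grading K G (-n) := by
  change x ∈ component K G n at hx
  change invol K G x ∈ component K G (-n)
  induction hx using Submodule.span_induction with
  | mem x hx =>
    obtain ⟨a, b, c, p, q, hp, hq, hn, rfl⟩ := hx
    rw [invol_mul, invol_path, invol_ghostPath]
    exact Submodule.subset_span ⟨b, a, c, q, p, hq, hp, by omega, rfl⟩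
  | zero => rw [map_zero]; exact zero_mem _
  | add x y _ _ hx hy => rw [map_add]; exact add_mem hx hy
  | smul k x _ hx => rw [map_smul]; exact Submodule.smul_mem _ _ hx

theorem invol_breakingElement {H : Set V} {a : V} (h : (G.emittedOutside H a).Finite) :
    invol K G (breakingElement K G H a) = breakingElement K G H a := by
  rw [breakingElement_eq h, map_sub, invol_vert, map_sum]
  simp only [invol_mul, invol_edge, invol_ghost]

/-- The inverse image of an ideal under the involution. -/
noncomputable def involComap (P : TwoSidedIdeal (LeavittPathAlgebra K G)) :
    TwoSidedIdeal (LeavittPathAlgebra K G) :=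
  TwoSidedIdeal.mk' {x | invol K G x ∈ P}
    (by change invol K G 0 ∈ P; rw [map_zero]; exact P.zero_mem)
    (fun {x y} hx hy => by
      change invol K G (x + y) ∈ P; rw [map_add]; exact P.add_mem hx hy)
    (fun {x} hx => by change invol K G (-x) ∈ P; rw [map_neg]; exact P.neg_mem hx)
    (fun {x y} hy => by
      change invol K G (x * y) ∈ P; rw [invol_mul]; exact P.mul_mem_right _ _ hy)
    (fun {x y} hx => by
      change invol K G (x * y) ∈ P; rw [invol_mul]; exact P.mul_mem_left _ _ hx)

theorem mem_involComap {P : TwoSidedIdeal (LeavittPathAlgebra K G)}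
    {x : LeavittPathAlgebra K G} : x ∈ involComap P ↔ invol K G x ∈ P := by
  rw [involComap, TwoSidedIdeal.mem_mk']; rfl

/-- All generators of `I(H, S)` are fixed by the involution. -/
theorem invol_mem_idealOf {H S : Set V} (hS : S ⊆ G.breaking H) {x : LeavittPathAlgebra K G}
    (hx : x ∈ idealOf K G H S) : invol K G x ∈ idealOf K G H S := by
  have hle : idealOf K G H S ≤ involComap (idealOf K G H S) := by
    refine TwoSidedIdeal.span_le.2 ?_
    rintro x (⟨a, ha, rfl⟩ | ⟨a, ha, rfl⟩)
    · rw [SetLike.mem_coe, mem_involComap, invol_vert]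
      exact TwoSidedIdeal.subset_span (Or.inl ⟨a, ha, rfl⟩)
    · rw [SetLike.mem_coe, mem_involComap, invol_breakingElement (hS ha).2.2.2]
      exact TwoSidedIdeal.subset_span (Or.inr ⟨a, ha, rfl⟩)
  exact mem_involComap.1 (hle hx)

end Involution

end LeavittPathAlgebra

namespace LeavittPathAlgebra

/-! ### Graded ideals are generated by vertices and breaking elements -/

section GradedIdeals

variable {K : Type u} [Field K] {V : Type v} {E : Type w} {G : DirGraph V E}

/-- The vertices in an ideal. -/
def vertexSet (P : TwoSidedIdeal (LeavittPathAlgebra K G)) : Set V := {a | vert K G a ∈ P}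

/-- The breaking vertices whose breaking elements are in an ideal. -/
def breakingSet (P : TwoSidedIdeal (LeavittPathAlgebra K G)) : Set V :=
  {a | a ∈ G.breaking (vertexSet P) ∧ breakingElement K G (vertexSet P) a ∈ P}

/-- The graded part `I(H, S)` of an ideal. -/
noncomputable def gradedPart (P : TwoSidedIdeal (LeavittPathAlgebra K G)) :
    TwoSidedIdeal (LeavittPathAlgebra K G) :=
  idealOf K G (vertexSet P) (breakingSet P)

variable {P : TwoSidedIdeal (LeavittPathAlgebra K G)}

theorem mem_vertexSet {a : V} : a ∈ vertexSet P ↔ vert K G a ∈ P := Iff.rfl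

theorem edge_mem_of_range {e : E} (h : G.r e ∈ vertexSet P) : edge K G e ∈ P := by
  rw [← edge_mul_range]; exact P.mul_mem_left _ _ h

theorem ghost_mem_of_range {e : E} (h : G.r e ∈ vertexSet P) : ghost K G e ∈ P := by
  rw [← range_mul_ghost]; exact P.mul_mem_right _ _ h

theorem vertexSet_hereditary (P : TwoSidedIdeal (LeavittPathAlgebra K G)) :
    G.IsHereditary (vertexSet P) := by
  rintro a b ha ⟨p, hp⟩
  rw [mem_vertexSet, ← ghostPath_mul_path_self hp, ← vert_mul_path hp]
  exact P.mul_mem_left _ _ (P.mul_mem_right _ _ ha)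

theorem vertexSet_saturated (P : TwoSidedIdeal (LeavittPathAlgebra K G)) :
    G.IsSaturated (vertexSet P) := by
  intro a ha h
  rw [mem_vertexSet, vert_eq_sum ha]
  refine sum_mem_ideal P fun e he => P.mul_mem_right _ _ (edge_mem_of_range (h e ?_))
  simpa [DirGraph.emitted] using he

theorem isAdmissible_sets (P : TwoSidedIdeal (LeavittPathAlgebra K G)) :
    G.IsAdmissible (vertexSet P) (breakingSet P) :=
  ⟨vertexSet_hereditary P, vertexSet_saturated P, fun _ ha => ha.1⟩

theorem gradedPart_le (P : TwoSidedIdeal (LeavittPathAlgebra K G)) : gradedPart P ≤ P := by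
  refine TwoSidedIdeal.span_le.2 ?_
  rintro x (⟨a, ha, rfl⟩ | ⟨a, ha, rfl⟩)
  · exact ha
  · exact ha.2

theorem vert_mem_gradedPart {a : V} (h : vert K G a ∈ P) : vert K G a ∈ gradedPart P :=
  TwoSidedIdeal.subset_span (Or.inl ⟨a, h, rfl⟩)

/-- Consequently `a^H` annihilates all edges from `a` modulo any ideal that contains `H`. -/
theorem breakingElement_mul_edge {H : Set V} {a : V} (h : (G.emittedOutside H a).Finite) {e : E}
    (he : G.s e = a) :
    breakingElement K G H a * edge K G e = 0 ∨
      G.r e ∈ H ∧ breakingElement K G H a * edge K G e = edge K G e := by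
  subst he
  rw [breakingElement_eq h, sub_mul, source_mul_edge, Finset.sum_mul]
  by_cases hr : G.r e ∈ H
  · refine Or.inr ⟨hr, ?_⟩
    rw [Finset.sum_eq_zero, sub_zero]
    intro f hf
    have hfe : f ≠ e := by
      rintro rfl
      exact ((Set.Finite.mem_toFinset h).1 hf).2 hr
    rw [mul_assoc, ghost_mul_edge hfe, mul_zero]
  · left
    rw [Finset.sum_eq_single e, mul_assoc, ghost_mul_edge_self, edge_mul_range, sub_self]
    · intro f _ hfe
      rw [mul_assoc, ghost_mul_edge hfe, mul_zero]
    · intro hne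
      exact absurd ((Set.Finite.mem_toFinset h).2 ⟨rfl, hr⟩) hne

theorem breakingElement_mul_vert {H : Set V} {a : V} (h : (G.emittedOutside H a).Finite) :
    breakingElement K G H a * vert K G a = breakingElement K G H a := by
  rw [breakingElement_eq h, sub_mul, vert_mul_self, Finset.sum_mul]
  congr 1
  refine Finset.sum_congr rfl fun e he => ?_
  obtain rfl : G.s e = a := ((Set.Finite.mem_toFinset h).1 he).1
  rw [mul_assoc, ghost_mul_source]

/-- The element `a - ∑ e e*`, the sum over the edges to the complement of `H`, is in the ideal only
for the reasons which are visible in `H` and `S`. -/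
theorem breakingElement_mem_gradedPart {a : V}
    (hfin : (G.emittedOutside (vertexSet P) a).Finite)
    (h : breakingElement K G (vertexSet P) a ∈ P) :
    breakingElement K G (vertexSet P) a ∈ gradedPart P := by
  -- Only a breaking vertex yields a generator. Otherwise there are no edges outside `H` and the
  -- element is `a`, or `a` is regular and the element is the sum of `e e*` over the edges into `H`,
  -- or `a ∈ H` and every term is in the ideal.
  by_cases hne : (G.emittedOutside (vertexSet P) a).Nonempty
  swap
  · rw [Set.not_nonempty_iff_eq_empty] at hne
    have hz : breakingElement K G (vertexSet P) a = vert K G a := by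
      rw [breakingElement, hne]; simp
    rw [hz] at h ⊢
    exact vert_mem_gradedPart h
  by_cases hinf : (G.emitted a).Finite
  · have hreg : G.IsRegular a := by
      obtain ⟨e, he, -⟩ := hne
      exact ⟨⟨e, he⟩, hinf⟩
    classical
    have hsub : hfin.toFinset ⊆ hreg.2.toFinset := by
      rw [Set.Finite.toFinset_subset_toFinset]; exact fun e he => he.1
    rw [breakingElement_eq hfin, vert_eq_sum hreg, ← Finset.sum_sdiff hsub, add_sub_cancel_right]
    refine sum_mem_ideal _ fun e he => ?_
    rw [← edge_mul_range e]
    refine TwoSidedIdeal.mul_mem_right _ _ _ (TwoSidedIdeal.mul_mem_left _ _ _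
      (vert_mem_gradedPart ?_))
    rw [Finset.mem_sdiff, Set.Finite.mem_toFinset, Set.Finite.mem_toFinset] at he
    by_contra hr
    exact he.2 ⟨he.1, hr⟩
  · by_cases haH : a ∈ vertexSet P
    · rw [breakingElement_eq hfin]
      refine TwoSidedIdeal.sub_mem _ (vert_mem_gradedPart haH) (sum_mem_ideal _ fun e he => ?_)
      obtain rfl : G.s e = a := ((Set.Finite.mem_toFinset hfin).1 he).1
      rw [← source_mul_edge e]
      exact TwoSidedIdeal.mul_mem_right _ _ _
        (TwoSidedIdeal.mul_mem_right _ _ _ (vert_mem_gradedPart haH))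
    · exact TwoSidedIdeal.subset_span (Or.inr ⟨a, ⟨⟨haH, hinf, hne, hfin⟩, h⟩, rfl⟩)

variable (K G) in
/-- An exhaustive filtration of the component of degree zero. -/
noncomputable def level : ℕ → Submodule K (LeavittPathAlgebra K G)
  | 0 => Submodule.span K (Set.range (vert K G))
  | n + 1 => Submodule.span K (Set.range (vert K G) ∪
      {x | ∃ e f, ∃ y ∈ level n, x = edge K G e * y * ghost K G f})

theorem vert_mem_level (a : V) (n : ℕ) : vert K G a ∈ level K G n := by
  cases n with
  | zero => exact Submodule.subset_span ⟨a, rfl⟩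
  | succ n => exact Submodule.subset_span (Or.inl ⟨a, rfl⟩)

theorem level_le_succ (n : ℕ) : level K G n ≤ level K G (n + 1) := by
  induction n with
  | zero =>
    refine Submodule.span_le.2 ?_
    rintro _ ⟨a, rfl⟩
    exact vert_mem_level a 1
  | succ n ih =>
    refine Submodule.span_le.2 ?_
    rintro _ (⟨a, rfl⟩ | ⟨e, f, y, hy, rfl⟩)
    · exact vert_mem_level a _
    · exact Submodule.subset_span (Or.inr ⟨e, f, y, ih hy, rfl⟩)

theorem level_mono : Monotone (level K G) := monotone_nat_of_le_succ level_le_succ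

theorem monomial_mem_level {a b c : V} {p q : List E} (hp : G.IsPath a p c)
    (hq : G.IsPath b q c) (h : p.length = q.length) :
    path K G a p * ghostPath K G b q ∈ level K G p.length := by
  induction hp generalizing b q with
  | nil a =>
    obtain rfl := List.length_eq_zero_iff.1 h.symm
    obtain rfl := hq.eq_of_nil
    exact (vert_mul_self (K := K) (G := G) b).symm ▸ vert_mem_level b 0
  | @cons e p c hp ih =>
    cases q with
    | nil => simp at h
    | cons f q =>
      refine Submodule.subset_span (Or.inr ⟨e, f, _, ih hq.tail (by simpa using h), ?_⟩)
      simp only [path, ghostPath, mul_assoc]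

theorem exists_mem_level {x : LeavittPathAlgebra K G} (hx : x ∈ component K G 0) :
    ∃ n, x ∈ level K G n := by
  induction hx using Submodule.span_induction with
  | mem x hx =>
    obtain ⟨a, b, c, p, q, hp, hq, hn, rfl⟩ := hx
    exact ⟨_, monomial_mem_level hp hq (by omega)⟩
  | zero => exact ⟨0, zero_mem _⟩
  | add x y _ _ hx hy =>
    obtain ⟨m, hm⟩ := hx
    obtain ⟨n, hn⟩ := hy
    exact ⟨max m n, add_mem (level_mono (le_max_left m n) hm) (level_mono (le_max_right m n) hn)⟩
  | smul k x _ hx =>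
    obtain ⟨m, hm⟩ := hx
    exact ⟨m, Submodule.smul_mem _ _ hm⟩

theorem vert_mul_mem_level (a : V) {n : ℕ} {x : LeavittPathAlgebra K G}
    (hx : x ∈ level K G n) : vert K G a * x ∈ level K G n := by
  have hvert : ∀ b, vert K G a * vert K G b ∈ level K G n := by
    intro b
    by_cases hab : a = b
    · subst hab; rw [vert_mul_self]; exact vert_mem_level a n
    · rw [vert_mul_vert hab]; exact zero_mem _
  cases n with
  | zero =>
    induction hx using Submodule.span_induction with
    | mem x hx => obtain ⟨b, rfl⟩ := hx; exact hvert b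
    | zero => rw [mul_zero]; exact zero_mem _
    | add x y _ _ hx hy => rw [mul_add]; exact add_mem hx hy
    | smul k x _ hx => rw [mul_smul_comm]; exact Submodule.smul_mem _ _ hx
  | succ n =>
    induction hx using Submodule.span_induction with
    | mem x hx =>
      obtain ⟨b, rfl⟩ | ⟨e, f, y, hy, rfl⟩ := hx
      · exact hvert b
      · by_cases he : G.s e = a
        · subst he
          rw [← mul_assoc, ← mul_assoc, source_mul_edge]
          exact Submodule.subset_span (Or.inr ⟨e, f, y, hy, rfl⟩)
        · rw [← mul_assoc, ← mul_assoc, vert_mul_edge he, zero_mul, zero_mul]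
          exact zero_mem _
    | zero => rw [mul_zero]; exact zero_mem _
    | add x y _ _ hx hy => rw [mul_add]; exact add_mem hx hy
    | smul k x _ hx => rw [mul_smul_comm]; exact Submodule.smul_mem _ _ hx

theorem invol_mem_level {n : ℕ} {x : LeavittPathAlgebra K G}
    (hx : x ∈ level K G n) : invol K G x ∈ level K G n := by
  induction n generalizing x with
  | zero =>
    induction hx using Submodule.span_induction with
    | mem x hx => obtain ⟨b, rfl⟩ := hx; rw [invol_vert]; exact vert_mem_level b 0
    | zero => rw [map_zero]; exact zero_mem _
    | add x y _ _ hx hy => rw [map_add]; exact add_mem hx hy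
    | smul k x _ hx => rw [map_smul]; exact Submodule.smul_mem _ _ hx
  | succ n ih =>
    induction hx using Submodule.span_induction with
    | mem x hx =>
      obtain ⟨b, rfl⟩ | ⟨e, f, y, hy, rfl⟩ := hx
      · rw [invol_vert]; exact vert_mem_level b _
      · rw [invol_mul, invol_mul, invol_edge, invol_ghost, ← mul_assoc]
        exact Submodule.subset_span (Or.inr ⟨f, e, _, ih hy, rfl⟩)
    | zero => rw [map_zero]; exact zero_mem _
    | add x y _ _ hx hy => rw [map_add]; exact add_mem hx hy
    | smul k x _ hx => rw [map_smul]; exact Submodule.smul_mem _ _ hx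

theorem mul_vert_mem_level (a : V) {n : ℕ} {x : LeavittPathAlgebra K G}
    (hx : x ∈ level K G n) : x * vert K G a ∈ level K G n := by
  have := invol_mem_level (vert_mul_mem_level a (invol_mem_level hx))
  rwa [invol_mul, invol_invol, invol_vert] at this

/-- The normal form of an element of the filtration. -/
theorem exists_normalForm {n : ℕ} {x : LeavittPathAlgebra K G} (hx : x ∈ level K G (n + 1)) :
    ∃ (k : V →₀ K) (F : Finset E) (y : E → E → LeavittPathAlgebra K G),
      (∀ e f, y e f ∈ level K G n) ∧
      x = (k.sum fun a l => l • vert K G a) +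
        ∑ e ∈ F, ∑ f ∈ F, edge K G e * y e f * ghost K G f := by
  classical
  induction hx using Submodule.span_induction with
  | mem x hx =>
    obtain ⟨b, rfl⟩ | ⟨e, f, y, hy, rfl⟩ := hx
    · exact ⟨Finsupp.single b 1, ∅, 0, fun _ _ => zero_mem _, by simp⟩
    · refine ⟨0, {e, f}, fun e' f' => if e' = e ∧ f' = f then y else 0, fun e' f' => ?_, ?_⟩
      · dsimp only
        split_ifs
        · exact hy
        · exact zero_mem _
      · rw [Finset.sum_eq_single e, Finset.sum_eq_single f]
        · simp
        · intro g _ hg; simp [hg]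
        · simp
        · intro g _ hg; simp [hg]
        · simp
  | zero => exact ⟨0, ∅, 0, fun _ _ => zero_mem _, by simp⟩
  | add x x' _ _ hx hx' =>
    obtain ⟨k, F, y, hy, rfl⟩ := hx
    obtain ⟨k', F', y', hy', rfl⟩ := hx'
    -- Padding with zero coefficients brings two normal forms to a common index set.
    have key : ∀ (F T : Finset E) (y : E → E → LeavittPathAlgebra K G), F ⊆ T →
        ∑ e ∈ F, ∑ f ∈ F, edge K G e * y e f * ghost K G f =
          ∑ e ∈ T, ∑ f ∈ T,
            edge K G e * (if e ∈ F ∧ f ∈ F then y e f else 0) * ghost K G f := by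
      intro F T y hFT
      refine Finset.sum_subset_zero_on_sdiff hFT ?_ ?_
      · intro e he
        refine Finset.sum_eq_zero fun f _ => ?_
        rw [if_neg (fun h => (Finset.mem_sdiff.1 he).2 h.1), mul_zero, zero_mul]
      · intro e he
        refine Finset.sum_subset_zero_on_sdiff hFT ?_ ?_
        · intro f hf
          rw [if_neg (fun h => (Finset.mem_sdiff.1 hf).2 h.2), mul_zero, zero_mul]
        · intro f hf
          rw [if_pos ⟨he, hf⟩]
    refine ⟨k + k', F ∪ F', fun e f => (if e ∈ F ∧ f ∈ F then y e f else 0) +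
      (if e ∈ F' ∧ f ∈ F' then y' e f else 0), fun e f => ?_, ?_⟩
    · refine add_mem ?_ ?_
      · split_ifs
        · exact hy e f
        · exact zero_mem _
      · split_ifs
        · exact hy' e f
        · exact zero_mem _
    · rw [Finsupp.sum_add_index' (h := fun a l => l • vert K G a) (fun _ => zero_smul _ _)
        (fun _ _ _ => add_smul _ _ _), key F (F ∪ F') y Finset.subset_union_left,
        key F' (F ∪ F') y' Finset.subset_union_right]
      simp only [mul_add, add_mul, Finset.sum_add_distrib]
      abel
  | smul l x _ hx =>
    obtain ⟨k, F, y, hy, rfl⟩ := hx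
    refine ⟨l • k, F, fun e f => l • y e f, fun e f => Submodule.smul_mem _ _ (hy e f), ?_⟩
    rw [Finsupp.sum_smul_index (h := fun a l => l • vert K G a) (fun _ => zero_smul _ _), smul_add,
      Finsupp.smul_sum, Finset.smul_sum]
    simp only [Finset.smul_sum, mul_smul_comm, smul_mul_assoc, mul_smul]

/-- The sum behaves like a matrix with entries `y e f`; by (CK1) multiplication with `e*` and `f`
reads off one entry. -/
theorem ghost_mul_sum_mul_edge (F : Finset E) (y : E → E → LeavittPathAlgebra K G) {e f : E}
    (he : e ∈ F) (hf : f ∈ F) :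
    ghost K G e * (∑ e ∈ F, ∑ f ∈ F, edge K G e * y e f * ghost K G f) * edge K G f =
      vert K G (G.r e) * y e f * vert K G (G.r f) := by
  rw [Finset.mul_sum, Finset.sum_mul, Finset.sum_eq_single e]
  · rw [Finset.mul_sum, Finset.sum_mul, Finset.sum_eq_single f]
    · rw [← ghost_mul_edge_self e, ← ghost_mul_edge_self f]
      simp only [mul_assoc]
    · intro g _ hg
      rw [mul_assoc, mul_assoc, ghost_mul_edge hg, mul_zero, mul_zero]
    · exact fun h => absurd hf h
  · intro g _ hg
    rw [Finset.mul_sum, Finset.sum_mul]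
    refine Finset.sum_eq_zero fun h _ => ?_
    rw [← mul_assoc, ← mul_assoc, ghost_mul_edge hg.symm, zero_mul, zero_mul, zero_mul]
  · exact fun h => absurd he h

/-- Each entry, cut down by range vertices, lies in `P` and one level lower. -/
theorem sum_mem_gradedPart {n : ℕ} (ih : ∀ x ∈ level K G n, x ∈ P → x ∈ gradedPart P)
    {F : Finset E} {y : E → E → LeavittPathAlgebra K G} (hy : ∀ e f, y e f ∈ level K G n)
    (h : ∑ e ∈ F, ∑ f ∈ F, edge K G e * y e f * ghost K G f ∈ P) :
    ∑ e ∈ F, ∑ f ∈ F, edge K G e * y e f * ghost K G f ∈ gradedPart P := by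
  refine sum_mem_ideal _ fun e he => sum_mem_ideal _ fun f hf => ?_
  have h1 : vert K G (G.r e) * y e f * vert K G (G.r f) ∈ gradedPart P := by
    refine ih _ (mul_vert_mem_level _ (vert_mul_mem_level _ (hy e f))) ?_
    rw [← ghost_mul_sum_mul_edge F y he hf]
    exact P.mul_mem_right _ _ (P.mul_mem_left _ _ h)
  have h2 : edge K G e * y e f * ghost K G f =
      edge K G e * (vert K G (G.r e) * y e f * vert K G (G.r f)) * ghost K G f := by
    conv_lhs => rw [← edge_mul_range e, ← range_mul_ghost f]
    simp only [mul_assoc]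
  rw [h2]
  exact TwoSidedIdeal.mul_mem_right _ _ _ (TwoSidedIdeal.mul_mem_left _ _ _ h1)

/-- The step in which breaking elements appear: the vertex term is traded for `a^H`, which lies in
the graded part, and a pure sum is left. -/
theorem vert_add_sum_mem_gradedPart {n : ℕ}
    (ih : ∀ x ∈ level K G n, x ∈ P → x ∈ gradedPart P)
    {a : V} {F : Finset E} (hF : ∀ e ∈ F, G.s e = a) {y : E → E → LeavittPathAlgebra K G}
    (hy : ∀ e f, y e f ∈ level K G n)
    (h : vert K G a + ∑ e ∈ F, ∑ f ∈ F, edge K G e * y e f * ghost K G f ∈ P) :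
    vert K G a + ∑ e ∈ F, ∑ f ∈ F, edge K G e * y e f * ghost K G f ∈ gradedPart P := by
  classical
  -- For an edge `e ∉ F` from `a`, compressing the given element by `e*` and `e` leaves exactly `r
  -- e`, which is therefore in `P`.
  have hsub : G.emittedOutside (vertexSet P) a ⊆ F := by
    rintro e ⟨rfl, her⟩
    by_contra heF
    apply her
    have h1 := P.mul_mem_right _ (edge K G e) (P.mul_mem_left (ghost K G e) _ h)
    rw [mul_add, add_mul, ghost_mul_source, ghost_mul_edge_self, Finset.mul_sum, Finset.sum_mul,
      Finset.sum_eq_zero, add_zero] at h1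
    · exact h1
    · intro f hf
      rw [Finset.mul_sum, Finset.sum_mul]
      refine Finset.sum_eq_zero fun g _ => ?_
      have hef : e ≠ f := by rintro rfl; exact heF hf
      rw [← mul_assoc, ← mul_assoc, ghost_mul_edge hef, zero_mul, zero_mul, zero_mul]
  have hfin : (G.emittedOutside (vertexSet P) a).Finite := F.finite_toSet.subset hsub
  -- Multiplying from the left by `a^H` reproduces `a^H` from the vertex term and sends the sum into
  -- `P`.
  have hz : breakingElement K G (vertexSet P) a ∈ P := by
    have h1 := P.mul_mem_left (breakingElement K G (vertexSet P) a) _ h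
    rw [mul_add, breakingElement_mul_vert hfin] at h1
    have h2 : breakingElement K G (vertexSet P) a *
        ∑ e ∈ F, ∑ f ∈ F, edge K G e * y e f * ghost K G f ∈ P := by
      rw [Finset.mul_sum]
      refine sum_mem_ideal P fun e he => ?_
      rw [Finset.mul_sum]
      refine sum_mem_ideal P fun f _ => ?_
      rw [← mul_assoc, ← mul_assoc]
      refine P.mul_mem_right _ _ (P.mul_mem_right _ _ ?_)
      rcases breakingElement_mul_edge (K := K) hfin (hF e he) with h3 | ⟨h3, h4⟩
      · rw [h3]; exact P.zero_mem
      · rw [h4]; exact edge_mem_of_range h3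
    simpa using P.sub_mem h1 h2
  have hzI := breakingElement_mem_gradedPart hfin hz
  -- The terms `e e*` by which `a` differs from `a^H` are absorbed into the diagonal coefficients.
  have hx : vert K G a + ∑ e ∈ F, ∑ f ∈ F, edge K G e * y e f * ghost K G f =
      breakingElement K G (vertexSet P) a + ∑ e ∈ F, ∑ f ∈ F, edge K G e *
        (y e f + if e = f ∧ e ∈ hfin.toFinset then vert K G (G.r e) else 0) * ghost K G f := by
    have h1 : ∑ e ∈ hfin.toFinset, edge K G e * ghost K G e = ∑ e ∈ F, ∑ f ∈ F, edge K G e *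
        (if e = f ∧ e ∈ hfin.toFinset then vert K G (G.r e) else 0) * ghost K G f := by
      refine Finset.sum_subset_zero_on_sdiff (by simpa using hsub) ?_ ?_
      · intro e he
        refine Finset.sum_eq_zero fun f _ => ?_
        rw [if_neg (fun h => (Finset.mem_sdiff.1 he).2 h.2), mul_zero, zero_mul]
      · intro e he
        rw [Finset.sum_eq_single e]
        · rw [if_pos ⟨rfl, he⟩, edge_mul_range]
        · intro f _ hf
          rw [if_neg (fun h => hf h.1.symm), mul_zero, zero_mul]
        · exact fun h => absurd (hsub ((Set.Finite.mem_toFinset hfin).1 he)) h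
    simp only [mul_add, add_mul, Finset.sum_add_distrib]
    rw [← h1, breakingElement_eq hfin]
    abel
  rw [hx] at h ⊢
  refine TwoSidedIdeal.add_mem _ hzI (sum_mem_gradedPart ih (fun e f => ?_) ?_)
  · refine add_mem (hy e f) ?_
    split_ifs
    · exact vert_mem_level _ _
    · exact zero_mem _
  · simpa using P.sub_mem h hz

theorem mem_of_vert_mul_vert (I : TwoSidedIdeal (LeavittPathAlgebra K G))
    {x : LeavittPathAlgebra K G} (h : ∀ a b, vert K G a * x * vert K G b ∈ I) : x ∈ I := by
  obtain ⟨F, hF⟩ := exists_local_unit x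
  rw [← (hF F subset_rfl).2, Finset.mul_sum]
  refine sum_mem_ideal _ fun b _ => ?_
  rw [← (hF F subset_rfl).1, Finset.sum_mul, Finset.sum_mul]
  exact sum_mem_ideal _ fun a _ => h a b

theorem vert_mul_sum_mul_vert [DecidableEq V] (k : V →₀ K) (a b : V) :
    vert K G a * (k.sum fun a l => l • vert K G a) * vert K G b =
      if a = b then k a • vert K G a else 0 := by
  have h1 : vert K G a * (k.sum fun a l => l • vert K G a) = k a • vert K G a := by
    rw [Finsupp.mul_sum, Finsupp.sum, Finset.sum_eq_single a]
    · rw [mul_smul_comm, vert_mul_self]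
    · intro c _ hc
      rw [mul_smul_comm, vert_mul_vert hc.symm, smul_zero]
    · intro h
      rw [Finsupp.notMem_support_iff.1 h, zero_smul, mul_zero]
  rw [h1, smul_mul_assoc]
  split_ifs with h
  · subst h; rw [vert_mul_self]
  · rw [vert_mul_vert h, smul_zero]

theorem smul_mem_iff_of_ne_zero (I : TwoSidedIdeal (LeavittPathAlgebra K G)) {k : K} (hk : k ≠ 0)
    {x : LeavittPathAlgebra K G} : k • x ∈ I ↔ x ∈ I := by
  refine ⟨fun h => ?_, smul_mem_ideal I k⟩
  have := smul_mem_ideal I k⁻¹ h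
  rwa [smul_smul, inv_mul_cancel₀ hk, one_smul] at this

theorem level_mem_gradedPart (n : ℕ) : ∀ x ∈ level K G n, x ∈ P → x ∈ gradedPart P := by
  classical
  induction n with
  | zero =>
    intro x hx hxP
    obtain ⟨k, rfl⟩ := (Finsupp.mem_span_range_iff_exists_finsupp).1 hx
    refine mem_of_vert_mul_vert _ fun a b => ?_
    have h1 := P.mul_mem_right _ (vert K G b) (P.mul_mem_left (vert K G a) _ hxP)
    rw [vert_mul_sum_mul_vert] at h1 ⊢
    split_ifs at h1 ⊢
    · by_cases hk : k a = 0
      · rw [hk, zero_smul]; exact TwoSidedIdeal.zero_mem _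
      · rw [smul_mem_iff_of_ne_zero _ hk] at h1 ⊢
        exact vert_mem_gradedPart h1
    · exact TwoSidedIdeal.zero_mem _
  | succ n ih =>
    intro x hx hxP
    obtain ⟨k, F, y, hy, rfl⟩ := exists_normalForm hx
    refine mem_of_vert_mul_vert _ fun a b => ?_
    have h1 := P.mul_mem_right _ (vert K G b) (P.mul_mem_left (vert K G a) _ hxP)
    have h2 : vert K G a * (∑ e ∈ F, ∑ f ∈ F, edge K G e * y e f * ghost K G f) * vert K G b =
        ∑ e ∈ F, ∑ f ∈ F, edge K G e * (if G.s e = a ∧ G.s f = b then y e f else 0) *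
          ghost K G f := by
      rw [Finset.mul_sum, Finset.sum_mul]
      refine Finset.sum_congr rfl fun e _ => ?_
      rw [Finset.mul_sum, Finset.sum_mul]
      refine Finset.sum_congr rfl fun f _ => ?_
      have h3 : vert K G a * (edge K G e * y e f * ghost K G f) * vert K G b =
        vert K G a * edge K G e * y e f * (ghost K G f * vert K G b) := by simp only [mul_assoc]
      rw [h3]
      by_cases he : G.s e = a
      · by_cases hf : G.s f = b
        · rw [if_pos ⟨he, hf⟩, ← he, ← hf, source_mul_edge, ghost_mul_source]
        · rw [if_neg (fun h => hf h.2), ghost_mul_vert hf, mul_zero, mul_zero, zero_mul]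
      · rw [if_neg (fun h => he h.1), vert_mul_edge he, zero_mul, zero_mul, mul_zero, zero_mul]
    have hy' : ∀ e f, (if G.s e = a ∧ G.s f = b then y e f else 0) ∈ level K G n := by
      intro e f
      split_ifs
      · exact hy e f
      · exact zero_mem _
    rw [mul_add, add_mul, vert_mul_sum_mul_vert, h2] at h1 ⊢
    -- A vertex term survives only in a diagonal corner with nonzero coefficient, where it can be
    -- scaled to one.
    by_cases hab : a = b ∧ k a ≠ 0
    swap
    · have h4 : (if a = b then k a • vert K G a else 0) = 0 := by
        split_ifs with h
        · rw [not_and_not_right.1 hab h, zero_smul]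
        · rfl
      rw [h4, zero_add] at h1 ⊢
      exact sum_mem_gradedPart ih hy' h1
    · obtain ⟨rfl, hk⟩ := hab
      rw [if_pos rfl] at h1 ⊢
      have h5 : ∑ e ∈ F, ∑ f ∈ F, edge K G e * (if G.s e = a ∧ G.s f = a then y e f else 0) *
          ghost K G f = k a • ∑ e ∈ F.filter (G.s · = a), ∑ f ∈ F.filter (G.s · = a),
            edge K G e * ((k a)⁻¹ • y e f) * ghost K G f := by
        simp only [Finset.sum_filter, Finset.smul_sum]
        refine Finset.sum_congr rfl fun e _ => ?_
        by_cases he : G.s e = a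
        · rw [if_pos he, Finset.smul_sum]
          refine Finset.sum_congr rfl fun f _ => ?_
          by_cases hf : G.s f = a
          · rw [if_pos hf, if_pos ⟨he, hf⟩, mul_smul_comm, smul_mul_assoc, smul_smul,
              mul_inv_cancel₀ hk, one_smul]
          · rw [if_neg hf, if_neg (fun h => hf h.2), mul_zero, zero_mul, smul_zero]
        · rw [if_neg he, smul_zero]
          refine Finset.sum_eq_zero fun f _ => ?_
          rw [if_neg (fun h => he h.1), mul_zero, zero_mul]
      rw [h5, ← smul_add, smul_mem_iff_of_ne_zero _ hk] at h1 ⊢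
      exact vert_add_sum_mem_gradedPart ih (fun e he => (Finset.mem_filter.1 he).2)
        (fun e f => Submodule.smul_mem _ _ (hy e f)) h1

/-- In positive degree every monomial begins with an edge, so a large enough finite sum of `e e*` is
a left unit even at infinite emitters. -/
theorem exists_sum_edge_mul {n : ℤ} (hn : 0 < n) {x : LeavittPathAlgebra K G}
    (hx : x ∈ component K G n) :
    ∃ F : Finset E, ∀ F', F ⊆ F' → ∑ e ∈ F', edge K G e * (ghost K G e * x) = x := by
  classical
  induction hx using Submodule.span_induction with
  | mem x hx =>
    obtain ⟨a, b, c, p, q, hp, hq, hpq, rfl⟩ := hx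
    cases hp with
    | nil => simp at hpq; omega
    | @cons f p _ hp =>
      refine ⟨{f}, fun F' hF => ?_⟩
      rw [Finset.sum_eq_single f]
      · rw [path]
        simp only [← mul_assoc]
        rw [mul_assoc (edge K G f) (ghost K G f), ghost_mul_edge_self, edge_mul_range]
      · intro e _ he
        rw [path]
        simp only [← mul_assoc]
        rw [mul_assoc (edge K G e) (ghost K G e), ghost_mul_edge he, mul_zero, zero_mul, zero_mul]
      · intro h; exact absurd (hF (by simp)) h
  | zero => exact ⟨∅, fun F' _ => by simp⟩
  | add x y _ _ hx hy =>
    obtain ⟨F, hF⟩ := hx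
    obtain ⟨F', hF'⟩ := hy
    refine ⟨F ∪ F', fun T hT => ?_⟩
    simp only [mul_add, Finset.sum_add_distrib]
    rw [hF T (Finset.union_subset_left hT), hF' T (Finset.union_subset_right hT)]
  | smul k x _ hx =>
    obtain ⟨F, hF⟩ := hx
    refine ⟨F, fun T hT => ?_⟩
    simp only [mul_smul_comm, ← Finset.smul_sum]
    rw [hF T hT]

theorem ghost_mul_mem_component {n : ℤ} (e : E) {x : LeavittPathAlgebra K G}
    (hx : x ∈ component K G n) : ghost K G e * x ∈ component K G (n - 1) := by
  induction hx using Submodule.span_induction with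
  | mem x hx =>
    obtain ⟨a, b, c, p, q, hp, hq, hpq, rfl⟩ := hx
    rw [← mul_assoc, ← ghostPath_singleton e]
    rcases ghostPath_mul_path_cases (K := K) (DirGraph.isPath_singleton (G := G) e) hp with
      ⟨t, ht, -, h1, h2⟩ | ⟨t, ht, -, h1, h2⟩ | h
    · rw [h2]
      refine Submodule.subset_span ⟨_, _, _, _, _, h1, hq, ?_, rfl⟩
      rw [← hpq, ht]; simp; ring
    · rw [h2, ← ghostPath_append hq h1, ← vert_mul_ghostPath (hq.append h1)]
      refine Submodule.subset_span ⟨_, _, _, [], _, .nil _, hq.append h1, ?_, rfl⟩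
      have := congrArg List.length ht
      simp only [List.length_append, List.length_singleton] at this
      simp only [List.length_nil, List.length_append]
      omega
    · rw [h, zero_mul]; exact zero_mem _
  | zero => rw [mul_zero]; exact zero_mem _
  | add x y _ _ hx hy => rw [mul_add]; exact add_mem hx hy
  | smul k x _ hx => rw [mul_smul_comm]; exact Submodule.smul_mem _ _ hx

theorem nonneg_mem_gradedPart (n : ℕ) {x : LeavittPathAlgebra K G}
    (hx : x ∈ component K G n) (hxP : x ∈ P) : x ∈ gradedPart P := by
  induction n generalizing x with
  | zero =>
    obtain ⟨m, hm⟩ := exists_mem_level hx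
    exact level_mem_gradedPart m x hm hxP
  | succ n ih =>
    obtain ⟨F, hF⟩ := exists_sum_edge_mul (by positivity) hx
    rw [← hF F subset_rfl]
    refine sum_mem_ideal _ fun e _ => TwoSidedIdeal.mul_mem_left _ _ _ (ih ?_ ?_)
    · simpa using ghost_mul_mem_component e hx
    · exact P.mul_mem_left _ _ hxP

theorem vertexSet_involComap : vertexSet (involComap P) = vertexSet P := by
  ext a
  rw [mem_vertexSet, mem_vertexSet, mem_involComap, invol_vert]

theorem gradedPart_involComap : gradedPart (involComap P) = gradedPart P := by
  have : breakingSet (involComap P) = breakingSet P := by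
    ext a
    simp only [breakingSet, vertexSet_involComap, mem_involComap, Set.mem_ofPred_eq]
    refine and_congr_right fun ha => ?_
    rw [invol_breakingElement ha.2.2.2]
  rw [gradedPart, gradedPart, vertexSet_involComap, this]

/-- In negative degree the involution is applied; `P` and its image have the same vertices and
breaking elements, hence the same graded part. -/
theorem homogeneous_mem_gradedPart {n : ℤ} {x : LeavittPathAlgebra K G}
    (hx : x ∈ grading K G n) (hxP : x ∈ P) : x ∈ gradedPart P := by
  obtain ⟨m, rfl | rfl⟩ := n.eq_nat_or_neg
  · exact nonneg_mem_gradedPart m hx hxP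
  · have h1 := invol_mem_grading hx
    rw [neg_neg] at h1
    have h2 : invol K G x ∈ involComap P := by rwa [mem_involComap, invol_invol]
    have h3 := nonneg_mem_gradedPart m h1 h2
    rw [gradedPart_involComap] at h3
    have h4 := invol_mem_idealOf (isAdmissible_sets P).2.2 h3
    rwa [invol_invol] at h4

/-- A graded ideal is generated by vertices and breaking elements. -/
theorem eq_gradedPart (hP : IsGradedIdeal (grading K G) P) : P = gradedPart P := by
  refine le_antisymm (fun x hx => ?_) (gradedPart_le P)
  obtain ⟨f, hf, rfl⟩ := exists_homogeneous_sum x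
  exact sum_mem_ideal _ fun n _ => homogeneous_mem_gradedPart (hf n) (hP f hf hx n)

end GradedIdeals

end LeavittPathAlgebra

/-! ### Graded modules over graded rings -/

section GradedModules

variable {R : Type u} [NonUnitalRing R] {M : Type v} [AddCommGroup M]

/-- Restates internal direct sums by finitely supported families in `M`, the language of
`IsGradedSubgroup`. -/
theorem isInternal_iff_finsupp {ℳ : ℤ → AddSubgroup M} :
    DirectSum.IsInternal ℳ ↔
      (∀ m, ∃ f : ℤ →₀ M, (∀ n, f n ∈ ℳ n) ∧ (f.sum fun _ x => x) = m) ∧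
      ∀ f : ℤ →₀ M, (∀ n, f n ∈ ℳ n) → (f.sum fun _ x => x) = 0 → f = 0 := by
  classical
  have toFinsupp : ∀ x : DirectSum ℤ fun i => ℳ i, ∃ f : ℤ →₀ M, (∀ n, f n = x n) ∧
      (f.sum fun _ x => x) = DirectSum.coeAddMonoidHom ℳ x := by
    intro x
    induction x using DirectSum.induction_on with
    | zero => exact ⟨0, fun n => by simp, by simp⟩
    | of i x =>
      refine ⟨Finsupp.single i x, fun n => ?_, ?_⟩
      · rw [DirectSum.coe_of_apply, Finsupp.single_apply]
        split_ifs <;> rfl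
      · rw [DirectSum.coeAddMonoidHom_of, Finsupp.sum_single_index rfl]
    | add x y hx hy =>
      obtain ⟨f, hf, hf'⟩ := hx
      obtain ⟨g, hg, hg'⟩ := hy
      refine ⟨f + g, fun n => ?_, ?_⟩
      · rw [Finsupp.add_apply, hf, hg]; rfl
      · rw [map_add, ← hf', ← hg', Finsupp.sum_add_index' (fun _ => rfl) (fun _ _ _ => rfl)]
  have ofFinsupp : ∀ f : ℤ →₀ M, (∀ n, f n ∈ ℳ n) → ∃ x : DirectSum ℤ fun i => ℳ i,
      (∀ n, f n = x n) ∧ (f.sum fun _ x => x) = DirectSum.coeAddMonoidHom ℳ x := by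
    intro f hf
    refine ⟨∑ n ∈ f.support, DirectSum.of (fun i => ℳ i) n ⟨f n, hf n⟩, fun n => ?_, ?_⟩
    · rw [DirectSum.sum_apply, AddSubgroup.val_finsetSum]
      simp only [DirectSum.coe_of_apply]
      by_cases hn : n ∈ f.support
      · rw [Finset.sum_eq_single n]
        · simp
        · intro i _ hi; rw [if_neg hi]; rfl
        · exact fun h => absurd hn h
      · rw [Finsupp.notMem_support_iff.1 hn, Finset.sum_eq_zero]
        intro i hi
        rw [if_neg (by rintro rfl; exact hn hi)]; rfl
    · rw [map_sum]
      simp only [DirectSum.coeAddMonoidHom_of]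
      rfl
  constructor
  · intro h
    constructor
    · intro m
      obtain ⟨x, rfl⟩ := h.2 m
      obtain ⟨f, hf, hf'⟩ := toFinsupp x
      exact ⟨f, fun n => by rw [hf]; exact (x n).2, hf'⟩
    · intro f hf h0
      obtain ⟨x, hx, hx'⟩ := ofFinsupp f hf
      obtain rfl : x = 0 := h.1 (by rw [← hx', h0, map_zero])
      ext n
      rw [hx]; rfl
  · rintro ⟨hex, huniq⟩
    refine ⟨(injective_iff_map_eq_zero _).2 fun x hx => ?_, fun m => ?_⟩
    · obtain ⟨f, hf, hf'⟩ := toFinsupp x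
      have hf0 := huniq f (fun n => by rw [hf]; exact (x n).2) (hf'.trans hx)
      refine DFinsupp.ext fun n => Subtype.ext ?_
      rw [← hf n, hf0]; rfl
    · obtain ⟨f, hf, rfl⟩ := hex m
      obtain ⟨x, -, hx'⟩ := ofFinsupp f hf
      exact ⟨x, hx'.symm⟩

variable {𝒜 : ℤ → AddSubgroup R} {act : R →+ M →+ M} {ℳ : ℤ → AddSubgroup M}

theorem eq_of_homogeneous_sum_eq (h : DirectSum.IsInternal ℳ) {f g : ℤ →₀ M}
    (hf : ∀ n, f n ∈ ℳ n) (hg : ∀ n, g n ∈ ℳ n)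
    (hfg : (f.sum fun _ x => x) = g.sum fun _ x => x) : f = g := by
  rw [← sub_eq_zero]
  refine (isInternal_iff_finsupp.1 h).2 _ (fun n => sub_mem (hf n) (hg n)) ?_
  rw [Finsupp.sum_sub_index (fun _ _ _ => rfl), hfg, sub_self]

/-- The homogeneous components of `x m` for a homogeneous element `m` of degree `j`. -/
theorem exists_act_sum (hact : ∀ i j x m, x ∈ 𝒜 i → m ∈ ℳ j → act x m ∈ ℳ (i + j))
    {f : ℤ →₀ R} (hf : ∀ n, f n ∈ 𝒜 n) {j : ℤ} {m : M} (hm : m ∈ ℳ j) :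
    ∃ g : ℤ →₀ M, (∀ n, g n ∈ ℳ n) ∧ (∀ n, g n = act (f (n - j)) m) ∧
      (g.sum fun _ x => x) = act (f.sum fun _ x => x) m := by
  have happ : ∀ n, (Finsupp.equivMapDomain (Equiv.addRight j)
      (f.mapRange (fun x => act x m) (by simp))) n = act (f (n - j)) m := by
    intro n
    rw [Finsupp.equivMapDomain_apply, Finsupp.mapRange_apply]
    simp [sub_eq_add_neg]
  refine ⟨_, fun n => ?_, happ, ?_⟩
  · rw [happ]
    have := hact (n - j) j _ m (hf (n - j)) hm
    rwa [sub_add_cancel] at this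
  · rw [Finsupp.sum_equivMapDomain, Finsupp.sum_mapRange_index (fun _ => rfl), Finsupp.sum,
      Finsupp.sum, map_sum, AddMonoidHom.finsetSum_apply]

theorem exists_homogeneous_act_ne_zero (h : DirectSum.IsInternal ℳ) {x : R}
    (hx : ∃ m, act x m ≠ 0) : ∃ j, ∃ m ∈ ℳ j, act x m ≠ 0 := by
  by_contra! hcon
  obtain ⟨m, hm⟩ := hx
  obtain ⟨f, hf, rfl⟩ := (isInternal_iff_finsupp.1 h).1 m
  apply hm
  rw [Finsupp.sum, map_sum]
  exact Finset.sum_eq_zero fun n _ => hcon n _ (hf n)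

/-- For homogeneous `m` the elements `f n • m` lie in distinct degrees, so if their sum vanishes
then each of them does. -/
theorem annihilator_isGraded (h : DirectSum.IsInternal ℳ)
    (hact : ∀ i j x m, x ∈ 𝒜 i → m ∈ ℳ j → act x m ∈ ℳ (i + j)) :
    IsGradedSubgroup 𝒜 {x | ∀ m, act x m = 0} := by
  intro f hf hsum n
  change ∀ m, act (f n) m = 0
  by_contra! hcon
  obtain ⟨j, m, hm, hne⟩ := exists_homogeneous_act_ne_zero h hcon
  obtain ⟨g, hg, hg', hgs⟩ := exists_act_sum hact hf hm
  have hg0 := (isInternal_iff_finsupp.1 h).2 g hg (hgs.trans (hsum m))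
  apply hne
  have := hg' (n + j)
  rw [add_sub_cancel_right, hg0] at this
  exact this.symm

/-- A graded simple left module is generated by each of its nonzero homogeneous elements. -/
theorem IsGradedSimple.exists_act_eq (hR : ∀ x, ∃ f : ℤ →₀ R, (∀ n, f n ∈ 𝒜 n) ∧
      (f.sum fun _ y => y) = x) (hl : IsLeftAction act) (h : IsGradedSimple 𝒜 act ℳ) {j : ℤ}
    {m : M} (hm : m ∈ ℳ j) (hm0 : m ≠ 0) (m' : M) : ∃ x, act x m = m' := by
  let N : AddSubgroup M := (act.flip m).range
  have hN : N = ⊥ ∨ N = ⊤ := by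
    refine h.eq_bot_or_eq_top N ?_ ?_
    · rintro x _ ⟨y, rfl⟩
      exact ⟨x * y, hl x y m⟩
    · rintro f hf ⟨x, hx⟩ n
      obtain ⟨g, hg, rfl⟩ := hR x
      obtain ⟨g', hg', hg'', hs⟩ := exists_act_sum h.act_mem hg hm
      have hfg : f = g' := eq_of_homogeneous_sum_eq h.isInternal hf hg' (hx.symm.trans hs.symm)
      exact ⟨g (n - j), by rw [hfg, hg'']; rfl⟩
  rcases hN with hN | hN
  · exfalso
    -- If `R m = 0`, then `m` lies in the graded submodule annihilated by `R`, which must be all of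
    -- `M`, against the nonzero action.
    let T : AddSubgroup M :=
      { carrier := {m | ∀ x, act x m = 0}
        zero_mem' := fun x => map_zero _
        add_mem' := fun {a b} ha hb x => by rw [map_add, ha, hb, add_zero]
        neg_mem' := fun {a} ha x => by rw [map_neg, ha, neg_zero] }
    have hT : T = ⊥ ∨ T = ⊤ := by
      refine h.eq_bot_or_eq_top T ?_ ?_
      · intro x m hm y
        rw [← hl, hm]
      · intro f hf hsum n x
        obtain ⟨g, hg, rfl⟩ := hR x
        rw [Finsupp.sum, map_sum, AddMonoidHom.finsetSum_apply]
        refine Finset.sum_eq_zero fun i _ => ?_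
        have h1 := hsum (g i)
        -- The family of homogeneous components of `g i` applied to the sum of `f`: degrees are
        -- shifted by `i`.
        let g' : ℤ →₀ M := Finsupp.equivMapDomain (Equiv.addLeft i)
          (f.mapRange (act (g i)) (map_zero _))
        have happ : ∀ k, g' k = act (g i) (f (-i + k)) := fun k => by
          rw [Finsupp.equivMapDomain_apply, Finsupp.mapRange_apply]; simp
        have hg0 := (isInternal_iff_finsupp.1 h.isInternal).2 g' (fun k => ?_) ?_
        · have := happ (i + n)
          rw [neg_add_cancel_left, hg0] at this
          exact this.symm
        · rw [happ]
          have := h.act_mem i (-i + k) _ _ (hg i) (hf (-i + k))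
          rwa [add_neg_cancel_left] at this
        · rw [Finsupp.sum_equivMapDomain, Finsupp.sum_mapRange_index (fun _ => rfl), ← h1,
            Finsupp.sum, Finsupp.sum, map_sum]
    rcases hT with hT | hT
    · have hmT : m ∈ T := fun x => by
        have : act x m ∈ N := ⟨x, rfl⟩
        rwa [hN, AddSubgroup.mem_bot] at this
      rw [hT, AddSubgroup.mem_bot] at hmT
      exact hm0 hmT
    · obtain ⟨x, m₁, hne⟩ := h.act_ne_zero
      have : m₁ ∈ T := by rw [hT]; trivial
      exact hne (this x)
  · have : m' ∈ N := by rw [hN]; trivial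
    exact this

/-- Of an element that carries `m` to `m'` only the component of degree `i - j` contributes. -/
theorem IsGradedSimple.exists_homogeneous_act_eq (hR : ∀ x, ∃ f : ℤ →₀ R,
      (∀ n, f n ∈ 𝒜 n) ∧ (f.sum fun _ y => y) = x) (hl : IsLeftAction act)
    (h : IsGradedSimple 𝒜 act ℳ) {i j : ℤ} {m m' : M} (hm : m ∈ ℳ j) (hm0 : m ≠ 0)
    (hm' : m' ∈ ℳ i) : ∃ x ∈ 𝒜 (i - j), act x m = m' := by
  obtain ⟨x, hx⟩ := h.exists_act_eq hR hl hm hm0 m'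
  obtain ⟨f, hf, rfl⟩ := hR x
  obtain ⟨g, hg, hg', hs⟩ := exists_act_sum h.act_mem hf hm
  have hgm : g = Finsupp.single i m' := by
    refine eq_of_homogeneous_sum_eq h.isInternal hg (fun n => ?_) ?_
    · rw [Finsupp.single_apply]
      split_ifs with hn
      · rwa [← hn]
      · exact zero_mem _
    · rw [hs, hx, Finsupp.sum_single_index rfl]
  exact ⟨f (i - j), hf _, by rw [← hg', hgm, Finsupp.single_eq_same]⟩

theorem isGradedSubgroup_neg {N : Set M} (h : IsGradedSubgroup (fun n => ℳ (-n)) N) :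
    IsGradedSubgroup ℳ N := by
  intro f hf hsum n
  have := h (Finsupp.equivMapDomain (Equiv.neg ℤ) f) (fun n => ?_) ?_ (-n)
  · simpa [Finsupp.equivMapDomain_apply] using this
  · rw [Finsupp.equivMapDomain_apply]
    exact hf (-n)
  · rwa [Finsupp.sum_equivMapDomain]

theorem isInternal_neg (h : DirectSum.IsInternal ℳ) :
    DirectSum.IsInternal fun n => ℳ (-n) := by
  rw [isInternal_iff_finsupp] at h ⊢
  constructor
  · intro m
    obtain ⟨f, hf, rfl⟩ := h.1 m
    refine ⟨Finsupp.equivMapDomain (Equiv.neg ℤ) f, fun n => ?_, Finsupp.sum_equivMapDomain _ _ _⟩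
    rw [Finsupp.equivMapDomain_apply]
    exact hf (-n)
  · intro f hf hsum
    have := h.2 (Finsupp.equivMapDomain (Equiv.neg ℤ) f) (fun n => ?_) ?_
    · ext n
      have h1 := DFunLike.congr_fun this (-n)
      simpa [Finsupp.equivMapDomain_apply] using h1
    · rw [Finsupp.equivMapDomain_apply]
      have := hf (-n)
      rwa [neg_neg] at this
    · rwa [Finsupp.sum_equivMapDomain]

/-- An anti-automorphism of order two turns graded simple left modules into graded simple right
modules. -/
theorem IsGradedLeftPrimitive.right {R : Type u} [NonUnitalRing R] {𝒜 : ℤ → AddSubgroup R}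
    {P : TwoSidedIdeal R} (h : IsGradedLeftPrimitive 𝒜 P) (τ : R →+ R)
    (hτ : ∀ x, τ (τ x) = x) (hmul : ∀ x y, τ (x * y) = τ y * τ x)
    (hgr : ∀ n, ∀ x ∈ 𝒜 n, τ x ∈ 𝒜 (-n)) (hP : ∀ x ∈ P, τ x ∈ P) :
    IsGradedRightPrimitive 𝒜 P := by
  obtain ⟨hg, M, _, act, ℳ, hl, hs, hann⟩ := h
  -- Elements act through `τ`; since `τ` reverses degrees, the grading of the module is reversed
  -- too.
  refine ⟨hg, M, _, act.comp τ, fun n => ℳ (-n), ?_, ⟨isInternal_neg hs.isInternal, ?_, ?_, ?_⟩, ?_⟩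
  · intro x y m
    change act (τ (x * y)) m = _
    rw [hmul, hl]; rfl
  · intro i j x m hx hm
    rw [neg_add]
    exact hs.act_mem _ _ _ _ (hgr i x hx) hm
  · obtain ⟨x, m, hne⟩ := hs.act_ne_zero
    refine ⟨τ x, m, ?_⟩
    change act (τ (τ x)) m ≠ 0
    rwa [hτ]
  · intro N hN hNg
    refine hs.eq_bot_or_eq_top N (fun x m hm => ?_) (isGradedSubgroup_neg hNg)
    have h1 : act (τ (τ x)) m ∈ N := hN (τ x) m hm
    rwa [hτ] at h1
  · intro x
    constructor
    · intro hx
      exact (hann _).1 (hP x hx)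
    · intro hx
      have := hP _ ((hann (τ x)).2 hx)
      rwa [hτ] at this

end GradedModules

-- Representations on path spaces

universe x

/-- A set of abstract paths in a graph: every element `x` has a source and a degree, it can be
prolonged by an edge with range `src x`, and it may have a first edge which can be removed. -/
structure PathSystem {V : Type v} {E : Type w} (G : DirGraph V E) (X : Type x) where
  src : X → V
  deg : X → ℤ
  cons : E → X → X
  head : X → Option E
  tail : X → X
  src_cons : ∀ e x, src x = G.r e → src (cons e x) = G.s e
  deg_cons : ∀ e x, src x = G.r e → deg (cons e x) = deg x + 1
  head_cons : ∀ e x, src x = G.r e → head (cons e x) = some e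
  tail_cons : ∀ e x, src x = G.r e → tail (cons e x) = x
  source_of_head : ∀ e x, head x = some e → G.s e = src x
  src_tail : ∀ e x, head x = some e → src (tail x) = G.r e
  cons_tail : ∀ e x, head x = some e → cons e (tail x) = x
  head_ne_none : ∀ x, G.IsRegular (src x) → head x ≠ none

namespace PathSystem

open LeavittPathAlgebra

section

variable {V : Type v} {E : Type w} {G : DirGraph V E} {X : Type x} (S : PathSystem G X)
  (K : Type u) [Field K]

-- On basis paths: `a` projects to the paths starting at `a`, `e` prolongs by `e` or gives zero, and
-- `e*` removes the first edge if it is `e` and gives zero otherwise.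
open Classical in
noncomputable def vertOp (a : V) : Module.End K (X →₀ K) :=
  Finsupp.linearCombination K fun x => if S.src x = a then Finsupp.single x 1 else 0

open Classical in
noncomputable def edgeOp (e : E) : Module.End K (X →₀ K) :=
  Finsupp.linearCombination K fun x => if S.src x = G.r e then Finsupp.single (S.cons e x) 1 else 0

open Classical in
noncomputable def ghostOp (e : E) : Module.End K (X →₀ K) :=
  Finsupp.linearCombination K fun x => if S.head x = some e then Finsupp.single (S.tail x) 1 else 0

variable {K}

theorem vertOp_of_eq {a : V} {x : X} (h : S.src x = a) (k : K) :
    S.vertOp K a (Finsupp.single x k) = Finsupp.single x k := by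
  simp [vertOp, h]

theorem vertOp_of_ne {a : V} {x : X} (h : S.src x ≠ a) (k : K) :
    S.vertOp K a (Finsupp.single x k) = 0 := by
  simp [vertOp, h]

theorem edgeOp_of_eq {e : E} {x : X} (h : S.src x = G.r e) (k : K) :
    S.edgeOp K e (Finsupp.single x k) = Finsupp.single (S.cons e x) k := by
  simp [edgeOp, h]

theorem edgeOp_of_ne {e : E} {x : X} (h : S.src x ≠ G.r e) (k : K) :
    S.edgeOp K e (Finsupp.single x k) = 0 := by
  simp [edgeOp, h]

theorem ghostOp_of_eq {e : E} {x : X} (h : S.head x = some e) (k : K) :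
    S.ghostOp K e (Finsupp.single x k) = Finsupp.single (S.tail x) k := by
  simp [ghostOp, h]

theorem ghostOp_of_ne {e : E} {x : X} (h : S.head x ≠ some e) (k : K) :
    S.ghostOp K e (Finsupp.single x k) = 0 := by
  simp [ghostOp, h]

theorem edgeOp_ghostOp_of_eq {e : E} {x : X} (h : S.head x = some e) (k : K) :
    (S.edgeOp K e * S.ghostOp K e) (Finsupp.single x k) = Finsupp.single x k := by
  rw [Module.End.mul_apply, S.ghostOp_of_eq h, S.edgeOp_of_eq (S.src_tail e x h),
    S.cons_tail e x h]

theorem edgeOp_ghostOp_of_ne {e : E} {x : X} (h : S.head x ≠ some e) (k : K) :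
    (S.edgeOp K e * S.ghostOp K e) (Finsupp.single x k) = 0 := by
  rw [Module.End.mul_apply, S.ghostOp_of_ne h, map_zero]

theorem end_ext {f g : Module.End K (X →₀ K)}
    (h : ∀ x, f (Finsupp.single x 1) = g (Finsupp.single x 1)) : f = g :=
  Finsupp.lhom_ext' fun x => LinearMap.ext_ring (h x)

theorem sum_edgeOp_ghostOp {T : Finset E} {x : X} {e : E} (h : S.head x = some e) (he : e ∈ T)
    (k : K) : (∑ f ∈ T, S.edgeOp K f * S.ghostOp K f) (Finsupp.single x k) =
      Finsupp.single x k := by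
  rw [LinearMap.sum_apply, Finset.sum_eq_single e]
  · exact S.edgeOp_ghostOp_of_eq h k
  · intro f _ hf
    refine S.edgeOp_ghostOp_of_ne (fun h' => hf ?_) k
    rw [h] at h'
    exact (Option.some.inj h').symm
  · exact fun h' => absurd he h'

-- (CK2) holds because each path starting at a regular vertex has a first edge, so exactly one of
-- the operators `e e*` fixes it.
variable (K) in
noncomputable def family : Family K G (Module.End K (X →₀ K)) where
  vert := S.vertOp K
  edge := S.edgeOp K
  ghost := S.ghostOp K
  vert_mul_self a := end_ext fun x => by
    rw [Module.End.mul_apply]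
    by_cases h : S.src x = a
    · rw [S.vertOp_of_eq h, S.vertOp_of_eq h]
    · rw [S.vertOp_of_ne h, map_zero]
  vert_mul_vert a b hab := end_ext fun x => by
    rw [Module.End.mul_apply]
    by_cases h : S.src x = b
    · rw [S.vertOp_of_eq h, S.vertOp_of_ne (fun h' => hab (h'.symm.trans h))]; rfl
    · rw [S.vertOp_of_ne h, map_zero]; rfl
  source_mul_edge e := end_ext fun x => by
    rw [Module.End.mul_apply]
    by_cases h : S.src x = G.r e
    · rw [S.edgeOp_of_eq h, S.vertOp_of_eq (S.src_cons e x h)]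
    · rw [S.edgeOp_of_ne h, map_zero]
  edge_mul_range e := end_ext fun x => by
    rw [Module.End.mul_apply]
    by_cases h : S.src x = G.r e
    · rw [S.vertOp_of_eq h]
    · rw [S.vertOp_of_ne h, S.edgeOp_of_ne h, map_zero]
  range_mul_ghost e := end_ext fun x => by
    rw [Module.End.mul_apply]
    by_cases h : S.head x = some e
    · rw [S.ghostOp_of_eq h, S.vertOp_of_eq (S.src_tail e x h)]
    · rw [S.ghostOp_of_ne h, map_zero]
  ghost_mul_source e := end_ext fun x => by
    rw [Module.End.mul_apply]
    by_cases h : S.src x = G.s e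
    · rw [S.vertOp_of_eq h]
    · rw [S.vertOp_of_ne h, S.ghostOp_of_ne (fun h' => h (S.source_of_head e x h').symm), map_zero]
  ghost_mul_edge_self e := end_ext fun x => by
    rw [Module.End.mul_apply]
    by_cases h : S.src x = G.r e
    · rw [S.edgeOp_of_eq h, S.ghostOp_of_eq (S.head_cons e x h), S.tail_cons e x h,
        S.vertOp_of_eq h]
    · rw [S.edgeOp_of_ne h, S.vertOp_of_ne h, map_zero]
  ghost_mul_edge e f hef := end_ext fun x => by
    rw [Module.End.mul_apply]
    by_cases h : S.src x = G.r f
    · rw [S.edgeOp_of_eq h, S.ghostOp_of_ne]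
      · rfl
      · rw [S.head_cons f x h]
        exact fun h' => hef (Option.some.inj h').symm
    · rw [S.edgeOp_of_ne h, map_zero]; rfl
  vert_eq_sum a ha := end_ext fun x => by
    by_cases h : S.src x = a
    · subst h
      obtain ⟨e, he⟩ := Option.ne_none_iff_exists'.1 (S.head_ne_none x ha)
      rw [S.vertOp_of_eq rfl, S.sum_edgeOp_ghostOp he]
      rw [Set.Finite.mem_toFinset]
      exact S.source_of_head e x he
    · rw [S.vertOp_of_ne h, LinearMap.sum_apply, Finset.sum_eq_zero]
      intro e he
      obtain rfl : G.s e = a := (Set.Finite.mem_toFinset ha.2).1 he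
      exact S.edgeOp_ghostOp_of_ne (fun h' => h (S.source_of_head e x h').symm) _

variable (K) in
/-- The representation of `L_K(E)` on the vector space with basis `X`. -/
noncomputable def rep : LeavittPathAlgebra K G →ₙₐ[K] Module.End K (X →₀ K) := (S.family K).lift

theorem rep_vert (a : V) : S.rep K (vert K G a) = S.vertOp K a := Family.lift_vert _ _

theorem rep_edge (e : E) : S.rep K (edge K G e) = S.edgeOp K e := Family.lift_edge _ _

theorem rep_ghost (e : E) : S.rep K (ghost K G e) = S.ghostOp K e := Family.lift_ghost _ _

variable (K) in
noncomputable def act : LeavittPathAlgebra K G →+ (X →₀ K) →+ (X →₀ K) where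
  toFun x := (S.rep K x).toAddMonoidHom
  map_zero' := by rw [map_zero]; rfl
  map_add' x y := by rw [map_add]; rfl

theorem act_apply (x : LeavittPathAlgebra K G) (m : X →₀ K) : S.act K x m = S.rep K x m := rfl

theorem isLeftAction_act : IsLeftAction (S.act K) := fun x y m => by
  rw [act_apply, map_mul]; rfl

variable (K) in
/-- The homogeneous component of degree `n` of the module with basis `X`. -/
noncomputable def part (n : ℤ) : Submodule K (X →₀ K) := Finsupp.supported K K {x | S.deg x = n}

variable (K) in
noncomputable def grade (n : ℤ) : AddSubgroup (X →₀ K) := (S.part K n).toAddSubgroup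

theorem single_mem_part {x : X} {n : ℤ} (h : S.deg x = n) (k : K) :
    Finsupp.single x k ∈ S.part K n := Finsupp.single_mem_supported K k h

theorem map_part {f : Module.End K (X →₀ K)} {i j : ℤ}
    (h : ∀ x, S.deg x = i → f (Finsupp.single x 1) ∈ S.part K j) {m : X →₀ K}
    (hm : m ∈ S.part K i) : f m ∈ S.part K j := by
  rw [part, Finsupp.supported_eq_span_single] at hm
  induction hm using Submodule.span_induction with
  | mem m hm =>
    obtain ⟨x, hx, rfl⟩ := hm
    exact h x hx
  | zero => rw [map_zero]; exact zero_mem _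
  | add m m' _ _ hm hm' => rw [map_add]; exact add_mem hm hm'
  | smul k m _ hm => rw [map_smul]; exact Submodule.smul_mem _ _ hm

theorem vertOp_mem_part (a : V) {i : ℤ} {m : X →₀ K} (hm : m ∈ S.part K i) :
    S.vertOp K a m ∈ S.part K i := by
  refine S.map_part (fun x hx => ?_) hm
  by_cases h : S.src x = a
  · rw [S.vertOp_of_eq h]; exact S.single_mem_part hx 1
  · rw [S.vertOp_of_ne h]; exact zero_mem _

theorem edgeOp_mem_part (e : E) {i : ℤ} {m : X →₀ K} (hm : m ∈ S.part K i) :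
    S.edgeOp K e m ∈ S.part K (i + 1) := by
  refine S.map_part (fun x hx => ?_) hm
  by_cases h : S.src x = G.r e
  · rw [S.edgeOp_of_eq h]; exact S.single_mem_part (by rw [S.deg_cons e x h, hx]) 1
  · rw [S.edgeOp_of_ne h]; exact zero_mem _

theorem ghostOp_mem_part (e : E) {i : ℤ} {m : X →₀ K} (hm : m ∈ S.part K i) :
    S.ghostOp K e m ∈ S.part K (i - 1) := by
  refine S.map_part (fun x hx => ?_) hm
  by_cases h : S.head x = some e
  · rw [S.ghostOp_of_eq h]
    refine S.single_mem_part ?_ 1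
    have h1 := S.deg_cons e _ (S.src_tail e x h)
    rw [S.cons_tail e x h, hx] at h1
    omega
  · rw [S.ghostOp_of_ne h]; exact zero_mem _

theorem rep_path_mem_part (a : V) (p : List E) {i : ℤ} {m : X →₀ K} (hm : m ∈ S.part K i) :
    S.rep K (path K G a p) m ∈ S.part K (i + p.length) := by
  induction p generalizing a with
  | nil => rw [path, rep_vert]; simpa using S.vertOp_mem_part a hm
  | cons e p ih =>
    rw [path, map_mul, Module.End.mul_apply, rep_edge]
    have := S.edgeOp_mem_part e (ih (G.r e))
    rwa [add_assoc] at this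

theorem rep_ghostPath_mem_part (a : V) (p : List E) {i : ℤ} {m : X →₀ K}
    (hm : m ∈ S.part K i) : S.rep K (ghostPath K G a p) m ∈ S.part K (i - p.length) := by
  induction p generalizing a i m with
  | nil => rw [ghostPath, rep_vert]; simpa using S.vertOp_mem_part a hm
  | cons e p ih =>
    rw [ghostPath, map_mul, Module.End.mul_apply, rep_ghost]
    have := ih (G.r e) (S.ghostOp_mem_part e hm)
    rwa [sub_sub, add_comm (1 : ℤ)] at this

theorem act_mem_grade (i j : ℤ) (x : LeavittPathAlgebra K G) (m : X →₀ K)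
    (hx : x ∈ grading K G i) (hm : m ∈ S.grade K j) : S.act K x m ∈ S.grade K (i + j) := by
  change x ∈ component K G i at hx
  change S.rep K x m ∈ S.part K (i + j)
  induction hx using Submodule.span_induction with
  | mem x hx =>
    obtain ⟨a, b, c, p, q, -, -, rfl, rfl⟩ := hx
    rw [map_mul, Module.End.mul_apply]
    have := S.rep_path_mem_part a p (S.rep_ghostPath_mem_part b q hm)
    convert this using 2
    ring
  | zero => rw [map_zero]; exact zero_mem _
  | add x y _ _ hx hy => rw [map_add, LinearMap.add_apply]; exact add_mem hx hy
  | smul k x _ hx => rw [map_smul, LinearMap.smul_apply]; exact Submodule.smul_mem _ _ hx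

theorem isInternal_grade : DirectSum.IsInternal (S.grade K) := by
  classical
  rw [isInternal_iff_finsupp]
  constructor
  · intro m
    induction m using Finsupp.induction_linear with
    | zero => exact ⟨0, fun n => zero_mem _, by simp⟩
    | add m m' hm hm' =>
      obtain ⟨f, hf, rfl⟩ := hm
      obtain ⟨g, hg, rfl⟩ := hm'
      exact ⟨f + g, fun n => add_mem (hf n) (hg n),
        Finsupp.sum_add_index' (fun _ => rfl) (fun _ _ _ => rfl)⟩
    | single x k =>
      refine ⟨Finsupp.single (S.deg x) (Finsupp.single x k), fun n => ?_,
        Finsupp.sum_single_index rfl⟩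
      rw [Finsupp.single_apply]
      split_ifs with h
      · exact S.single_mem_part h k
      · exact zero_mem _
  · intro f hf hsum
    have hzero : ∀ n x, S.deg x ≠ n → f n x = 0 := by
      intro n x hx
      have h1 : f n ∈ Finsupp.supported K K {x | S.deg x = n} := hf n
      rw [Finsupp.mem_supported'] at h1
      exact h1 x hx
    ext n x
    by_cases hx : S.deg x = n
    · subst hx
      have h1 := DFunLike.congr_fun hsum x
      rw [Finsupp.sum, Finsupp.finsetSum_apply, Finset.sum_eq_single (S.deg x)] at h1
      · exact h1
      · intro n _ hn; exact hzero n x hn.symm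
      · intro h; rw [Finsupp.notMem_support_iff.1 h]; rfl
    · exact hzero n x hx

open Classical in
/-- Removes the initial segment `p`, if there is one. -/
noncomputable def strip : List E → X → Option X
  | [], x => some x
  | e :: p, x => if S.head x = some e then strip p (S.tail x) else none

theorem strip_cons_eq_some {e : E} {p : List E} {x z : X} :
    S.strip (e :: p) x = some z ↔ S.head x = some e ∧ S.strip p (S.tail x) = some z := by
  rw [strip]; split_ifs with h <;> simp [h]

theorem rep_ghostPath_of_strip {p : List E} {x z : X} (h : S.strip p x = some z) (k : K) :
    S.rep K (ghostPath K G (S.src x) p) (Finsupp.single x k) = Finsupp.single z k := by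
  induction p generalizing x with
  | nil =>
    obtain rfl := Option.some.inj h
    rw [ghostPath, rep_vert, S.vertOp_of_eq rfl]
  | cons e p ih =>
    obtain ⟨h1, h2⟩ := S.strip_cons_eq_some.1 h
    rw [ghostPath, map_mul, Module.End.mul_apply, rep_ghost, S.ghostOp_of_eq h1,
      ← S.src_tail e x h1, ih h2]

theorem rep_ghostPath_of_strip_none {a : V} {p : List E} {x : X} (h : S.strip p x = none)
    (k : K) : S.rep K (ghostPath K G a p) (Finsupp.single x k) = 0 := by
  induction p generalizing x a with
  | nil => simp [strip] at h
  | cons e p ih =>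
    rw [ghostPath, map_mul, Module.End.mul_apply, rep_ghost]
    by_cases h1 : S.head x = some e
    · rw [strip, if_pos h1] at h
      rw [S.ghostOp_of_eq h1, ih h]
    · rw [S.ghostOp_of_ne h1, map_zero]

theorem rep_path_of_strip {p : List E} {x z : X} (h : S.strip p x = some z) (k : K) :
    S.rep K (path K G (S.src x) p) (Finsupp.single z k) = Finsupp.single x k := by
  induction p generalizing x with
  | nil =>
    obtain rfl := Option.some.inj h
    rw [path, rep_vert, S.vertOp_of_eq rfl]
  | cons e p ih =>
    obtain ⟨h1, h2⟩ := S.strip_cons_eq_some.1 h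
    rw [path, map_mul, Module.End.mul_apply, rep_edge, ← S.src_tail e x h1, ih h2,
      S.edgeOp_of_eq (S.src_tail e x h1), S.cons_tail e x h1]

/-- Any two elements have a common final segment. -/
def IsConnected : Prop := ∀ x y, ∃ p q z, S.strip p x = some z ∧ S.strip q y = some z

/-- Elements of the same degree are distinguished by their initial segments. -/
def IsSeparated : Prop := ∀ (x : X) (F : Finset X), ∃ p z, S.strip p x = some z ∧
  ∀ y ∈ F, y ≠ x → S.deg y = S.deg x → S.strip p y = none

variable {S}

/-- Separation lets a ghost path reduce a nonzero homogeneous element to a multiple of one basis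
element; connectedness moves that to any other basis element through a common tail. -/
theorem isGradedSimple [Nonempty X] (hconn : S.IsConnected) (hsep : S.IsSeparated) :
    IsGradedSimple (grading K G) (S.act K) (S.grade K) where
  isInternal := S.isInternal_grade
  act_mem := S.act_mem_grade
  act_ne_zero := by
    obtain ⟨x⟩ := ‹Nonempty X›
    refine ⟨vert K G (S.src x), Finsupp.single x 1, ?_⟩
    rw [act_apply, rep_vert, S.vertOp_of_eq rfl]
    simp
  eq_bot_or_eq_top N hN hNg := by
    rw [or_iff_not_imp_left]
    intro hne
    obtain ⟨m, hm, hm0⟩ := N.bot_or_exists_ne_zero.resolve_left hne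
    obtain ⟨f, hf, rfl⟩ := (isInternal_iff_finsupp.1 S.isInternal_grade).1 m
    have hfN := hNg f hf hm
    obtain ⟨n, hn⟩ : ∃ n, f n ≠ 0 := by
      by_contra! hcon
      exact hm0 (Finset.sum_eq_zero fun n _ => hcon n)
    have hdeg : ∀ x ∈ (f n).support, S.deg x = n := fun x hx =>
      (Finsupp.mem_supported K _).1 (hf n) hx
    obtain ⟨x, hx⟩ := Finsupp.support_nonempty_iff.2 hn
    obtain ⟨p, z, hz, hy⟩ := hsep x (f n).support
    have hz1 : Finsupp.single z (f n x) ∈ N := by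
      have h1 := hN (ghostPath K G (S.src x) p) _ (hfN n)
      have h2 : S.act K (ghostPath K G (S.src x) p) (f n) = Finsupp.single z (f n x) := by
        conv_lhs => rw [← Finsupp.sum_single (f n)]
        rw [act_apply, Finsupp.sum, map_sum, Finset.sum_eq_single x]
        · exact S.rep_ghostPath_of_strip hz _
        · intro y hyF hyx
          exact S.rep_ghostPath_of_strip_none
            (hy y hyF hyx ((hdeg y hyF).trans (hdeg x hx).symm)) _
        · exact fun h => absurd hx h
      rwa [h2] at h1
    have hall : ∀ y k, Finsupp.single y k ∈ N := by
      intro y k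
      obtain ⟨p, q, t, hp, hq⟩ := hconn z y
      -- `N` is only an additive subgroup, so the scalar is supplied by a multiple of a vertex.
      have h1 := hN (path K G (S.src y) q * (ghostPath K G (S.src z) p *
        ((k * (f n x)⁻¹) • vert K G (S.src z)))) _ hz1
      rw [act_apply, map_mul, map_mul, map_smul, Module.End.mul_apply, Module.End.mul_apply,
        LinearMap.smul_apply, rep_vert, S.vertOp_of_eq rfl, Finsupp.smul_single, smul_eq_mul,
        mul_assoc, inv_mul_cancel₀ (Finsupp.mem_support_iff.1 hx), mul_one,
        S.rep_ghostPath_of_strip hp, S.rep_path_of_strip hq] at h1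
      exact h1
    rw [eq_top_iff]
    intro m _
    rw [← Finsupp.sum_single m]
    exact sum_mem fun y _ => hall y _

variable (S)

/-- The vertices which are not sources of elements of `X`. -/
def nonSources : Set V := {a | ∀ x, S.src x ≠ a}

/-- The breaking vertices which are not sources of elements without a first edge. -/
def breakingSources : Set V :=
  {a | a ∈ G.breaking S.nonSources ∧ ∀ x, S.src x = a → S.head x ≠ none}

theorem vertexSet_ker : vertexSet (TwoSidedIdeal.ker (S.rep K)) = S.nonSources := by
  ext a
  rw [mem_vertexSet, TwoSidedIdeal.mem_ker, rep_vert]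
  constructor
  · intro h x hx
    have h1 := S.vertOp_of_eq hx (1 : K)
    rw [h] at h1
    have h2 := DFunLike.congr_fun h1 x
    simp at h2
  · intro h
    exact end_ext fun x => S.vertOp_of_ne (h x) 1

/-- `a^H` acts as the projection to the paths at `a` without a first edge: a first edge ends at a
source of another path, hence outside `H`, and its `e e*` is among the terms subtracted. -/
theorem breakingSet_ker : breakingSet (TwoSidedIdeal.ker (S.rep K)) = S.breakingSources := by
  ext a
  simp only [breakingSet, vertexSet_ker, breakingSources, Set.mem_ofPred_eq]
  refine and_congr_right fun ha => ?_
  have hfin := ha.2.2.2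
  rw [TwoSidedIdeal.mem_ker, breakingElement_eq hfin, map_sub, map_sum, rep_vert]
  simp only [map_mul, rep_edge, rep_ghost]
  constructor
  · intro h x hx hnone
    have h1 := congrArg (fun f : Module.End K (X →₀ K) => f (Finsupp.single x 1)) h
    simp only [LinearMap.sub_apply, LinearMap.sum_apply, LinearMap.zero_apply] at h1
    rw [S.vertOp_of_eq hx, Finset.sum_eq_zero] at h1
    · have h2 := DFunLike.congr_fun h1 x
      simp at h2
    · intro e _
      exact S.edgeOp_ghostOp_of_ne (by rw [hnone]; simp) _
  · intro h
    refine end_ext fun x => ?_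
    rw [LinearMap.sub_apply, LinearMap.zero_apply]
    by_cases hx : S.src x = a
    · obtain ⟨e, he⟩ := Option.ne_none_iff_exists'.1 (h x hx)
      rw [S.vertOp_of_eq hx, S.sum_edgeOp_ghostOp he, sub_self]
      rw [Set.Finite.mem_toFinset]
      exact ⟨(S.source_of_head e x he).trans hx, fun hr => hr (S.tail x) (S.src_tail e x he)⟩
    · rw [S.vertOp_of_ne hx, LinearMap.sum_apply, Finset.sum_eq_zero, sub_zero]
      intro e he
      obtain rfl : G.s e = a := ((Set.Finite.mem_toFinset hfin).1 he).1
      exact S.edgeOp_ghostOp_of_ne (fun h' => hx (S.source_of_head e x h').symm) _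

theorem mem_ker_iff {y : LeavittPathAlgebra K G} :
    y ∈ TwoSidedIdeal.ker (S.rep K) ↔ ∀ m, S.act K y m = 0 := by
  rw [TwoSidedIdeal.mem_ker]
  exact ⟨fun h m => by rw [act_apply, h]; rfl, fun h => LinearMap.ext h⟩

theorem isGradedIdeal_ker : IsGradedIdeal (grading K G) (TwoSidedIdeal.ker (S.rep K)) := by
  have h : {y | y ∈ TwoSidedIdeal.ker (S.rep K)} = {y | ∀ m, S.act K y m = 0} :=
    Set.ext fun y => S.mem_ker_iff
  rw [IsGradedIdeal, h]
  exact annihilator_isGraded S.isInternal_grade S.act_mem_grade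

theorem ker_eq : TwoSidedIdeal.ker (S.rep K) = idealOf K G S.nonSources S.breakingSources := by
  have h := eq_gradedPart (S.isGradedIdeal_ker (K := K))
  rwa [gradedPart, vertexSet_ker, breakingSet_ker] at h

end

/-- The second conjunct recovers the vertex set from the ideal, which later makes different
descriptions of one ideal comparable. -/
theorem isGradedLeftPrimitive {V : Type v} {E : Type w} {G : DirGraph V E} {X : Type (max v w)}
    [Nonempty X] {S : PathSystem G X} (K : Type u) [Field K] (hconn : S.IsConnected)
    (hsep : S.IsSeparated) :
    IsGradedLeftPrimitive (grading K G) (idealOf K G S.nonSources S.breakingSources) ∧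
      vertexSet (idealOf K G S.nonSources S.breakingSources) = S.nonSources := by
  rw [← ker_eq]
  exact ⟨⟨S.isGradedIdeal_ker, X →₀ K, inferInstance, S.act K, S.grade K, S.isLeftAction_act,
    isGradedSimple hconn hsep, fun y => S.mem_ker_iff⟩, S.vertexSet_ker⟩

end PathSystem

theorem DirGraph.IsPath.source_unique {V : Type v} {E : Type w} {G : DirGraph V E} {a b c : V}
    {p : List E} (h : G.IsPath a p c) (h' : G.IsPath b p c) : a = b := by
  cases p with
  | nil => exact h.eq_of_nil.trans h'.eq_of_nil.symm
  | cons e p => exact h.source_eq.symm.trans h'.source_eq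

namespace PathSystem

/-! ### The module of finite paths ending at a non-regular vertex -/

section FinitePaths

variable {V : Type v} {E : Type w} {G : DirGraph V E} {a : V}

/-- The paths with range `a`. -/
abbrev FinitePath (G : DirGraph V E) (a : V) : Type (max v w) :=
  {x : V × List E // G.IsPath x.1 x.2 a}

namespace FinitePath

def single (G : DirGraph V E) (a : V) : FinitePath G a := ⟨(a, []), .nil a⟩

instance : Nonempty (FinitePath G a) := ⟨single G a⟩

-- The value for an edge that does not fit is arbitrary; the axioms of `PathSystem` never refer to
-- it.
open Classical in
noncomputable def cons (e : E) (x : FinitePath G a) : FinitePath G a :=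
  if h : x.1.1 = G.r e then
    ⟨(G.s e, e :: x.1.2), .cons e (by rw [← h]; exact x.2)⟩
  else x

def tail : FinitePath G a → FinitePath G a
  | ⟨(b, []), h⟩ => ⟨(b, []), h⟩
  | ⟨(_, e :: p), h⟩ => ⟨(G.r e, p), h.tail⟩

theorem cons_of_eq {e : E} {x : FinitePath G a} (h : x.1.1 = G.r e) :
    (cons e x).1 = (G.s e, e :: x.1.2) := by
  rw [cons, dif_pos h]

theorem tail_of_eq {x : FinitePath G a} {e : E} {p : List E} (h : x.1.2 = e :: p) :
    (tail x).1 = (G.r e, p) := by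
  obtain ⟨⟨b, q⟩, hx⟩ := x
  dsimp only at h
  subst h
  rfl

end FinitePath

open FinitePath in
/-- The system of the finite paths with range `a`. -/
noncomputable def finite (ha : ¬ G.IsRegular a) : PathSystem G (FinitePath G a) where
  src x := x.1.1
  deg x := x.1.2.length
  cons := FinitePath.cons
  head x := x.1.2.head?
  tail := FinitePath.tail
  src_cons e x h := by rw [cons_of_eq h]
  deg_cons e x h := by rw [cons_of_eq h]; simp
  head_cons e x h := by rw [cons_of_eq h]; rfl
  tail_cons e x h := by
    apply Subtype.ext
    rw [tail_of_eq (e := e) (p := x.1.2) (by rw [cons_of_eq h]), ← h]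
  source_of_head e x h := by
    obtain ⟨p, hp⟩ := List.head?_eq_some_iff.1 h
    have h1 := x.2
    rw [hp] at h1
    exact h1.source_eq
  src_tail e x h := by
    obtain ⟨p, hp⟩ := List.head?_eq_some_iff.1 h
    rw [tail_of_eq hp]
  cons_tail e x h := by
    obtain ⟨p, hp⟩ := List.head?_eq_some_iff.1 h
    apply Subtype.ext
    rw [cons_of_eq (by rw [tail_of_eq hp]), tail_of_eq hp]
    have h1 := x.2
    rw [hp] at h1
    rw [h1.source_eq, ← hp]
  -- A path without a first edge is the trivial path at `a`; this is where `a` must not be regular.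
  head_ne_none x h h' := by
    have h1 := x.2
    rw [List.head?_eq_none_iff.1 h'] at h1
    rw [h1.eq_of_nil] at h
    exact ha h

variable (ha : ¬ G.IsRegular a)

theorem finite_strip_self {x : FinitePath G a} {p : List E} (hp : x.1.2 = p) :
    (finite ha).strip p x = some (FinitePath.single G a) := by
  induction p generalizing x with
  | nil =>
    rw [strip]
    congr 1
    apply Subtype.ext
    have h1 := x.2
    rw [hp] at h1
    exact Prod.ext h1.eq_of_nil hp
  | cons e p ih =>
    refine (finite ha).strip_cons_eq_some.2 ⟨?_, ih ?_⟩
    · change x.1.2.head? = some e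
      rw [hp]; rfl
    · change (FinitePath.tail x).1.2 = p
      rw [FinitePath.tail_of_eq hp]

theorem finite_eq_append_of_strip {x z : FinitePath G a} {p : List E}
    (h : (finite ha).strip p x = some z) : x.1.2 = p ++ z.1.2 := by
  induction p generalizing x with
  | nil => rw [strip] at h; rw [Option.some.inj h]; rfl
  | cons e p ih =>
    obtain ⟨h1, h2⟩ := (finite ha).strip_cons_eq_some.1 h
    obtain ⟨q, hq⟩ := List.head?_eq_some_iff.1 h1
    have h3 := ih h2
    change (FinitePath.tail x).1.2 = _ at h3
    rw [FinitePath.tail_of_eq hq] at h3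
    rw [hq, List.cons_append, ← h3]

theorem finite_isConnected : (finite ha).IsConnected := fun x y =>
  ⟨x.1.2, y.1.2, _, finite_strip_self ha rfl, finite_strip_self ha rfl⟩

/-- The whole path `x` serves as initial segment: a path of the same length that begins with `x` is
`x`. -/
theorem finite_isSeparated : (finite ha).IsSeparated := by
  intro x F
  refine ⟨x.1.2, _, finite_strip_self ha rfl, fun y _ hyx hdeg => ?_⟩
  by_contra hne
  obtain ⟨z, hz⟩ := Option.ne_none_iff_exists'.1 hne
  have h1 := finite_eq_append_of_strip ha hz
  have h2 : y.1.2.length = x.1.2.length := Int.ofNat.inj hdeg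
  rw [h1, List.length_append] at h2
  have h3 : z.1.2 = [] := List.length_eq_zero_iff.1 (by omega)
  rw [h3, List.append_nil] at h1
  refine hyx (Subtype.ext (Prod.ext ?_ h1))
  have h4 := y.2
  rw [h1] at h4
  exact h4.source_unique x.2

theorem finite_nonSources : (finite ha).nonSources = (G.root a)ᶜ := by
  ext b
  constructor
  · rintro h ⟨p, hp⟩
    exact h ⟨(b, p), hp⟩ rfl
  · rintro h x rfl
    exact h ⟨_, x.2⟩

/-- The trivial path at `a`, the only one without a first edge, is not killed by the breaking
element of `a`. -/
theorem finite_breakingSources :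
    (finite ha).breakingSources = G.breaking (G.root a)ᶜ \ {a} := by
  ext b
  simp only [breakingSources, finite_nonSources, Set.mem_ofPred_eq, Set.mem_sdiff,
    Set.mem_singleton_iff]
  refine and_congr_right fun _ => ⟨?_, ?_⟩
  · rintro h rfl
    exact h (FinitePath.single G b) rfl rfl
  · intro hb x hx h
    have h1 := x.2
    rw [List.head?_eq_none_iff.1 h] at h1
    exact hb (hx.symm.trans h1.eq_of_nil)

end FinitePaths

/-! ### The module of infinite paths tail equivalent to a given one -/

section InfinitePaths

variable {V : Type v} {E : Type w} {G : DirGraph V E} {α : ℕ → E}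

/-- The infinite paths tail equivalent to `α`, together with their sources and the lag of the
equivalence. -/
abbrev TailPath (G : DirGraph V E) (α : ℕ → E) : Type (max v w) :=
  {x : V × (ℕ → E) × ℤ // G.IsInfinitePath x.2.1 ∧ x.1 = G.s (x.2.1 0) ∧
    ∃ i j : ℕ, (∀ t, x.2.1 (i + t) = α (j + t)) ∧ x.2.2 = (i : ℤ) - j}

namespace TailPath

def shift (hα : G.IsInfinitePath α) (j : ℕ) : TailPath G α :=
  ⟨(G.s (α j), fun t => α (j + t), -j), fun t => hα (j + t), rfl, 0, j,
    fun t => by simp only [zero_add], by simp⟩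

open Classical in
noncomputable def cons (e : E) (x : TailPath G α) : TailPath G α :=
  if h : x.1.1 = G.r e then
    ⟨(G.s e, fun n => Nat.casesOn n e x.1.2.1, x.1.2.2 + 1), by
      intro n
      cases n with
      | zero => exact h.symm.trans x.2.2.1
      | succ n => exact x.2.1 n, rfl, by
      obtain ⟨i, j, h1, h2⟩ := x.2.2.2
      refine ⟨i + 1, j, fun t => ?_, ?_⟩
      · rw [add_right_comm]; exact h1 t
      · simp only [h2]; push_cast; ring⟩
  else x

def tail (x : TailPath G α) : TailPath G α :=
  ⟨(G.s (x.1.2.1 1), fun n => x.1.2.1 (n + 1), x.1.2.2 - 1), fun n => x.2.1 (n + 1), rfl, by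
    obtain ⟨i, j, h1, h2⟩ := x.2.2.2
    refine ⟨i, j + 1, fun t => ?_, ?_⟩
    · dsimp only
      rw [add_assoc, h1]
      congr 1
      omega
    · simp only [h2]; push_cast; ring⟩

theorem cons_of_eq {e : E} {x : TailPath G α} (h : x.1.1 = G.r e) :
    (cons e x).1 = (G.s e, fun n => Nat.casesOn n e x.1.2.1, x.1.2.2 + 1) := by
  rw [cons, dif_pos h]

theorem iterate_tail (n : ℕ) (x : TailPath G α) :
    (tail^[n] x).1 = (G.s (x.1.2.1 n), fun t => x.1.2.1 (t + n), x.1.2.2 - n) := by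
  induction n generalizing x with
  | zero =>
    simp only [Function.iterate_zero, id, Nat.cast_zero, sub_zero, add_zero]
    exact Prod.ext x.2.2.1 rfl
  | succ n ih =>
    rw [Function.iterate_succ_apply, ih]
    refine Prod.ext rfl (Prod.ext (funext fun t => rfl) ?_)
    change x.1.2.2 - 1 - n = _
    push_cast; ring

end TailPath

open TailPath in
variable (G α) in
/-- The system of the infinite paths tail equivalent to `α`. -/
noncomputable def infinite : PathSystem G (TailPath G α) where
  src x := x.1.1
  deg x := x.1.2.2
  cons := TailPath.cons
  head x := some (x.1.2.1 0)
  tail := TailPath.tail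
  src_cons e x h := by rw [cons_of_eq h]
  deg_cons e x h := by rw [cons_of_eq h]
  head_cons e x h := by rw [cons_of_eq h]; rfl
  tail_cons e x h := by
    apply Subtype.ext
    rw [TailPath.tail]
    simp only [cons_of_eq h]
    refine Prod.ext x.2.2.1.symm (Prod.ext rfl ?_)
    simp
  source_of_head e x h := by rw [← Option.some.inj h]; exact x.2.2.1.symm
  src_tail e x h := by rw [← Option.some.inj h]; exact (x.2.1 0).symm
  cons_tail e x h := by
    obtain rfl := Option.some.inj h
    apply Subtype.ext
    rw [cons_of_eq (x.2.1 0).symm]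
    refine Prod.ext x.2.2.1.symm (Prod.ext (funext fun n => ?_) ?_)
    · cases n <;> rfl
    · change x.1.2.2 - 1 + 1 = _
      ring
  head_ne_none x _ := by simp

variable (α) in
theorem infinite_exists_strip (n : ℕ) (x : TailPath G α) :
    ∃ p, (infinite G α).strip p x = some (TailPath.tail^[n] x) ∧
      ∀ y : TailPath G α, (∃ t < n, y.1.2.1 t ≠ x.1.2.1 t) →
        (infinite G α).strip p y = none := by
  induction n generalizing x with
  | zero => exact ⟨[], rfl, fun y ⟨t, ht, _⟩ => absurd ht (Nat.not_lt_zero t)⟩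
  | succ n ih =>
    obtain ⟨p, hp, hy⟩ := ih (TailPath.tail x)
    refine ⟨x.1.2.1 0 :: p, (infinite G α).strip_cons_eq_some.2 ⟨rfl, hp⟩, ?_⟩
    rintro y ⟨t, ht, hne⟩
    rw [strip]
    split_ifs with h
    · cases t with
      | zero => exact absurd (Option.some.inj h) hne
      | succ t => exact hy (TailPath.tail y) ⟨t, by omega, hne⟩
    · rfl

theorem infinite_isConnected : (infinite G α).IsConnected := by
  intro x y
  obtain ⟨i, j, h1, h2⟩ := x.2.2.2
  obtain ⟨i', j', h1', h2'⟩ := y.2.2.2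
  -- Dropping `i + j'` edges from `x` and `i' + j` edges from `y` leaves in both cases `α` from
  -- position `j + j'` on, with lag `-(j + j')`.
  obtain ⟨p, hp, -⟩ := infinite_exists_strip α (i + j') x
  obtain ⟨q, hq, -⟩ := infinite_exists_strip α (i' + j) y
  refine ⟨p, q, _, hp, hq.trans (congrArg some (Subtype.ext ?_))⟩
  rw [TailPath.iterate_tail, TailPath.iterate_tail]
  have h3 : ∀ t, y.1.2.1 (t + (i' + j)) = x.1.2.1 (t + (i + j')) := by
    intro t
    have e1 : t + (i' + j) = i' + (j + t) := by omega
    have e2 : t + (i + j') = i + (j' + t) := by omega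
    rw [e1, e2, h1, h1']
    congr 1
    omega
  refine Prod.ext ?_ (Prod.ext (funext h3) ?_)
  · have := h3 0
    rw [zero_add, zero_add] at this
    exact congrArg G.s this
  · simp only [h2, h2']
    push_cast
    ring

/-- Elements of equal lag differ in some edge, and for finitely many of them these positions are
bounded. -/
theorem infinite_isSeparated : (infinite G α).IsSeparated := by
  intro x F
  have hex : ∀ y : TailPath G α, ∃ t, y ≠ x → y.1.2.2 = x.1.2.2 → y.1.2.1 t ≠ x.1.2.1 t := by
    intro y
    by_contra! hcon
    have h1 : y.1.2.1 = x.1.2.1 := funext fun t => (hcon t).2.2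
    refine (hcon 0).1 (Subtype.ext (Prod.ext ?_ (Prod.ext h1 (hcon 0).2.1)))
    rw [y.2.2.1, x.2.2.1, h1]
  choose t ht using hex
  obtain ⟨p, hp, hy⟩ := infinite_exists_strip α (F.sup t + 1) x
  exact ⟨p, _, hp, fun y hyF hyx hdeg =>
    hy y ⟨t y, Nat.lt_succ_of_le (Finset.le_sup hyF), ht y hyx hdeg⟩⟩

theorem infinite_nonSources (hα : G.IsInfinitePath α) :
    (infinite G α).nonSources = (G.rootSet (G.infinitePathVertices α))ᶜ := by
  have hprolong : ∀ {a b : V} {p : List E}, G.IsPath a p b →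
      (∃ x, (infinite G α).src x = b) → ∃ x, (infinite G α).src x = a := by
    intro a b p hp
    induction hp with
    | nil => exact id
    | cons e _ ih =>
      intro hx
      obtain ⟨y, hy⟩ := ih hx
      exact ⟨(infinite G α).cons e y, (infinite G α).src_cons e y hy⟩
  ext a
  constructor
  · rintro h ⟨_, ⟨j, rfl⟩, p, hp⟩
    obtain ⟨x, hx⟩ := hprolong hp ⟨TailPath.shift hα j, rfl⟩
    exact h x hx
  · rintro h x rfl
    apply h
    obtain ⟨i, j, h1, -⟩ := x.2.2.2
    refine ⟨_, ⟨j, rfl⟩, ?_⟩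
    have h2 := x.2.1.geq (Nat.zero_le i)
    have h3 := h1 0
    rw [add_zero, add_zero] at h3
    rw [h3, ← x.2.2.1] at h2
    exact h2

theorem infinite_breakingSources (hα : G.IsInfinitePath α) :
    (infinite G α).breakingSources =
      G.breaking (G.rootSet (G.infinitePathVertices α))ᶜ := by
  ext b
  simp only [breakingSources, infinite_nonSources hα, Set.mem_ofPred_eq]
  exact ⟨fun h => h.1, fun h => ⟨h, fun x _ => by simp [infinite]⟩⟩

end InfinitePaths

end PathSystem

namespace LeavittPathAlgebra

/-! ### Construction of graded primitive ideals -/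

section Construction

variable (K : Type u) [Field K] {V : Type v} {E : Type w} {G : DirGraph V E}

theorem isGradedLeftPrimitive_of_vertex {a : V} (ha : ¬ G.IsRegular a) {H : Set V}
    (hH : H = (G.root a)ᶜ) :
    IsGradedLeftPrimitive (grading K G) (idealOf K G H (G.breaking H \ {a})) ∧
      vertexSet (idealOf K G H (G.breaking H \ {a})) = H := by
  have h := PathSystem.isGradedLeftPrimitive K (PathSystem.finite_isConnected ha)
    (PathSystem.finite_isSeparated ha)
  rwa [PathSystem.finite_nonSources, PathSystem.finite_breakingSources, ← hH] at h

theorem isGradedLeftPrimitive_of_infinitePath {α : ℕ → E} (hα : G.IsInfinitePath α) {H : Set V}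
    (hH : H = (G.rootSet (G.infinitePathVertices α))ᶜ) :
    IsGradedLeftPrimitive (grading K G) (idealOf K G H (G.breaking H)) ∧
      vertexSet (idealOf K G H (G.breaking H)) = H := by
  have : Nonempty (PathSystem.TailPath G α) := ⟨PathSystem.TailPath.shift hα 0⟩
  have h := PathSystem.isGradedLeftPrimitive K
    (PathSystem.infinite_isConnected (G := G) (α := α)) PathSystem.infinite_isSeparated
  rwa [PathSystem.infinite_nonSources hα, PathSystem.infinite_breakingSources hα, ← hH] at h

/-- For `S = B_H` the infinite path runs around the cycle forever. For `S = B_H - {b}` the finite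
paths ending at `b` serve: `b` is an infinite emitter and `R(b) = R(a)`. -/
theorem isGradedLeftPrimitive_of_cycle {c : List E} (hc : G.IsCycle c) {a : V}
    (ha : a ∈ G.cycleVertices c) {H S : Set V} (hH : H = (G.root a)ᶜ)
    (hS : S = G.breaking H ∨
      ∃ b ∈ G.breaking H, b ∈ G.cycleVertices c ∧ S = G.breaking H \ {b}) :
    IsGradedLeftPrimitive (grading K G) (idealOf K G H S) ∧
      vertexSet (idealOf K G H S) = H := by
  rcases hS with rfl | ⟨b, hb, hbc, rfl⟩
  · obtain ⟨α, hα, hαa⟩ := hc.exists_infinitePath ha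
    exact isGradedLeftPrimitive_of_infinitePath K hα (by rw [hH, hαa])
  · refine isGradedLeftPrimitive_of_vertex K (fun hreg => hb.2.1 hreg.2) ?_
    rw [hH, DirGraph.root_eq_iff.2 ⟨hc.geq ha hbc, hc.geq hbc ha⟩]

theorem isGradedLeftPrimitive_of_pair {H S : Set V} (h : G.IsPrimitivePair H S) :
    IsGradedLeftPrimitive (grading K G) (idealOf K G H S) ∧
      vertexSet (idealOf K G H S) = H := by
  rcases h.cases with ⟨α, rfl, hα, hH, -⟩ | ⟨a, rfl, hH, ha⟩ | ⟨a, c, hH, hc, ha, hS⟩ |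
    ⟨a, c, hH, hc, ha, hS⟩
  · exact isGradedLeftPrimitive_of_infinitePath K hα.1 hH
  · have haH : a ∉ H := by
      rw [hH]; exact fun h => h (DirGraph.mem_root_self a)
    -- A regular vertex emitting only into the saturated set `H` would belong to it. Nor is `a` a
    -- breaking vertex, so removing it from `B_H` changes nothing.
    have hreg : ¬ G.IsRegular a := fun hreg => haH (h.1.2.1 a hreg ha)
    have hbr : G.breaking H \ {a} = G.breaking H := by
      refine Set.sdiff_singleton_eq_self fun hab => ?_
      obtain ⟨e, he, he'⟩ := hab.2.2.1
      exact he' (ha e he)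
    have h1 := isGradedLeftPrimitive_of_vertex K hreg hH
    rwa [hbr] at h1
  · exact isGradedLeftPrimitive_of_cycle K hc.1 ha hH hS
  · exact isGradedLeftPrimitive_of_cycle K hc.1 ha hH hS

theorem isGradedPrimitive_of_pair {H S : Set V} (h : G.IsPrimitivePair H S) :
    IsGradedPrimitive (grading K G) (idealOf K G H S) := by
  have h1 := (isGradedLeftPrimitive_of_pair K h).1
  exact ⟨h1, h1.right (invol K G).toAddMonoidHom invol_invol invol_mul
    (fun _ _ hx => invol_mem_grading hx) (fun _ hx => invol_mem_idealOf h.1.2.2 hx)⟩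

end Construction

end LeavittPathAlgebra

namespace LeavittPathAlgebra

/-! ### Necessity: directedness and breaking vertices -/

section Primeness

variable {K : Type u} [Field K] {V : Type v} {E : Type w} {G : DirGraph V E}
  {P : TwoSidedIdeal (LeavittPathAlgebra K G)}

theorem vert_mem_grading (a : V) : vert K G a ∈ grading K G 0 :=
  Submodule.subset_span ⟨a, a, a, [], [], .nil a, .nil a, by simp, (vert_mul_self a).symm⟩

theorem breakingElement_mem_grading {H : Set V} {a : V} (h : (G.emittedOutside H a).Finite) :
    breakingElement K G H a ∈ grading K G 0 := by
  rw [breakingElement_eq h]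
  refine sub_mem (vert_mem_grading a) (sum_mem fun e _ => ?_)
  refine Submodule.subset_span ⟨_, _, _, [e], [e], DirGraph.isPath_singleton e,
    DirGraph.isPath_singleton e, by simp, ?_⟩
  rw [path_singleton, ghostPath_singleton]

theorem vert_mul_breakingElement {H : Set V} {a : V} (h : (G.emittedOutside H a).Finite) :
    vert K G a * breakingElement K G H a = breakingElement K G H a := by
  have := congrArg (invol K G) (breakingElement_mul_vert (K := K) h)
  rwa [invol_mul, invol_vert, invol_breakingElement h] at this

theorem ghost_mul_breakingElement {H : Set V} {a : V} (h : (G.emittedOutside H a).Finite) {e : E}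
    (he : G.s e = a) :
    ghost K G e * breakingElement K G H a = 0 ∨
      G.r e ∈ H ∧ ghost K G e * breakingElement K G H a = ghost K G e := by
  have h1 : ghost K G e * breakingElement K G H a =
      invol K G (breakingElement K G H a * edge K G e) := by
    rw [invol_mul, invol_edge, invol_breakingElement h]
  rcases breakingElement_mul_edge (K := K) h he with h2 | ⟨h2, h3⟩
  · left; rw [h1, h2, map_zero]
  · right; exact ⟨h2, by rw [h1, h3, invol_edge]⟩

theorem breakingElement_mul_path {a c d : V} {p : List E}
    (h : (G.emittedOutside (vertexSet P) a).Finite) (hp : G.IsPath c p d)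
    (hne : breakingElement K G (vertexSet P) a * path K G c p ∉ P) : p = [] ∧ c = a := by
  by_cases hca : c = a
  swap
  · exfalso
    apply hne
    rw [← breakingElement_mul_vert h, mul_assoc, vert_mul_path_of_ne hp (Ne.symm hca), mul_zero]
    exact P.zero_mem
  refine ⟨?_, hca⟩
  cases p with
  | nil => rfl
  | cons e p =>
    exfalso
    apply hne
    rw [path, ← mul_assoc]
    refine P.mul_mem_right _ _ ?_
    rcases breakingElement_mul_edge (K := K) h (hp.source_eq.trans hca) with h1 | ⟨h1, h2⟩
    · rw [h1]; exact P.zero_mem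
    · rw [h2]; exact edge_mem_of_range h1

theorem ghostPath_mul_breakingElement {a c d : V} {p : List E}
    (h : (G.emittedOutside (vertexSet P) a).Finite) (hp : G.IsPath c p d)
    (hne : ghostPath K G c p * breakingElement K G (vertexSet P) a ∉ P) : p = [] ∧ c = a := by
  by_cases hca : c = a
  swap
  · exfalso
    apply hne
    rw [← vert_mul_breakingElement h, ← mul_assoc, ghostPath_mul_vert_of_ne hp hca, zero_mul]
    exact P.zero_mem
  refine ⟨?_, hca⟩
  cases p with
  | nil => rfl
  | cons e p =>
    exfalso
    apply hne
    rw [ghostPath, mul_assoc]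
    refine P.mul_mem_left _ _ ?_
    rcases ghost_mul_breakingElement (K := K) h (hp.source_eq.trans hca) with h1 | ⟨h1, h2⟩
    · rw [h1]; exact P.zero_mem
    · rw [h2]; exact ghost_mem_of_range h1

/-- Primeness on monomials: for a homogeneous `m` with `y m ≠ 0` the element `y m` is homogeneous
and generates the module, which `x` does not annihilate. Homogeneity is needed only for `y`. -/
theorem IsGradedLeftPrimitive.exists_monomial (h : IsGradedLeftPrimitive (grading K G) P)
    {x y : LeavittPathAlgebra K G} (hx : x ∉ P) (hy : y ∉ P) (hy0 : y ∈ grading K G 0) :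
    ∃ t ∈ monomials K G, x * t * y ∉ P := by
  obtain ⟨-, M, _, act, ℳ, hl, hs, hann⟩ := h
  rw [hann] at hx hy
  push Not at hx hy
  obtain ⟨j, m, hm, hym⟩ := exists_homogeneous_act_ne_zero hs.isInternal hy
  obtain ⟨m', hm'⟩ := hx
  obtain ⟨z, rfl⟩ := hs.exists_act_eq exists_homogeneous_sum hl (hs.act_mem _ _ _ _ hy0 hm) hym m'
  refine exists_monomial_notMem P (y := z) fun hmem => hm' ?_
  rw [← hl, ← hl]
  exact (hann _).1 hmem m

/-- If `a p q* b ∉ P`, then the common range of `p` and `q` is outside `H` and below both `a` and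
`b`. -/
theorem isDownwardsDirected_of_primitive (h : IsGradedLeftPrimitive (grading K G) P) :
    G.IsDownwardsDirected (vertexSet P)ᶜ := by
  constructor
  -- If all vertices were in `P`, local units would put every element into `P`, and the action would
  -- be zero.
  · by_contra hemp
    rw [Set.not_nonempty_iff_eq_empty, Set.compl_empty_iff] at hemp
    obtain ⟨-, M, _, act, ℳ, hl, hs, hann⟩ := h
    obtain ⟨x, m, hne⟩ := hs.act_ne_zero
    refine hne ((hann x).1 ?_ m)
    obtain ⟨F, hF⟩ := exists_local_unit x
    rw [← (hF F subset_rfl).1]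
    refine P.mul_mem_right _ _ (sum_mem_ideal P fun a _ => ?_)
    rw [← mem_vertexSet, hemp]
    trivial
  · intro a ha b hb
    obtain ⟨t, ⟨c, d, z, p, q, hp, hq, rfl⟩, ht⟩ :=
      IsGradedLeftPrimitive.exists_monomial h (x := vert K G a) (y := vert K G b) ha hb
        (vert_mem_grading b)
    have hac : a = c := by
      by_contra hac
      apply ht
      rw [← mul_assoc, vert_mul_path_of_ne hp hac, zero_mul, zero_mul]
      exact P.zero_mem
    have hdb : d = b := by
      by_contra hdb
      apply ht
      rw [mul_assoc, mul_assoc, ghostPath_mul_vert_of_ne hq hdb, mul_zero, mul_zero]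
      exact P.zero_mem
    subst hac hdb
    refine ⟨z, fun hz => ht ?_, ⟨p, hp⟩, ⟨q, hq⟩⟩
    refine P.mul_mem_right _ _ (P.mul_mem_left _ _ ?_)
    rw [← path_mul_vert hp]
    exact P.mul_mem_right _ _ (P.mul_mem_left _ _ hz)

/-- A breaking vertex whose breaking element is not in the primitive ideal. -/
theorem exists_path_of_breakingElement_notMem (h : IsGradedLeftPrimitive (grading K G) P)
    {u : V} (hu : u ∈ G.breaking (vertexSet P))
    (huP : breakingElement K G (vertexSet P) u ∉ P) {x : LeavittPathAlgebra K G} (hx : x ∉ P) :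
    ∃ c p, G.IsPath c p u ∧ x * path K G c p ∉ P := by
  obtain ⟨t, ⟨c, d, z, p, q, hp, hq, rfl⟩, ht⟩ := IsGradedLeftPrimitive.exists_monomial h hx huP
    (breakingElement_mem_grading hu.2.2.2)
  have h1 : ghostPath K G d q * breakingElement K G (vertexSet P) u ∉ P := fun hmem => by
    apply ht
    rw [mul_assoc, mul_assoc]
    exact P.mul_mem_left _ _ (P.mul_mem_left _ _ hmem)
  obtain ⟨rfl, rfl⟩ := ghostPath_mul_breakingElement hu.2.2.2 hq h1
  obtain rfl := hq.eq_of_nil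
  refine ⟨c, p, hp, fun hmem => ht ?_⟩
  rw [← mul_assoc]
  exact P.mul_mem_right _ _ (P.mul_mem_right _ _ hmem)

/-- When `u^H ∉ P`, primeness joins every element outside `P` to `u^H` by a path ending at `u`. From
a vertex this gives `a ≥ u`; from another missing `a^H` the path must be trivial, so `a = u`. -/
theorem breakingSet_of_primitive (h : IsGradedLeftPrimitive (grading K G) P) :
    breakingSet P = G.breaking (vertexSet P) ∨ ∃ u ∈ G.breaking (vertexSet P),
      (vertexSet P)ᶜ = G.root u ∧ breakingSet P = G.breaking (vertexSet P) \ {u} := by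
  rw [or_iff_not_imp_left]
  intro hne
  obtain ⟨u, hu, huP⟩ : ∃ u ∈ G.breaking (vertexSet P),
      breakingElement K G (vertexSet P) u ∉ P := by
    by_contra! hcon
    exact hne (Set.Subset.antisymm (fun a ha => ha.1) fun a ha => ⟨ha, hcon a ha⟩)
  refine ⟨u, hu, Set.Subset.antisymm (fun a ha => ?_)
    (DirGraph.root_subset_of_hereditary (vertexSet_hereditary P) hu.1), ?_⟩
  · obtain ⟨c, p, hp, hne⟩ :=
      exists_path_of_breakingElement_notMem h hu huP (x := vert K G a) ha
    have hac : a = c := by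
      by_contra hac
      apply hne
      rw [vert_mul_path_of_ne hp hac]
      exact P.zero_mem
    subst hac
    exact ⟨p, hp⟩
  · ext a
    constructor
    · intro ha
      refine ⟨ha.1, ?_⟩
      rintro rfl
      exact huP ha.2
    · rintro ⟨ha, hau⟩
      refine ⟨ha, ?_⟩
      by_contra haP
      obtain ⟨c, p, hp, hne⟩ := exists_path_of_breakingElement_notMem h hu huP haP
      obtain ⟨rfl, rfl⟩ := breakingElement_mul_path ha.2.2.2 hp hne
      exact hau hp.eq_of_nil

end Primeness

/-! ### Necessity: the countable separation property -/

section Separation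

variable {K : Type u} [Field K] {V : Type v} {E : Type w} {G : DirGraph V E}

variable (K G) in
/-- The span of the elements `p q*` of degree zero with `|q| ≤ N` and with range in `A`. -/
noncomputable def zeroSpan (N : ℕ) (A : Set V) : Submodule K (LeavittPathAlgebra K G) :=
  Submodule.span K {x | ∃ (a b c : V) (p q : List E), G.IsPath a p c ∧ G.IsPath b q c ∧
    p.length = q.length ∧ q.length ≤ N ∧ c ∈ A ∧ x = path K G a p * ghostPath K G b q}

variable (K G) in
/-- The span of the elements `p q*` with `n ≤ |q| ≤ N` and with range in `A`. -/
noncomputable def boundedSpan (n N : ℕ) (A : Set V) : Submodule K (LeavittPathAlgebra K G) :=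
  Submodule.span K {x | ∃ (a b c : V) (p q : List E), G.IsPath a p c ∧ G.IsPath b q c ∧
    n ≤ q.length ∧ q.length ≤ N ∧ c ∈ A ∧ x = path K G a p * ghostPath K G b q}

theorem zeroSpan_mono {N N' : ℕ} (hN : N ≤ N') {A A' : Set V} (hA : A ⊆ A') :
    zeroSpan K G N A ≤ zeroSpan K G N' A' := by
  refine Submodule.span_mono ?_
  rintro x ⟨a, b, c, p, q, hp, hq, h1, h2, h3, h4⟩
  exact ⟨a, b, c, p, q, hp, hq, h1, h2.trans hN, hA h3, h4⟩

theorem zeroSpan_le_boundedSpan (N : ℕ) (A : Set V) :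
    zeroSpan K G N A ≤ boundedSpan K G 0 N A := by
  refine Submodule.span_mono ?_
  rintro x ⟨a, b, c, p, q, hp, hq, h1, h2, h3, h4⟩
  exact ⟨a, b, c, p, q, hp, hq, Nat.zero_le _, h2, h3, h4⟩

theorem boundedSpan_eq_bot {n N : ℕ} (h : N < n) (A : Set V) : boundedSpan K G n N A = ⊥ := by
  rw [boundedSpan, Submodule.span_eq_bot]
  rintro x ⟨a, b, c, p, q, hp, hq, h1, h2, h3, h4⟩
  omega

/-- In `p q* p' q'*` with ranges `c ∈ A` and `c' ∈ A'`, the case `q = p' t` would give `w ≥ c' ≥ c`,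
which is excluded. So a nonzero product has `p' = q t`, with `t` nonempty for the same reason, and
`|q'| = |p'| > |q|`. -/
theorem mul_mem_boundedSpan {n N : ℕ} {A A' : Set V} {w : V} (hw : w ∉ G.rootSet A)
    (hA' : ∀ a ∈ A', G.Geq w a) {x y : LeavittPathAlgebra K G} (hx : x ∈ boundedSpan K G n N A)
    (hy : y ∈ zeroSpan K G N A') : x * y ∈ boundedSpan K G (n + 1) N A' := by
  induction hx using Submodule.span_induction with
  | zero => rw [zero_mul]; exact zero_mem _
  | add x x' _ _ hx hx' => rw [add_mul]; exact add_mem hx hx'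
  | smul k x _ hx => rw [smul_mul_assoc]; exact Submodule.smul_mem _ _ hx
  | mem x hx =>
    obtain ⟨a, b, c, p, q, hp, hq, hn, hN, hc, rfl⟩ := hx
    induction hy using Submodule.span_induction with
    | zero => rw [mul_zero]; exact zero_mem _
    | add y y' _ _ hy hy' => rw [mul_add]; exact add_mem hy hy'
    | smul k y _ hy => rw [mul_smul_comm]; exact Submodule.smul_mem _ _ hy
    | mem y hy =>
      obtain ⟨a', b', c', p', q', hp', hq', hlen, hN', hc', rfl⟩ := hy
      have hmul : path K G a p * ghostPath K G b q * (path K G a' p' * ghostPath K G b' q') =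
          path K G a p * (ghostPath K G b q * path K G a' p') * ghostPath K G b' q' := by
        simp only [mul_assoc]
      rw [hmul]
      rcases ghostPath_mul_path_cases (K := K) hq hp' with
        ⟨t, ht, -, h1, h2⟩ | ⟨t, ht, -, h1, -⟩ | h
      · have hne : t ≠ [] := by
          rintro rfl
          obtain rfl := h1.eq_of_nil
          exact hw ⟨c, hc, hA' c hc'⟩
        rw [h2, ← path_append hp h1]
        refine Submodule.subset_span ⟨_, _, _, _, _, hp.append h1, hq', ?_, hN', hc', rfl⟩
        have := List.length_pos_of_ne_nil hne
        rw [← hlen, ht, List.length_append]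
        omega
      · exact absurd ⟨c, hc, (hA' c' hc').trans ⟨t, h1⟩⟩ hw
      · rw [h, mul_zero, zero_mul]; exact zero_mem _

/-- Elements of degree zero in the ideal generated by `w`. -/
theorem mul_vert_mul_mem {i : ℤ} {w b c : V} {p q : List E} (hp : G.IsPath w p c)
    (hq : G.IsPath b q c) (hi : (p.length : ℤ) - q.length = i) {y : LeavittPathAlgebra K G}
    (hy : y ∈ component K G (-i)) (P : TwoSidedIdeal (LeavittPathAlgebra K G)) :
    ∃ (N : ℕ) (A : Finset V), (∀ a ∈ A, a ∉ vertexSet P ∧ G.Geq w a) ∧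
      ∃ z ∈ zeroSpan K G N A, y * (path K G w p * ghostPath K G b q) - z ∈ P := by
  classical
  induction hy using Submodule.span_induction with
  | zero => exact ⟨0, ∅, by simp, 0, zero_mem _, by
    rw [zero_mul, sub_zero]; exact P.zero_mem⟩
  | add y y' _ _ hy hy' =>
    obtain ⟨N, A, hA, z, hz, hzP⟩ := hy
    obtain ⟨N', A', hA', z', hz', hzP'⟩ := hy'
    refine ⟨max N N', A ∪ A', fun a ha => ?_, z + z', add_mem
      (zeroSpan_mono (le_max_left N N') (by simp) hz)
      (zeroSpan_mono (le_max_right N N') (by simp) hz'), ?_⟩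
    · rcases Finset.mem_union.1 ha with ha | ha
      · exact hA a ha
      · exact hA' a ha
    · rw [add_mul, add_sub_add_comm]
      exact P.add_mem hzP hzP'
  | smul k y _ hy =>
    obtain ⟨N, A, hA, z, hz, hzP⟩ := hy
    refine ⟨N, A, hA, k • z, Submodule.smul_mem _ _ hz, ?_⟩
    rw [smul_mul_assoc, ← smul_sub]
    exact smul_mem_ideal P k hzP
  | mem y hy =>
    obtain ⟨a', b', c', p', q', hp', hq', hlen, rfl⟩ := hy
    have hmul : path K G a' p' * ghostPath K G b' q' * (path K G w p * ghostPath K G b q) =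
        path K G a' p' * (ghostPath K G b' q' * path K G w p) * ghostPath K G b q := by
      simp only [mul_assoc]
    -- A monomial whose range is a vertex of `P` lies in `P` and is replaced by zero, so only ranges
    -- outside `vertexSet P` remain.
    have key : ∀ {a b d : V} {r s : List E}, G.IsPath a r d → G.IsPath b s d →
        r.length = s.length → G.Geq w d →
        ∃ (N : ℕ) (A : Finset V), (∀ a ∈ A, a ∉ vertexSet P ∧ G.Geq w a) ∧
          ∃ z ∈ zeroSpan K G N A, path K G a r * ghostPath K G b s - z ∈ P := by
      intro a b d r s hr hs hrs hwd
      by_cases hd : d ∈ vertexSet P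
      · refine ⟨0, ∅, by simp, 0, zero_mem _, ?_⟩
        rw [sub_zero, ← path_mul_vert hr]
        exact P.mul_mem_right _ _ (P.mul_mem_left _ _ hd)
      · refine ⟨s.length, {d}, by simpa using ⟨hd, hwd⟩, _, Submodule.subset_span
          ⟨a, b, d, r, s, hr, hs, hrs, le_rfl, by simp, rfl⟩, ?_⟩
        rw [sub_self]; exact P.zero_mem
    rw [hmul]
    rcases ghostPath_mul_path_cases (K := K) hq' hp with
      ⟨t, ht, -, h1, h2⟩ | ⟨t, ht, -, h1, h2⟩ | h
    · rw [h2, ← path_append hp' h1]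
      refine key (hp'.append h1) hq ?_ ⟨p, hp⟩
      have := congrArg List.length ht
      simp only [List.length_append] at this ⊢
      omega
    · rw [h2, mul_assoc, ← ghostPath_append hq h1]
      refine key hp' (hq.append h1) ?_ (DirGraph.Geq.trans ⟨p, hp⟩ ⟨t, h1⟩)
      have := congrArg List.length ht
      simp only [List.length_append] at this ⊢
      omega
    · refine ⟨0, ∅, by simp, 0, zero_mem _, ?_⟩
      rw [h, mul_zero, zero_mul, sub_zero]; exact P.zero_mem

/-- As `w` does not annihilate the module, some monomial starting at `w` does not kill `m`. Graded
simplicity returns from its image to `m` by a homogeneous element of opposite degree; the product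
has degree zero and passes through vertices below `w`. -/
theorem exists_zeroSpan_act {P : TwoSidedIdeal (LeavittPathAlgebra K G)} {M : Type*}
    [AddCommGroup M] {act : LeavittPathAlgebra K G →+ M →+ M} {ℳ : ℤ → AddSubgroup M}
    (hl : IsLeftAction act) (hs : IsGradedSimple (grading K G) act ℳ)
    (hann : ∀ x, x ∈ P ↔ ∀ m, act x m = 0) {j : ℤ} {m : M} (hm : m ∈ ℳ j) (hm0 : m ≠ 0)
    {w : V} (hw : w ∉ vertexSet P) :
    ∃ (N : ℕ) (A : Finset V), (∀ a ∈ A, a ∉ vertexSet P ∧ G.Geq w a) ∧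
      ∃ z ∈ zeroSpan K G N A, act z m = m := by
  obtain ⟨b, c, p, q, hp, hq, hne⟩ : ∃ (b c : V) (p q : List E), G.IsPath w p c ∧
      G.IsPath b q c ∧ act (path K G w p * ghostPath K G b q) m ≠ 0 := by
    by_contra! hcon
    rw [mem_vertexSet, hann] at hw
    push Not at hw
    obtain ⟨m', hm'⟩ := hw
    apply hm'
    obtain ⟨y, rfl⟩ := hs.exists_act_eq exists_homogeneous_sum hl hm hm0 m'
    clear hm'
    induction mem_span_monomials y using Submodule.span_induction with
    | zero => simp
    | add y y' _ _ hy hy' => rw [map_add, AddMonoidHom.add_apply, map_add, hy, hy', add_zero]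
    | smul k y _ hy =>
      -- The module carries no `K`-structure, so the scalar is moved onto the vertex.
      have h1 : vert K G w * (k • y) = (k • vert K G w) * (vert K G w * y) := by
        rw [mul_smul_comm, smul_mul_assoc, ← mul_assoc, vert_mul_self]
      rw [← hl, h1, hl, hl, hy, map_zero]
    | mem y hy =>
      obtain ⟨a, b, c, p, q, hp, hq, rfl⟩ := hy
      rw [← hl, ← mul_assoc]
      by_cases hwa : w = a
      · subst hwa
        rw [vert_mul_path hp]
        exact hcon b c p q hp hq
      · rw [vert_mul_path_of_ne hp hwa, zero_mul, map_zero, AddMonoidHom.zero_apply]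
  have hgr : path K G w p * ghostPath K G b q ∈ grading K G ((p.length : ℤ) - q.length) :=
    Submodule.subset_span ⟨w, b, c, p, q, hp, hq, rfl, rfl⟩
  obtain ⟨y, hy, hym⟩ := hs.exists_homogeneous_act_eq exists_homogeneous_sum hl
    (hs.act_mem _ _ _ _ hgr hm) hne hm
  have hdeg : j - ((p.length : ℤ) - q.length + j) = -((p.length : ℤ) - q.length) := by ring
  rw [hdeg] at hy
  obtain ⟨N, A, hA, z, hz, hzP⟩ := mul_vert_mul_mem hp hq rfl hy P
  refine ⟨N, A, hA, z, hz, ?_⟩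
  have h1 := (hann _).1 hzP m
  rw [map_sub, AddMonoidHom.sub_apply, hl, hym, sub_eq_zero] at h1
  exact h1.symm

/-- If no finite set worked, one could always choose a new `w` outside the root of the ranges used
so far. Multiplying by its element, which also fixes `m`, raises the lower bound for `|q|` by one,
while `|q| ≤ N` persists. -/
theorem exists_finset_of_zeroSpan_act {P : TwoSidedIdeal (LeavittPathAlgebra K G)} {M : Type*}
    [AddCommGroup M] {act : LeavittPathAlgebra K G →+ M →+ M} (hl : IsLeftAction act) {m : M}
    (hm0 : m ≠ 0) (N : ℕ) :
    ∃ C : Finset V, (∀ a ∈ C, a ∉ vertexSet P) ∧ ∀ w, (∃ A : Finset V,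
      (∀ a ∈ A, a ∉ vertexSet P ∧ G.Geq w a) ∧ ∃ z ∈ zeroSpan K G N A, act z m = m) →
      w ∈ G.rootSet C := by
  by_contra hcon
  have hcon' : ∀ C : Finset V, (∀ a ∈ C, a ∉ vertexSet P) → ∃ w, w ∉ G.rootSet C ∧
      ∃ A : Finset V, (∀ a ∈ A, a ∉ vertexSet P ∧ G.Geq w a) ∧
        ∃ z ∈ zeroSpan K G N A, act z m = m := by
    intro C hC
    by_contra hw
    exact hcon ⟨C, hC, fun w hA => by_contra fun hwC => hw ⟨w, hwC, hA⟩⟩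
  have key : ∀ n, ∃ A : Finset V, (∀ a ∈ A, a ∉ vertexSet P) ∧
      ∃ y ∈ boundedSpan K G n N A, act y m = m := by
    intro n
    induction n with
    | zero =>
      obtain ⟨w, -, A, hA, z, hz, hzm⟩ := hcon' ∅ fun a ha => absurd ha (Finset.notMem_empty a)
      have hz' : z ∈ boundedSpan K G 0 N (A : Set V) := zeroSpan_le_boundedSpan N (A : Set V) hz
      exact ⟨A, fun a ha => (hA a ha).1, z, hz', hzm⟩
    | succ n ih =>
      obtain ⟨A, hA, y, hy, hym⟩ := ih
      obtain ⟨w, hw, A', hA', z, hz, hzm⟩ := hcon' A hA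
      exact ⟨A', fun a ha => (hA' a ha).1, y * z,
        mul_mem_boundedSpan hw (fun a ha => (hA' a ha).2) hy hz, by rw [hl, hzm, hym]⟩
  -- No monomial satisfies `N + 1 ≤ |q| ≤ N`, so `y = 0` although `y` fixes `m ≠ 0`.
  obtain ⟨A, -, y, hy, hym⟩ := key (N + 1)
  rw [boundedSpan_eq_bot (Nat.lt_succ_self N), Submodule.mem_bot] at hy
  rw [hy, map_zero] at hym
  exact hm0 hym.symm

theorem hasICSP_of_primitive {P : TwoSidedIdeal (LeavittPathAlgebra K G)}
    (h : IsGradedLeftPrimitive (grading K G) P) : G.HasICSP (vertexSet P)ᶜ := by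
  obtain ⟨-, M, _, act, ℳ, hl, hs, hann⟩ := h
  obtain ⟨j, m, hm, hm0⟩ : ∃ j, ∃ m ∈ ℳ j, m ≠ 0 := by
    obtain ⟨x, hx⟩ := hs.act_ne_zero
    obtain ⟨j, m, hm, hne⟩ := exists_homogeneous_act_ne_zero hs.isInternal hx
    exact ⟨j, m, hm, fun h0 => hne (by rw [h0, map_zero])⟩
  have hΓ : ∀ N, ∃ C : Finset V, (∀ a ∈ C, a ∉ vertexSet P) ∧ ∀ w, (∃ A : Finset V,
      (∀ a ∈ A, a ∉ vertexSet P ∧ G.Geq w a) ∧ ∃ z ∈ zeroSpan K G N A, act z m = m) →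
      w ∈ G.rootSet C :=
    fun N => exists_finset_of_zeroSpan_act hl hm0 N
  choose C hC hΓC using hΓ
  refine ⟨⋃ N, (C N : Set V), Set.countable_iUnion fun N => (C N).countable_toSet, ?_, ?_⟩
  · intro a ha
    obtain ⟨N, hN⟩ := Set.mem_iUnion.1 ha
    exact hC N a hN
  · intro w hw
    obtain ⟨N, A, hA, z, hz, hzm⟩ := exists_zeroSpan_act hl hs hann hm hm0 hw
    obtain ⟨a, ha, hwa⟩ := hΓC N w ⟨A, hA, z, hz, hzm⟩
    exact ⟨a, Set.mem_iUnion.2 ⟨N, ha⟩, hwa⟩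

theorem isPrimitivePair_of_primitive {P : TwoSidedIdeal (LeavittPathAlgebra K G)}
    (h : IsGradedLeftPrimitive (grading K G) P) :
    G.IsPrimitivePair (vertexSet P) (breakingSet P) :=
  ⟨isAdmissible_sets P, isDownwardsDirected_of_primitive h, hasICSP_of_primitive h,
    breakingSet_of_primitive h⟩

end Separation

end LeavittPathAlgebra

/-! ### The main theorem -/

theorem mainTheorem2 {K : Type u} [Field K] {V : Type v} {E : Type w} (G : DirGraph V E)
    (P : TwoSidedIdeal (LeavittPathAlgebra K G)) :
    List.TFAE [
      IsGradedPrimitive (LeavittPathAlgebra.grading K G) P,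
      ∃ H S : Set V, LeavittPathAlgebra.IsIdealOf P H S ∧
        G.IsDownwardsDirected Hᶜ ∧ G.HasICSP Hᶜ ∧
        (S = G.breaking H ∨ ∃ a ∈ G.breaking H, Hᶜ = G.root a ∧ S = G.breaking H \ {a}),
      ∃! i : Fin 4, (![LeavittPathAlgebra.DecreasingPathCondition P,
        LeavittPathAlgebra.NoEdgesCondition P,
        LeavittPathAlgebra.ExtremeCycleCondition P,
        LeavittPathAlgebra.ExclusiveCycleCondition P] : Fin 4 → Prop) i] := by
  have hcases : ∀ i : Fin 4, (![LeavittPathAlgebra.DecreasingPathCondition P,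
        LeavittPathAlgebra.NoEdgesCondition P,
        LeavittPathAlgebra.ExtremeCycleCondition P,
        LeavittPathAlgebra.ExclusiveCycleCondition P] : Fin 4 → Prop) i →
      ∃ H S : Set V, G.IsAdmissible H S ∧ P = LeavittPathAlgebra.idealOf K G H S ∧
        (![G.PathCase H S, G.NoEdgesCase H S, G.ExtremeCase H S, G.ExclusiveCase H S] :
          Fin 4 → Prop) i := by
    intro i hi
    fin_cases i
    · obtain ⟨H, α, ⟨hadm, hP⟩, h⟩ := hi
      exact ⟨H, _, hadm, hP, α, rfl, h⟩
    · obtain ⟨H, a, ⟨hadm, hP⟩, h⟩ := hi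
      exact ⟨H, _, hadm, hP, a, rfl, h⟩
    · obtain ⟨H, S, a, c, ⟨hadm, hP⟩, h⟩ := hi
      exact ⟨H, S, hadm, hP, a, c, h⟩
    · obtain ⟨H, S, a, c, ⟨hadm, hP⟩, h⟩ := hi
      exact ⟨H, S, hadm, hP, a, c, h⟩
  have hpair : ∀ {H S : Set V}, G.IsAdmissible H S → ∀ i : Fin 4,
      (![G.PathCase H S, G.NoEdgesCase H S, G.ExtremeCase H S, G.ExclusiveCase H S] :
          Fin 4 → Prop) i → G.IsPrimitivePair H S := by
    intro H S hadm i hi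
    fin_cases i
    · exact DirGraph.PathCase.isPrimitivePair hadm hi
    · exact DirGraph.NoEdgesCase.isPrimitivePair hadm hi
    · exact DirGraph.ExtremeCase.isPrimitivePair hadm hi
    · exact DirGraph.ExclusiveCase.isPrimitivePair hadm hi
  tfae_have 1 → 2 := by
    intro h
    obtain ⟨h1, h2⟩ := LeavittPathAlgebra.isPrimitivePair_of_primitive h.1
    exact ⟨_, _, ⟨h1, LeavittPathAlgebra.eq_gradedPart h.1.1⟩, h2⟩
  tfae_have 2 → 1 := by
    rintro ⟨H, S, ⟨hadm, rfl⟩, h⟩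
    exact LeavittPathAlgebra.isGradedPrimitive_of_pair K ⟨hadm, h⟩
  tfae_have 3 → 2 := by
    rintro ⟨i, hi, -⟩
    obtain ⟨H, S, hadm, hP, h⟩ := hcases i hi
    exact ⟨H, S, ⟨hadm, hP⟩, (hpair hadm i h).2⟩
  tfae_have 2 → 3 := by
    rintro ⟨H, S, ⟨hadm, hP⟩, h⟩
    apply existsUnique_of_exists_of_unique
    · rcases DirGraph.IsPrimitivePair.cases ⟨hadm, h⟩ with
        ⟨α, rfl, hc⟩ | ⟨a, rfl, hc⟩ | ⟨a, c, hc⟩ | ⟨a, c, hc⟩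
      · exact ⟨0, H, α, ⟨hadm, hP⟩, hc⟩
      · exact ⟨1, H, a, ⟨hadm, hP⟩, hc⟩
      · exact ⟨2, H, S, a, c, ⟨hadm, hP⟩, hc⟩
      · exact ⟨3, H, S, a, c, ⟨hadm, hP⟩, hc⟩
    -- Each case comes with its own pair, but both vertex sets equal the set of vertices in `P`, so
    -- all cases can be compared for one `H`. The sets `S` may differ, as they play no role in the
    -- exclusion.
    · have hH : ∀ i : Fin 4, (![LeavittPathAlgebra.DecreasingPathCondition P,
          LeavittPathAlgebra.NoEdgesCondition P,
          LeavittPathAlgebra.ExtremeCycleCondition P,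
          LeavittPathAlgebra.ExclusiveCycleCondition P] : Fin 4 → Prop) i →
          ∃ S : Set V, (![G.PathCase H S, G.NoEdgesCase H S, G.ExtremeCase H S,
            G.ExclusiveCase H S] : Fin 4 → Prop) i := by
        intro i hi
        obtain ⟨H', S', hadm', hP', h'⟩ := hcases i hi
        have h1 := (LeavittPathAlgebra.isGradedLeftPrimitive_of_pair K (hpair hadm' i h')).2
        have h2 := (LeavittPathAlgebra.isGradedLeftPrimitive_of_pair K
          (H := H) (S := S) ⟨hadm, h⟩).2
        rw [← hP'] at h1
        rw [← hP, h1] at h2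
        exact ⟨S', h2 ▸ h'⟩
      have hlt : ∀ i j : Fin 4, i < j → ∀ S S' : Set V,
          (![G.PathCase H S, G.NoEdgesCase H S, G.ExtremeCase H S,
            G.ExclusiveCase H S] : Fin 4 → Prop) i →
          (![G.PathCase H S', G.NoEdgesCase H S', G.ExtremeCase H S',
            G.ExclusiveCase H S'] : Fin 4 → Prop) j → False := by
        intro i j hij S S' hi hj
        fin_cases i <;> fin_cases j <;> try exact absurd hij (by decide)
        · obtain ⟨a, -, ha, -⟩ := hj
          exact DirGraph.PathCase.not_root hi ha
        · obtain ⟨a, c, ha, -⟩ := hj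
          exact DirGraph.PathCase.not_root hi ha
        · obtain ⟨a, c, ha, -⟩ := hj
          exact DirGraph.PathCase.not_root hi ha
        · obtain ⟨a, c, ha, hc, hac, -⟩ := hj
          exact DirGraph.NoEdgesCase.not_cycle hi hc.1 hac ha
        · obtain ⟨a, c, ha, hc, hac, -⟩ := hj
          exact DirGraph.NoEdgesCase.not_cycle hi hc.1 hac ha
        · exact DirGraph.ExtremeCase.not_exclusive hi hj
      intro i j hi hj
      obtain ⟨S₁, h₁⟩ := hH i hi
      obtain ⟨S₂, h₂⟩ := hH j hj
      rcases lt_trichotomy i j with hij | hij | hij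
      · exact (hlt i j hij S₁ S₂ h₁ h₂).elim
      · exact hij
      · exact (hlt j i hij S₂ S₁ h₂ h₁).elim
  tfae_finish
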